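/- Let $\lambda\in\mathbb{R}\setminus\{0\}$. An $\mathrm{Sp}(2)$-invariant Laplacian soliton with dilation constant $\lambda$ on $(a,T)\times\mathbb{CP}^3$, where $-\infty<a<T\le\infty$ (an expander if $\lambda>0$, a shrinker if $\lambda<0$), is described by functions $x,y>0$, $\tau_1,\tau_2,u$ on $(a,T)$ satisfying \[ \tau_1=(x^2)'-2x+\frac{x^3}{y^2},\qquad \tau_2=(y^2)'-x,\qquad (xy^2)'=\tfrac12x^2+y^2, \] \[ (\tau_1-ux^2)'=\lambda x^2,\qquad(\tau_2-uy^2)'=\lambda y^2,\qquad \tau_1+2\tau_2=u(x^2+2y^2)+2\lambda xy^2 . \] Here $\varphi=(x^2\omega_1+y^2\omega_2)\wedge dt+xy^2\alpha$ is the closed $\mathrm{G}_2$-structure, $\tau=\tau_1\omega_1+\tau_2\omega_2$ its torsion and $u\,\partial_t$ the soliton vector field, where $\omega_1,\omega_2$ is a suitable basis of the invariant $2$-forms on $\mathbb{CP}^3$ and $\alpha$ an invariant closed $3$-form. A soliton end is such a solution that is forward-inextensible, i.e. does not extend to a solution on $(a,T')$ for any $T'>T$; it is forward complete if $T=\infty$.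 A closed $\mathrm{Sp}(2)$-invariant $\mathrm{G}_2$-cone is a pair $c_1,c_2>0$ with $6c_1c_2^2=c_1^2+2c_2^2$ (it corresponds to $x=c_1t$, $y=c_2t$). An end with $T=\infty$ is asymptotic to it with rate at least $-2$ if, up to a translation of $t$, $x=c_1t+O(t^{-1})$ and $y=c_2t+O(t^{-1})$ as $t\to\infty$. Every $\mathrm{Sp}(2)$-invariant soliton end with $\lambda\neq0$ satisfies exactly one of the following. (i) It is forward complete and $\log\frac yx$ is bounded as $t\to\infty$. Then it is asymptotic with rate at least $-2$ to a unique closed $\mathrm{Sp}(2)$-invariant $\mathrm{G}_2$-cone. (ii) It is forward complete and $|\log\frac yx|\to\infty$ as $t\to\infty$. Then: (a) if $\lambda>0$, then $tx\to\frac3\lambda$ and $\frac{\log(xy^2)}{t^2}\to\frac\lambda6$ as $t\to\infty$; in particular $x\to0$ and $\frac{\log y}{t^2}\to\frac{\lambda}{12}$; (b) if $\lambda<0$, then $\frac{\log x}{t}\to\sqrt{\frac{-\lambda}{18}}$ and $\frac{y^4}{x^2}\to-\frac{9}{8\lambda}$ as $t\to\infty$; in particular $\frac{\log y}{t}\to\frac12\sqrt{\frac{-\lambda}{18}}$.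 (iii) It has a finite maximal forward existence time $t_*=T<\infty$. Then $\frac yx\to\infty$, $x=O\big((t_*-t)^{1/2}\big)$ and $y=O\big((t_*-t)^{-1/4}\big)$ as $t\to t_*$. -/

import Mathlib

open Filter Topology Asymptotics

/-- The quintuple `(x, y, τ₁, τ₂, u)` solves, on the open interval `(a, T)`, the ODE system of
`Sp(2)`-invariant Laplacian solitons with dilation constant `lam`.  Here
`φ = (x² ω₁ + y² ω₂) ∧ dt + x y² α` is a closed `Sp(2)`-invariant G₂-structure on
`(a, T) × ℂP³` with `∂_t` of unit length, `τ = τ₁ ω₁ + τ₂ ω₂` is its torsion and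
`X = u ∂_t` is the soliton vector field. -/
structure IsSp2Soliton (lam a : ℝ) (T : EReal) (x y τ₁ τ₂ u : ℝ → ℝ) : Prop where
  x_pos : ∀ t : ℝ, a < t → (t : EReal) < T → 0 < x t
  y_pos : ∀ t : ℝ, a < t → (t : EReal) < T → 0 < y t
  /-- `τ₁ = (x²)' - 2x + x³/y²` -/
  torsion₁ : ∀ t : ℝ, a < t → (t : EReal) < T →
    HasDerivAt (fun s => x s ^ 2) (τ₁ t + 2 * x t - x t ^ 3 / y t ^ 2) t
  /-- `τ₂ = (y²)' - x` -/
  torsion₂ : ∀ t : ℝ, a < t → (t : EReal) < T →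
    HasDerivAt (fun s => y s ^ 2) (τ₂ t + x t) t
  /-- `(x y²)' = x²/2 + y²`, i.e. `dφ = 0` -/
  closure : ∀ t : ℝ, a < t → (t : EReal) < T →
    HasDerivAt (fun s => x s * y s ^ 2) (x t ^ 2 / 2 + y t ^ 2) t
  /-- `(τ₁ - u x²)' = λ x²` -/
  soliton₁ : ∀ t : ℝ, a < t → (t : EReal) < T →
    HasDerivAt (fun s => τ₁ s - u s * x s ^ 2) (lam * x t ^ 2) t
  /-- `(τ₂ - u y²)' = λ y²` -/
  soliton₂ : ∀ t : ℝ, a < t → (t : EReal) < T →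
    HasDerivAt (fun s => τ₂ s - u s * y s ^ 2) (lam * y t ^ 2) t
  /-- `τ₁ + 2 τ₂ = u (x² + 2 y²) + 2 λ x y²` -/
  conserved : ∀ t : ℝ, a < t → (t : EReal) < T →
    τ₁ t + 2 * τ₂ t = u t * (x t ^ 2 + 2 * y t ^ 2) + 2 * lam * (x t * y t ^ 2)

/-- A soliton end: a solution of the soliton ODE system on a nonempty interval `(a, T)`,
`a < T ≤ ∞`, that does not extend to a solution on any `(a, T')` with `T' > T`. -/
structure IsSp2SolitonEnd (lam a : ℝ) (T : EReal) (x y τ₁ τ₂ u : ℝ → ℝ) : Prop where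
  lt : (a : EReal) < T
  soliton : IsSp2Soliton lam a T x y τ₁ τ₂ u
  inextensible : ∀ (T' : EReal) (x' y' τ₁' τ₂' u' : ℝ → ℝ), T < T' →
    IsSp2Soliton lam a T' x' y' τ₁' τ₂' u' →
    ¬ ∀ t : ℝ, a < t → (t : EReal) < T →
      x' t = x t ∧ y' t = y t ∧ τ₁' t = τ₁ t ∧ τ₂' t = τ₂ t ∧ u' t = u t

/-- The cone `x = c₁ t`, `y = c₂ t` defines a closed `Sp(2)`-invariant G₂-cone. -/
def IsClosedSp2Cone (c₁ c₂ : ℝ) : Prop :=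
  0 < c₁ ∧ 0 < c₂ ∧ 6 * c₁ * c₂ ^ 2 = c₁ ^ 2 + 2 * c₂ ^ 2

/-- Up to a translation of `t`, `x = c₁ t + O(t⁻¹)` and `y = c₂ t + O(t⁻¹)` as `t → ∞`:
the end is asymptotic with rate (at least) `-2` to the cone `(c₁, c₂)`. -/
def IsAsymptoticRateNegTwo (x y : ℝ → ℝ) (c₁ c₂ : ℝ) : Prop :=
  ∃ k : ℝ, (fun t => x t - c₁ * (t + k)) =O[atTop] (fun t : ℝ => t⁻¹) ∧
    (fun t => y t - c₂ * (t + k)) =O[atTop] (fun t : ℝ => t⁻¹)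

/-- Forward complete with `log (y/x)` forward-bounded. -/
def IsBoundedWarpingEnd (T : EReal) (x y : ℝ → ℝ) : Prop :=
  T = ⊤ ∧ ∃ C : ℝ, ∀ᶠ t in atTop, |Real.log (y t / x t)| ≤ C

/-- Forward complete with `|log (y/x)| → ∞`. -/
def IsUnboundedWarpingEnd (T : EReal) (x y : ℝ → ℝ) : Prop :=
  T = ⊤ ∧ Tendsto (fun t => |Real.log (y t / x t)|) atTop atTop

/-- Finite maximal forward existence time. -/
def IsForwardIncompleteEnd (T : EReal) : Prop :=
  ∃ tstar : ℝ, T = (tstar : EReal)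

/-! ### Real-variable lemmas on half-lines -/

/-! Closure and the torsion equations force `y²τ₁ + 2x²τ₂ = 0`. With the conserved quantity this
makes `τ₁, τ₂, u` rational functions of `x`, `v = xy²` and `p = τ₁ - ux²`, so the problem is a
three-dimensional ODE, regular as long as `x, v > 0`. Since `v' = x²/2 + v/x > 0`, the first
question is whether `v` stays bounded.

If `v` is bounded, then `T < ∞`, because `v → ∞` on an infinite half-line. As `|p'| ≤ 2|λ|v'`, both
`v` and `p` converge, and so does `x²` (`exists_limits`). A positive limit of `x` would allow an
extension, so `x → 0`. The limit of `p` must then be negative (`limit_p_neg`), hence `x²` vanishes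
linearly, and the bound on `xy²` controls `y`.

If `v` is unbounded, take `s = log v` as time and put `P = p/λ`, `z = 2y²/(x² + 2y²)`, `θ = 1 -
e⁻ˢP/2`. Then `θ' = z - θ` and `z' = z(1-z)R` with `R = 4 - 6z - 2λ(eˢ/x)(z - θ)`. Thus `θ` is a
running average of `z`, while the last term pulls `z` to `θ` when `λ > 0` and pushes it away when `λ
< 0`. While `z` stays in a compact part of `(0,1)`, `eˢ/x` is comparable to `e^{2s/3}`, so `z - θ =
O(e^{-2s/3})`: by damping for `λ > 0`, and because a larger gap would grow inadmissibly fast for `λ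
< 0`. Hence `z` converges, and integrating `dt/ds = zx` gives a cone (`conical`).

For expanders, `eˢ - P/2` eventually becomes positive, which keeps `z` away from `0`. If `P` is ever
positive, `z` also stays away from `1` and the end is conical. If `P ≤ 0` throughout, then `x, P →
0`, `x` is slaved to `-λP/3`, and the reduced equation gives `tx → 3/λ`.

For shrinkers, `θ` converges and the instability forces `z` to the same limit `l`. The value `l = 1`
would make `x` blow up at a finite `s`, and `0 < l < 1` is conical. For `l = 0` the pair `a = -R/3`,
`n = -(8λ/9)y⁴/x²` obeys a planar system perturbed by `z → 0`. An energy and Barbalat arguments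
force convergence to the equilibrium `(1/6, 1)` (`tendsto_equilibrium`), from which the rates are
read off. In every unbounded case `t → ∞`, so `T = ∞`. -/

theorem monotoneOn_Ici_of_hasDerivAt_nonneg {f f' : ℝ → ℝ} {s₀ : ℝ}
    (hf : ∀ s, s₀ ≤ s → HasDerivAt f (f' s) s) (h : ∀ s, s₀ ≤ s → 0 ≤ f' s) :
    MonotoneOn f (Set.Ici s₀) := by
  refine monotoneOn_of_deriv_nonneg (convex_Ici s₀)
    (fun s hs => (hf s hs).continuousAt.continuousWithinAt)
    (fun s hs => ?_) (fun s hs => ?_)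
  · rw [interior_Ici] at hs
    exact (hf s (le_of_lt hs)).differentiableAt.differentiableWithinAt
  · rw [interior_Ici] at hs
    rw [(hf s (le_of_lt hs)).deriv]
    exact h s (le_of_lt hs)

theorem antitoneOn_Ici_of_hasDerivAt_nonpos {f f' : ℝ → ℝ} {s₀ : ℝ}
    (hf : ∀ s, s₀ ≤ s → HasDerivAt f (f' s) s) (h : ∀ s, s₀ ≤ s → f' s ≤ 0) :
    AntitoneOn f (Set.Ici s₀) := by
  have := monotoneOn_Ici_of_hasDerivAt_nonneg (f := fun s => -f s) (f' := fun s => -f' s)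
    (fun s hs => (hf s hs).neg) (fun s hs => by linarith [h s hs])
  intro a ha b hb hab
  have := this ha hb hab
  simp only at this
  linarith

theorem monotoneOn_Icc_of_hasDerivAt_nonneg {f f' : ℝ → ℝ} {s₀ s₁ : ℝ}
    (hf : ∀ s ∈ Set.Icc s₀ s₁, HasDerivAt f (f' s) s) (h : ∀ s ∈ Set.Icc s₀ s₁, 0 ≤ f' s) :
    MonotoneOn f (Set.Icc s₀ s₁) := by
  refine monotoneOn_of_deriv_nonneg (convex_Icc s₀ s₁)
    (fun s hs => (hf s hs).continuousAt.continuousWithinAt)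
    (fun s hs => ?_) (fun s hs => ?_)
  · rw [interior_Icc] at hs
    exact (hf s (Set.Ioo_subset_Icc_self hs)).differentiableAt.differentiableWithinAt
  · rw [interior_Icc] at hs
    rw [(hf s (Set.Ioo_subset_Icc_self hs)).deriv]
    exact h s (Set.Ioo_subset_Icc_self hs)

/-- A function whose derivative is bounded below by `c` grows at least linearly. -/
theorem linear_growth_le {f f' : ℝ → ℝ} {s₀ c : ℝ}
    (hf : ∀ s, s₀ ≤ s → HasDerivAt f (f' s) s) (h : ∀ s, s₀ ≤ s → c ≤ f' s) :
    ∀ s, s₀ ≤ s → f s₀ + c * (s - s₀) ≤ f s := by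
  intro s hs
  have := monotoneOn_Ici_of_hasDerivAt_nonneg (f := fun s => f s - c * s)
    (f' := fun s => f' s - c)
    (fun s hs => by simpa using (hf s hs).fun_sub ((hasDerivAt_id s).const_mul c))
    (fun s hs => by linarith [h s hs]) (Set.self_mem_Ici) hs hs
  simp only at this
  linarith

theorem tendsto_atTop_of_le_hasDerivAt {f f' : ℝ → ℝ} {s₀ c : ℝ} (hc : 0 < c)
    (hf : ∀ s, s₀ ≤ s → HasDerivAt f (f' s) s) (h : ∀ s, s₀ ≤ s → c ≤ f' s) :
    Tendsto f atTop atTop := by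
  have h1 : Tendsto (fun s => f s₀ + c * (s - s₀)) atTop atTop :=
    tendsto_atTop_add_const_left _ _
      ((tendsto_atTop_add_const_right _ (-s₀) tendsto_id).const_mul_atTop hc)
  refine tendsto_atTop_mono' _ ?_ h1
  filter_upwards [eventually_ge_atTop s₀] with s hs using linear_growth_le hf h s hs

/-- Barrier principle: if `f` starts above `c` and its derivative is positive whenever it returns
to the value `c` for the first time, then `f` stays above `c`. -/
theorem barrier_ge_Icc {f f' : ℝ → ℝ} {s₀ b c : ℝ} (hb : s₀ ≤ b)
    (hf : ∀ s, s₀ ≤ s → s ≤ b → HasDerivAt f (f' s) s) (h₀ : c ≤ f s₀)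
    (h : ∀ s, s₀ ≤ s → s ≤ b → (∀ σ, s₀ ≤ σ → σ ≤ s → c ≤ f σ) → f s = c → 0 < f' s) :
    c ≤ f b := by
  by_contra hlt
  push Not at hlt
  -- `S` collects the times up to which the bound has held. At its supremum the bound persists by
  -- continuity, and strictness or the positive derivative carries it further.
  set S : Set ℝ := {s | s ∈ Set.Icc s₀ b ∧ ∀ σ, s₀ ≤ σ → σ ≤ s → c ≤ f σ} with hS
  have hS0 : s₀ ∈ S := ⟨⟨le_rfl, hb⟩, fun σ h1 h2 => by rwa [le_antisymm h2 h1]⟩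
  have hSb : BddAbove S := ⟨b, fun s hs => hs.1.2⟩
  set m := sSup S with hm
  have hm0 : s₀ ≤ m := le_csSup hSb hS0
  have hmb : m ≤ b := csSup_le ⟨s₀, hS0⟩ fun s hs => hs.1.2
  have hbelow : ∀ σ, s₀ ≤ σ → σ < m → c ≤ f σ := by
    intro σ h1 h2
    obtain ⟨s, hs, hσs⟩ := exists_lt_of_lt_csSup ⟨s₀, hS0⟩ h2
    exact hs.2 σ h1 hσs.le
  have hcm : c ≤ f m := by
    rcases hm0.eq_or_lt with he | hlt'
    · rw [← he]; exact h₀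
    · have : Tendsto f (𝓝[<] m) (𝓝 (f m)) := (hf m hm0 hmb).continuousAt.tendsto.mono_left
        nhdsWithin_le_nhds
      refine ge_of_tendsto this ?_
      filter_upwards [Ioo_mem_nhdsLT hlt'] with σ hσ using hbelow σ hσ.1.le hσ.2
  have hall : ∀ σ, s₀ ≤ σ → σ ≤ m → c ≤ f σ := by
    intro σ h1 h2
    rcases h2.eq_or_lt with he | h3
    · rw [he]; exact hcm
    · exact hbelow σ h1 h3
  have hmltb : m < b := lt_of_le_of_ne hmb (by rintro he; rw [he] at hcm; linarith)
  have hev : ∀ᶠ σ in 𝓝[>] m, c ≤ f σ := by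
    rcases hcm.eq_or_lt with he | h1
    · have hd := h m hm0 hmb hall he.symm
      have := (hasDerivAt_iff_tendsto_slope.1 (hf m hm0 hmb)).mono_left
        (nhdsWithin_mono m (fun s (hs : m < s) => hs.ne'))
      filter_upwards [this.eventually (lt_mem_nhds hd), self_mem_nhdsWithin] with σ hσ hmσ
      rw [slope_def_field] at hσ
      have h2 : 0 < σ - m := sub_pos.2 hmσ
      have := (div_pos_iff_of_pos_right h2).1 hσ
      linarith
    · filter_upwards [((hf m hm0 hmb).continuousAt.tendsto.mono_left
        nhdsWithin_le_nhds).eventually (lt_mem_nhds h1)] with σ hσ using hσ.le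
  obtain ⟨u, hu, hu2⟩ := mem_nhdsGT_iff_exists_Ioc_subset.1 hev
  have hmem : min u b ∈ S := by
    refine ⟨⟨le_min (hm0.trans (le_of_lt hu)) hb, min_le_right _ _⟩, fun σ h1 h2 => ?_⟩
    rcases le_or_gt σ m with h3 | h3
    · exact hall σ h1 h3
    · exact hu2 ⟨h3, h2.trans (min_le_left _ _)⟩
  have := le_csSup hSb hmem
  have h4 : m < min u b := lt_min hu hmltb
  linarith

theorem barrier_ge {f f' : ℝ → ℝ} {s₀ c : ℝ} (hf : ∀ s, s₀ ≤ s → HasDerivAt f (f' s) s)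
    (h₀ : c ≤ f s₀)
    (h : ∀ s, s₀ ≤ s → (∀ σ, s₀ ≤ σ → σ ≤ s → c ≤ f σ) → f s = c → 0 < f' s) :
    ∀ s, s₀ ≤ s → c ≤ f s := fun _ hb =>
  barrier_ge_Icc hb (fun s hs _ => hf s hs) h₀ (fun s hs _ => h s hs)

theorem barrier_le {f f' : ℝ → ℝ} {s₀ c : ℝ} (hf : ∀ s, s₀ ≤ s → HasDerivAt f (f' s) s)
    (h₀ : f s₀ ≤ c)
    (h : ∀ s, s₀ ≤ s → (∀ σ, s₀ ≤ σ → σ ≤ s → f σ ≤ c) → f s = c → f' s < 0) :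
    ∀ s, s₀ ≤ s → f s ≤ c := by
  have := barrier_ge (f := fun s => -f s) (f' := fun s => -f' s) (c := -c)
    (fun s hs => (hf s hs).neg) (by simpa using h₀)
    (fun s hs h1 h2 => by
      have := h s hs (fun σ a b => by simpa using h1 σ a b) (by simpa using h2)
      simpa using this)
  intro s hs
  simpa using this s hs

theorem exists_tendsto_of_monotoneOn_Ici {f : ℝ → ℝ} {s₀ B : ℝ}
    (hf : MonotoneOn f (Set.Ici s₀)) (hB : ∀ s, s₀ ≤ s → f s ≤ B) :
    ∃ L, Tendsto f atTop (𝓝 L) ∧ ∀ s, s₀ ≤ s → f s ≤ L := by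
  have hm : Monotone fun s => f (max s₀ s) := fun a b hab =>
    hf (Set.mem_Ici.2 (le_max_left _ _)) (Set.mem_Ici.2 (le_max_left _ _)) (max_le_max le_rfl hab)
  have hbd : BddAbove (Set.range fun s => f (max s₀ s)) :=
    ⟨B, by rintro _ ⟨s, rfl⟩; exact hB _ (le_max_left _ _)⟩
  refine ⟨_, (tendsto_atTop_ciSup hm hbd).congr' ?_, fun s hs => ?_⟩
  · filter_upwards [eventually_ge_atTop s₀] with s hs
    rw [max_eq_right hs]
  · have := le_ciSup hbd s
    simpa only [max_eq_right hs] using this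

theorem exists_tendsto_of_antitoneOn_Ici {f : ℝ → ℝ} {s₀ B : ℝ}
    (hf : AntitoneOn f (Set.Ici s₀)) (hB : ∀ s, s₀ ≤ s → B ≤ f s) :
    ∃ L, Tendsto f atTop (𝓝 L) ∧ ∀ s, s₀ ≤ s → L ≤ f s := by
  obtain ⟨L, h1, h2⟩ := exists_tendsto_of_monotoneOn_Ici (f := fun s => -f s) (B := -B)
    (fun a ha b hb hab => neg_le_neg (hf ha hb hab)) (fun s hs => neg_le_neg (hB s hs))
  exact ⟨-L, by simpa using h1.neg, fun s hs => by linarith [h2 s hs]⟩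

theorem abs_sub_le_of_hasDerivAt_bound {f f' : ℝ → ℝ} {s₀ C : ℝ}
    (hf : ∀ s, s₀ ≤ s → HasDerivAt f (f' s) s) (h : ∀ s, s₀ ≤ s → |f' s| ≤ C)
    {a b : ℝ} (ha : s₀ ≤ a) (hb : s₀ ≤ b) : |f b - f a| ≤ C * |b - a| := by
  have := (convex_Ici s₀).norm_image_sub_le_of_norm_hasDerivWithin_le
    (f := f) (f' := f') (C := C) (fun s hs => (hf s hs).hasDerivWithinAt)
    (fun s hs => by simpa using h s hs) (x := a) (y := b) ha hb
  simpa using this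

/-- Barbalat-type lemma: if `F` converges, `F'` is nonnegative and is bounded away from zero where
`|k| ≥ ε`, and `k` is Lipschitz, then `k → 0`. -/
theorem tendsto_zero_of_convergent_of_lipschitz {F F' k k' : ℝ → ℝ} {s₀ C L : ℝ}
    (hF : ∀ s, s₀ ≤ s → HasDerivAt F (F' s) s) (hL : Tendsto F atTop (𝓝 L))
    (hk : ∀ s, s₀ ≤ s → HasDerivAt k (k' s) s) (hkC : ∀ s, s₀ ≤ s → |k' s| ≤ C)
    (h : ∀ ε > 0, ∃ δ > 0, ∀ᶠ s in atTop, ε ≤ |k s| → δ ≤ F' s) :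
    Tendsto k atTop (𝓝 0) := by
  have hC : 0 ≤ C := (abs_nonneg _).trans (hkC s₀ le_rfl)
  rw [Metric.tendsto_atTop]
  intro ε hε
  obtain ⟨δ, hδ, hev⟩ := h (ε / 2) (by positivity)
  obtain ⟨N, hN⟩ := eventually_atTop.1 hev
  -- In time `d` a `C`-Lipschitz function starting at size `ε` cannot drop below `ε / 2`, so `F`
  -- would gain `δ d` there, too much for a convergent function.
  set d := ε / (2 * (C + 1)) with hd
  have hdpos : 0 < d := by positivity
  obtain ⟨N', hN'⟩ := Metric.tendsto_atTop.1 hL (δ * d / 2) (by positivity)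
  refine ⟨max s₀ (max N N'), fun s hs => ?_⟩
  have hs0 : s₀ ≤ s := (le_max_left _ _).trans hs
  have hsN : N ≤ s := (le_max_left _ _).trans ((le_max_right _ _).trans hs)
  have hsN' : N' ≤ s := (le_max_right _ _).trans ((le_max_right _ _).trans hs)
  rw [Real.dist_eq, sub_zero]
  by_contra hge
  push Not at hge
  have hbig : ∀ σ ∈ Set.Icc s (s + d), ε / 2 ≤ |k σ| := by
    intro σ hσ
    have h1 := abs_sub_le_of_hasDerivAt_bound hk hkC hs0 (hs0.trans hσ.1)
    rw [abs_of_nonneg (sub_nonneg.2 hσ.1)] at h1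
    have h2 : C * (σ - s) ≤ C * d := by
      apply mul_le_mul_of_nonneg_left _ hC; linarith [hσ.2]
    have h3 : C * d ≤ ε / 2 := by
      rw [hd, ← mul_div_assoc, div_le_div_iff₀ (by positivity) (by positivity)]
      nlinarith
    have h4 := abs_sub_abs_le_abs_sub (k s) (k σ)
    rw [abs_sub_comm] at h4
    linarith
  have hmono := monotoneOn_Icc_of_hasDerivAt_nonneg (f := fun σ => F σ - δ * σ)
    (f' := fun σ => F' σ - δ) (s₀ := s) (s₁ := s + d)
    (fun σ hσ => by
      simpa using (hF σ (hs0.trans hσ.1)).fun_sub ((hasDerivAt_id σ).const_mul δ))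
    (fun σ hσ => sub_nonneg.2 (hN σ (hsN.trans hσ.1) (hbig σ hσ)))
    ⟨le_rfl, by linarith⟩ ⟨by linarith, le_rfl⟩ (by linarith)
  simp only at hmono
  have h1 := hN' s hsN'
  have h2 := hN' (s + d) (by linarith)
  rw [Real.dist_eq, abs_lt] at h1 h2
  nlinarith

/-- Barbalat's lemma with a vanishing error term. -/
theorem tendsto_zero_of_convergent_deriv_asymp {f f' g g' : ℝ → ℝ} {s₀ C L : ℝ}
    (hf : ∀ s, s₀ ≤ s → HasDerivAt f (f' s) s) (hL : Tendsto f atTop (𝓝 L))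
    (hg : ∀ s, s₀ ≤ s → HasDerivAt g (g' s) s) (hgC : ∀ s, s₀ ≤ s → |g' s| ≤ C)
    (h : Tendsto (fun s => f' s - g s) atTop (𝓝 0)) :
    Tendsto g atTop (𝓝 0) := by
  -- Only the upper bound needs an argument; the lower one is the same statement for `-f` and `-g`.
  have key : ∀ {f f' g g' : ℝ → ℝ} {L : ℝ},
      (∀ s, s₀ ≤ s → HasDerivAt f (f' s) s) → Tendsto f atTop (𝓝 L) →
      (∀ s, s₀ ≤ s → HasDerivAt g (g' s) s) → (∀ s, s₀ ≤ s → |g' s| ≤ C) →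
      Tendsto (fun s => f' s - g s) atTop (𝓝 0) → ∀ ε > 0, ∀ᶠ s in atTop, g s < ε := by
    intro f f' g g' L hf hL hg hgC h ε hε
    have hC : 0 ≤ C := (abs_nonneg _).trans (hgC s₀ le_rfl)
    obtain ⟨N, hN⟩ := Metric.tendsto_atTop.1 h (ε / 4) (by positivity)
    set d := ε / (2 * (C + 1)) with hd
    have hdpos : 0 < d := by positivity
    obtain ⟨N', hN'⟩ := Metric.tendsto_atTop.1 hL (ε / 4 * d / 2) (by positivity)
    filter_upwards [eventually_ge_atTop s₀, eventually_ge_atTop N, eventually_ge_atTop N'] with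
      s hs0 hsN hsN'
    by_contra hge
    push Not at hge
    have hbig : ∀ σ ∈ Set.Icc s (s + d), ε / 4 ≤ f' σ := by
      intro σ hσ
      have h1 := abs_sub_le_of_hasDerivAt_bound hg hgC hs0 (hs0.trans hσ.1)
      rw [abs_of_nonneg (sub_nonneg.2 hσ.1), abs_le] at h1
      have h2 : C * (σ - s) ≤ C * d := by
        apply mul_le_mul_of_nonneg_left _ hC; linarith [hσ.2]
      have h3 : C * d ≤ ε / 2 := by
        rw [hd, ← mul_div_assoc, div_le_div_iff₀ (by positivity) (by positivity)]
        nlinarith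
      have h4 := hN σ (hsN.trans hσ.1)
      rw [Real.dist_eq, sub_zero, abs_lt] at h4
      linarith [h1.1, h4.1]
    have hmono := monotoneOn_Icc_of_hasDerivAt_nonneg (f := fun σ => f σ - ε / 4 * σ)
      (f' := fun σ => f' σ - ε / 4) (s₀ := s) (s₁ := s + d)
      (fun σ hσ => by
        simpa using (hf σ (hs0.trans hσ.1)).fun_sub ((hasDerivAt_id σ).const_mul (ε / 4)))
      (fun σ hσ => sub_nonneg.2 (hbig σ hσ))
      ⟨le_rfl, by linarith⟩ ⟨by linarith, le_rfl⟩ (by linarith)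
    simp only at hmono
    have h1 := hN' s hsN'
    have h2 := hN' (s + d) (by linarith)
    rw [Real.dist_eq, abs_lt] at h1 h2
    nlinarith
  rw [Metric.tendsto_nhds]
  intro ε hε
  have h1 := key hf hL hg hgC h ε hε
  have h2 := key (f := fun s => -f s) (f' := fun s => -f' s) (g := fun s => -g s)
    (g' := fun s => -g' s) (L := -L) (fun s hs => (hf s hs).neg) hL.neg
    (fun s hs => (hg s hs).neg) (fun s hs => by simpa using hgC s hs)
    (by simpa [sub_eq_add_neg, add_comm] using h.neg) ε hε
  filter_upwards [h1, h2] with s h1 h2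
  rw [Real.dist_eq, sub_zero, abs_lt]
  constructor <;> linarith

theorem deriv_limit_eq_zero {f f' : ℝ → ℝ} {s₀ L l : ℝ}
    (hf : ∀ s, s₀ ≤ s → HasDerivAt f (f' s) s) (hL : Tendsto f atTop (𝓝 L))
    (h : Tendsto f' atTop (𝓝 l)) : l = 0 := by
  have := tendsto_zero_of_convergent_deriv_asymp (g := fun _ => l) (g' := fun _ => 0) (C := 0)
    hf hL (fun s _ => hasDerivAt_const s l) (fun s _ => by simp)
    (by simpa using h.sub_const l)
  exact tendsto_nhds_unique tendsto_const_nhds this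

/-- L'Hôpital's rule at infinity for quotients with denominator tending to infinity. -/
theorem tendsto_div_of_tendsto_deriv_div {f f' g g' : ℝ → ℝ} {s₀ l : ℝ}
    (hf : ∀ s, s₀ ≤ s → HasDerivAt f (f' s) s) (hg : ∀ s, s₀ ≤ s → HasDerivAt g (g' s) s)
    (hg' : ∀ s, s₀ ≤ s → 0 < g' s) (hgt : Tendsto g atTop atTop)
    (h : Tendsto (fun s => f' s / g' s) atTop (𝓝 l)) :
    Tendsto (fun s => f s / g s) atTop (𝓝 l) := by
  have key : ∀ {f f' : ℝ → ℝ} {l : ℝ}, (∀ s, s₀ ≤ s → HasDerivAt f (f' s) s) →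
      Tendsto (fun s => f' s / g' s) atTop (𝓝 l) → ∀ ε > 0, ∀ᶠ s in atTop,
      f s / g s < l + ε := by
    intro f f' l hf h ε hε
    obtain ⟨N, hN⟩ := eventually_atTop.1 (h.eventually (gt_mem_nhds (show l < l + ε / 2 by linarith)))
    set M := max s₀ N
    have hM0 : s₀ ≤ M := le_max_left _ _
    have hanti := antitoneOn_Ici_of_hasDerivAt_nonpos (s₀ := M)
      (f := fun s => f s - (l + ε / 2) * g s) (f' := fun s => f' s - (l + ε / 2) * g' s)
      (fun s hs => (hf s (hM0.trans hs)).sub ((hg s (hM0.trans hs)).const_mul _))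
      (fun s hs => by
        have h1 := hN s ((le_max_right _ _).trans hs)
        rw [div_lt_iff₀ (hg' s (hM0.trans hs))] at h1
        linarith)
    set K := f M - (l + ε / 2) * g M with hK
    filter_upwards [eventually_ge_atTop M, hgt.eventually_gt_atTop 0,
      hgt.eventually_gt_atTop (K / (ε / 2))] with s hs hg0 hgK
    have h1 := hanti Set.self_mem_Ici hs hs
    simp only at h1
    rw [div_lt_iff₀ (by positivity)] at hgK
    rw [div_lt_iff₀ hg0]
    linarith
  rw [Metric.tendsto_nhds]
  intro ε hε
  have h1 := key hf h ε hε
  have h2 := key (f := fun s => -f s) (f' := fun s => -f' s) (l := -l) (fun s hs => (hf s hs).neg)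
    (by simpa [neg_div] using h.neg) ε hε
  filter_upwards [h1, h2] with s h1 h2
  rw [neg_div] at h2
  rw [Real.dist_eq, abs_lt]
  constructor <;> linarith

/-- A function with exponentially decaying derivative converges exponentially fast. -/
theorem exists_limit_of_exp_decay {f f' : ℝ → ℝ} {s₀ C c : ℝ} (hc : 0 < c)
    (hf : ∀ s, s₀ ≤ s → HasDerivAt f (f' s) s)
    (h : ∀ s, s₀ ≤ s → |f' s| ≤ C * Real.exp (-c * s)) :
    ∃ L, ∀ s, s₀ ≤ s → |f s - L| ≤ C / c * Real.exp (-c * s) := by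
  have hE : ∀ s : ℝ, HasDerivAt (fun s => C / c * Real.exp (-c * s)) (-(C * Real.exp (-c * s))) s := by
    intro s
    have h1 : HasDerivAt (fun s : ℝ => -c * s) (-c) s := by
      simpa using (hasDerivAt_id s).const_mul (-c)
    refine (h1.exp.const_mul (C / c)).congr_deriv ?_
    rw [mul_comm (Real.exp _), ← mul_assoc, mul_neg, div_mul_cancel₀ _ hc.ne', neg_mul]
  have hE0 : Tendsto (fun s => C / c * Real.exp (-c * s)) atTop (𝓝 0) := by
    have : Tendsto (fun s : ℝ => -c * s) atTop atBot :=
      tendsto_id.const_mul_atTop_of_neg (by linarith)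
    simpa using (Real.tendsto_exp_atBot.comp this).const_mul (C / c)
  -- Adding or subtracting the tail integral of the bound makes `f` monotone in opposite directions.
  -- The two limits agree because the tail tends to zero.
  have hanti : AntitoneOn (fun s => f s + C / c * Real.exp (-c * s)) (Set.Ici s₀) :=
    antitoneOn_Ici_of_hasDerivAt_nonpos (f' := fun s => f' s + -(C * Real.exp (-c * s)))
      (fun s hs => (hf s hs).add (hE s))
      (fun s hs => by linarith [(abs_le.1 (h s hs)).2])
  have hmono : MonotoneOn (fun s => f s - C / c * Real.exp (-c * s)) (Set.Ici s₀) :=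
    monotoneOn_Ici_of_hasDerivAt_nonneg (f' := fun s => f' s - -(C * Real.exp (-c * s)))
      (fun s hs => (hf s hs).sub (hE s))
      (fun s hs => by linarith [(abs_le.1 (h s hs)).1])
  have hC : 0 ≤ C := by
    have := (abs_nonneg _).trans (h s₀ le_rfl)
    exact nonneg_of_mul_nonneg_left this (Real.exp_pos _)
  have hE1 : ∀ s, 0 ≤ C / c * Real.exp (-c * s) := fun s => by positivity
  obtain ⟨L, hL, hL1⟩ := exists_tendsto_of_monotoneOn_Ici hmono
    (B := f s₀ + C / c * Real.exp (-c * s₀)) (fun s hs => by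
      have := hanti Set.self_mem_Ici hs hs
      simp only at this
      linarith [hE1 s])
  obtain ⟨L', hL', hL1'⟩ := exists_tendsto_of_antitoneOn_Ici hanti
    (B := f s₀ - C / c * Real.exp (-c * s₀)) (fun s hs => by
      have := hmono Set.self_mem_Ici hs hs
      simp only at this
      linarith [hE1 s])
  have : L = L' := by
    have h1 := hL.add (hE0.const_mul 2)
    simp only [mul_zero, add_zero] at h1
    refine tendsto_nhds_unique (h1.congr fun s => ?_) hL'
    ring
  subst this
  refine ⟨L, fun s hs => abs_le.2 ⟨?_, ?_⟩⟩
  · linarith [hL1' s hs]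
  · linarith [hL1 s hs]

/-! ### The soliton system in logarithmic volume time -/

/-- The quantity `2 y² / (x² + 2 y²)` in terms of `x` and `s = log (x y²)`. -/
noncomputable def warp (x : ℝ → ℝ) (s : ℝ) : ℝ := 2 * Real.exp s / (x s ^ 3 + 2 * Real.exp s)

/-- The logarithmic derivative of `y² / x²` with respect to `s = log (x y²)`. -/
noncomputable def ratioRate (lam : ℝ) (x P : ℝ → ℝ) (s : ℝ) : ℝ :=
  4 - 6 * warp x s - 2 * lam / x s * (warp x s * Real.exp s - (Real.exp s - P s / 2))

/-- The soliton system on `[s₀, ∞)` with independent variable `s = log (x y²)`; here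
`lam * P = τ₁ - u x²` and `t` is the arc length parameter. -/
structure IsLogSoliton (lam s₀ : ℝ) (x P t : ℝ → ℝ) : Prop where
  x_pos : ∀ s, s₀ ≤ s → 0 < x s
  deriv_x : ∀ s, s₀ ≤ s → HasDerivAt x
    (x s - 2 * (1 - warp x s) * x s + lam / 3 * (P s - warp x s * x s ^ 3)) s
  deriv_P : ∀ s, s₀ ≤ s → HasDerivAt P (warp x s * x s ^ 3) s
  deriv_t : ∀ s, s₀ ≤ s → HasDerivAt t (warp x s * x s) s

theorem warp_pos {x : ℝ → ℝ} {s : ℝ} (h : 0 < x s) : 0 < warp x s := by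
  unfold warp; positivity

theorem warp_lt_one {x : ℝ → ℝ} {s : ℝ} (h : 0 < x s) : warp x s < 1 := by
  unfold warp
  rw [div_lt_one (by positivity)]
  have : 0 < x s ^ 3 := by positivity
  linarith

/-- This identity gives `P' = 2(1-z)eˢ`, hence `(eˢ - P/2)' = z eˢ`: the two quantities split the
volume `eˢ` with weights `1-z` and `z`. -/
theorem warp_mul_cube {x : ℝ → ℝ} {s : ℝ} (h : 0 < x s) :
    warp x s * x s ^ 3 = 2 * (1 - warp x s) * Real.exp s := by
  unfold warp
  have : x s ^ 3 + 2 * Real.exp s ≠ 0 := by positivity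
  field_simp
  ring

theorem one_sub_warp {x : ℝ → ℝ} {s : ℝ} (h : 0 < x s) :
    1 - warp x s = x s ^ 3 / (x s ^ 3 + 2 * Real.exp s) := by
  unfold warp
  have : x s ^ 3 + 2 * Real.exp s ≠ 0 := by positivity
  field_simp
  ring

theorem one_sub_warp_le {x : ℝ → ℝ} {s : ℝ} (h : 0 < x s) :
    1 - warp x s ≤ x s ^ 3 / (2 * Real.exp s) := by
  rw [one_sub_warp h]
  have : 0 < x s ^ 3 := by positivity
  gcongr
  linarith

theorem cube_eq {x : ℝ → ℝ} {s : ℝ} (h : 0 < x s) :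
    x s ^ 3 = 2 * (1 - warp x s) * Real.exp s / warp x s := by
  rw [← warp_mul_cube h, mul_div_cancel_left₀ _ (warp_pos h).ne']

namespace IsLogSoliton

variable {lam s₀ : ℝ} {x P t : ℝ → ℝ}

theorem mono (h : IsLogSoliton lam s₀ x P t) {s₁ : ℝ} (hs : s₀ ≤ s₁) :
    IsLogSoliton lam s₁ x P t where
  x_pos s h1 := h.x_pos s (hs.trans h1)
  deriv_x s h1 := h.deriv_x s (hs.trans h1)
  deriv_P s h1 := h.deriv_P s (hs.trans h1)
  deriv_t s h1 := h.deriv_t s (hs.trans h1)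

theorem deriv_x_eq (h : IsLogSoliton lam s₀ x P t) {s : ℝ} (hs : s₀ ≤ s) :
    x s - 2 * (1 - warp x s) * x s + lam / 3 * (P s - warp x s * x s ^ 3) =
      x s * (1 - ratioRate lam x P s) / 3 := by
  have hx := h.x_pos s hs
  rw [warp_mul_cube hx, ratioRate]
  field_simp
  ring

theorem deriv_x' (h : IsLogSoliton lam s₀ x P t) {s : ℝ} (hs : s₀ ≤ s) :
    HasDerivAt x (x s * (1 - ratioRate lam x P s) / 3) s := by
  rw [← h.deriv_x_eq hs]
  exact h.deriv_x s hs

/-- The odds `z/(1-z) = 2eˢ/x³` equal `2y²/x²`, whose logarithmic derivative is `ratioRate`; this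
turns into a logistic equation for `z`. -/
theorem deriv_warp (h : IsLogSoliton lam s₀ x P t) {s : ℝ} (hs : s₀ ≤ s) :
    HasDerivAt (warp x) (warp x s * (1 - warp x s) * ratioRate lam x P s) s := by
  have hx := h.x_pos s hs
  have hne : x s ^ 3 + 2 * Real.exp s ≠ 0 := by positivity
  have h1 := ((Real.hasDerivAt_exp s).const_mul 2).fun_div
    (((h.deriv_x' hs).fun_pow 3).fun_add ((Real.hasDerivAt_exp s).const_mul 2)) hne
  refine h1.congr_deriv ?_
  rw [one_sub_warp hx]
  generalize ratioRate lam x P s = R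
  simp only [warp]
  field_simp
  push_cast
  ring

theorem deriv_Q (h : IsLogSoliton lam s₀ x P t) {s : ℝ} (hs : s₀ ≤ s) :
    HasDerivAt (fun s => Real.exp s - P s / 2) (warp x s * Real.exp s) s := by
  refine ((Real.hasDerivAt_exp s).fun_sub ((h.deriv_P s hs).div_const 2)).congr_deriv ?_
  rw [warp_mul_cube (h.x_pos s hs)]
  ring

/-- The coefficient `λ/3` is the one that cancels the cubic terms, so that `w e⁻ˢ` is nonincreasing
whatever the sign of `λ`. -/
theorem deriv_w (h : IsLogSoliton lam s₀ x P t) {s : ℝ} (hs : s₀ ≤ s) :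
    HasDerivAt (fun s => x s + lam / 3 * P s)
      (x s + lam / 3 * P s - 2 * (1 - warp x s) * x s) s := by
  refine ((h.deriv_x s hs).fun_add ((h.deriv_P s hs).const_mul (lam / 3))).congr_deriv ?_
  ring

theorem deriv_w_div (h : IsLogSoliton lam s₀ x P t) {s : ℝ} (hs : s₀ ≤ s) :
    HasDerivAt (fun s => (x s + lam / 3 * P s) * Real.exp (-s))
      (-(2 * (1 - warp x s) * (x s * Real.exp (-s)))) s := by
  have h1 : HasDerivAt (fun s : ℝ => Real.exp (-s)) (-Real.exp (-s)) s := by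
    simpa using (hasDerivAt_id s).neg.exp
  refine ((h.deriv_w hs).fun_mul h1).congr_deriv ?_
  ring

/-- The equation `θ' = z - θ` makes `θ` an exponentially weighted average of the past of `z`. -/
theorem deriv_theta (h : IsLogSoliton lam s₀ x P t) {s : ℝ} (hs : s₀ ≤ s) :
    HasDerivAt (fun s => 1 - P s / 2 * Real.exp (-s))
      (warp x s - (1 - P s / 2 * Real.exp (-s))) s := by
  have h1 : HasDerivAt (fun s : ℝ => Real.exp (-s)) (-Real.exp (-s)) s := by
    simpa using (hasDerivAt_id s).neg.exp
  refine ((((h.deriv_P s hs).div_const 2).fun_mul h1).const_sub 1).congr_deriv ?_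
  rw [warp_mul_cube (h.x_pos s hs), Real.exp_neg]
  field_simp
  ring

end IsLogSoliton

/-- Solutions of a linear equation with fast coefficient and bounded forcing that do not grow
too quickly are bounded above. -/
theorem bddAbove_of_fast_linear {lam s₀ A₀ B : ℝ} {W f A : ℝ → ℝ} (hlam : lam ≠ 0)
    (hA₀ : 0 < A₀) (hA : ∀ s, s₀ ≤ s → A₀ ≤ A s) (hf : ∀ s, s₀ ≤ s → |f s| ≤ 1)
    (hW : ∀ s, s₀ ≤ s → HasDerivAt W
      (-(1 / 3) * W s + Real.exp (2 / 3 * s) * (f s - lam * A s * W s)) s)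
    (hB : ∀ s, s₀ ≤ s → W s ≤ B * Real.exp (2 / 3 * s)) :
    ∃ M, 0 ≤ M ∧ ∀ s, s₀ ≤ s → W s ≤ M := by
  rcases lt_or_gt_of_ne hlam with hneg | hpos
  · set μ := -lam with hμ
    have hμ0 : 0 < μ := by linarith
    -- In the unstable case, `W ≥ M` makes `μ A W` at least three times the forcing bound. Once the
    -- exponential prefactor is large this gives `W' ≥ W`.
    set M := 3 / (μ * A₀) with hM
    have hM0 : 0 < M := by positivity
    have hev : ∀ᶠ s in atTop, 6 ≤ Real.exp (2 / 3 * s) * (μ * A₀) := by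
      have : Tendsto (fun s : ℝ => Real.exp (2 / 3 * s) * (μ * A₀)) atTop atTop :=
        (Real.tendsto_exp_atTop.comp
          (tendsto_id.const_mul_atTop (by norm_num : (0:ℝ) < 2 / 3))).atTop_mul_const
          (by positivity)
      exact this.eventually_ge_atTop 6
    obtain ⟨N, hN⟩ := eventually_atTop.1 hev
    set s₁ := max s₀ N with hs₁
    have h01 : s₀ ≤ s₁ := le_max_left _ _
    have hgrow : ∀ s, s₁ ≤ s → M ≤ W s →
        W s ≤ -(1 / 3) * W s + Real.exp (2 / 3 * s) * (f s - lam * A s * W s) := by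
      intro s hs hMW
      have hE := hN s ((le_max_right _ _).trans hs)
      have hE0 := Real.exp_pos (2 / 3 * s)
      have hWp : 0 < W s := hM0.trans_le hMW
      have hAs := hA s (h01.trans hs)
      have hfs := (abs_le.1 (hf s (h01.trans hs))).1
      have h3 : 3 ≤ μ * A₀ * W s := by
        have := mul_le_mul_of_nonneg_left hMW (show 0 ≤ μ * A₀ by positivity)
        rwa [hM, mul_div_cancel₀ _ (by positivity : μ * A₀ ≠ 0)] at this
      have h4 : μ * A₀ * W s ≤ μ * A s * W s := by gcongr
      have h5 : Real.exp (2 / 3 * s) * (μ * A₀ * W s - 1) ≤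
          Real.exp (2 / 3 * s) * (f s - lam * A s * W s) := by
        apply mul_le_mul_of_nonneg_left _ hE0.le
        have : lam = -μ := by rw [hμ]; ring
        rw [this]; linarith
      have h6 : Real.exp (2 / 3 * s) * (μ * A₀ * W s - 1) ≥
          Real.exp (2 / 3 * s) * (μ * A₀) * W s * (2 / 3) := by nlinarith
      have h7 : 6 * W s ≤ Real.exp (2 / 3 * s) * (μ * A₀) * W s := by gcongr
      nlinarith
    refine ⟨max M (|B| * Real.exp (2 / 3 * s₁)), le_max_of_le_left hM0.le, fun s hs => ?_⟩
    rcases le_or_gt s s₁ with hss | hss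
    · refine le_max_of_le_right ((hB s hs).trans ?_)
      gcongr
      exact le_abs_self B
    · refine le_max_of_le_left ?_
      by_contra hcon
      push Not at hcon
      have hstay := barrier_ge (s₀ := s) (c := M) (fun σ hσ => hW σ (hs.trans hσ)) hcon.le
        (fun σ hσ _ he => by
          have := hgrow σ (hss.le.trans hσ) he.ge
          linarith)
      -- Above `M` the function grows at least like `e^σ`, which contradicts the a priori bound of
      -- order `e^{2σ/3}`.
      have hmono := monotoneOn_Ici_of_hasDerivAt_nonneg (s₀ := s)
        (f := fun σ => W σ * Real.exp (-σ))
        (f' := fun σ => (-(1 / 3) * W σ + Real.exp (2 / 3 * σ) * (f σ - lam * A σ * W σ)) *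
          Real.exp (-σ) + W σ * (-Real.exp (-σ)))
        (fun σ hσ => (hW σ (hs.trans hσ)).fun_mul (by simpa using (hasDerivAt_id σ).neg.exp))
        (fun σ hσ => by
          have h1 := hgrow σ (hss.le.trans hσ) (hstay σ hσ)
          have h2 := Real.exp_pos (-σ)
          nlinarith)
      have hc : 0 < W s * Real.exp (-s) := mul_pos (hM0.trans hcon) (Real.exp_pos _)
      have hlim : Tendsto (fun σ : ℝ => B * Real.exp (-(1 / 3) * σ)) atTop (𝓝 0) := by
        have : Tendsto (fun s : ℝ => -(1 / 3 : ℝ) * s) atTop atBot :=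
          tendsto_id.const_mul_atTop_of_neg (by norm_num)
        simpa using (Real.tendsto_exp_atBot.comp this).const_mul B
      obtain ⟨σ, hσ1, hσ2⟩ := ((hlim.eventually (gt_mem_nhds hc)).and
        (eventually_ge_atTop s)).exists
      have h1 := hmono Set.self_mem_Ici hσ2 hσ2
      simp only at h1
      have h2 := mul_le_mul_of_nonneg_right (hB σ (hs.trans hσ2)) (Real.exp_pos (-σ)).le
      rw [mul_assoc, ← Real.exp_add, show 2 / 3 * σ + -σ = -(1 / 3) * σ by ring] at h2
      linarith
  · refine ⟨max (W s₀) (2 / (lam * A₀)), le_max_of_le_right (by positivity), ?_⟩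
    refine barrier_le hW (le_max_left _ _) (fun s hs _ he => ?_)
    have hE0 := Real.exp_pos (2 / 3 * s)
    have hge : 2 / (lam * A₀) ≤ W s := he ▸ le_max_right _ _
    have hWp : 0 < W s := lt_of_lt_of_le (by positivity) hge
    rw [div_le_iff₀ (by positivity)] at hge
    have h4 : lam * A₀ * W s ≤ lam * A s * W s := by
      have := hA s hs
      gcongr
    have hfs := (abs_le.1 (hf s hs)).2
    have : Real.exp (2 / 3 * s) * (f s - lam * A s * W s) ≤ 0 :=
      mul_nonpos_of_nonneg_of_nonpos hE0.le (by nlinarith)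
    linarith

/-! ### Ends with `warp` in a compact part of `(0, 1)` are conical -/

namespace IsLogSoliton

variable {lam s₀ : ℝ} {x P t : ℝ → ℝ}

/-- Both `P` and `eˢ - P/2` are nondecreasing, hence bounded below by their initial values; division
by `eˢ` gives the two estimates. -/
theorem theta_bounds (h : IsLogSoliton lam s₀ x P t) :
    ∃ B, 0 ≤ B ∧ ∀ s, s₀ ≤ s → -(B * Real.exp (-s)) ≤ 1 - P s / 2 * Real.exp (-s) ∧
      1 - P s / 2 * Real.exp (-s) ≤ 1 + B * Real.exp (-s) := by
  have h1 := monotoneOn_Ici_of_hasDerivAt_nonneg (fun s hs => h.deriv_P s hs)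
    (fun s hs => mul_nonneg (warp_pos (h.x_pos s hs)).le (pow_pos (h.x_pos s hs) 3).le)
  have h2 := monotoneOn_Ici_of_hasDerivAt_nonneg (fun s hs => h.deriv_Q hs)
    (fun s hs => mul_nonneg (warp_pos (h.x_pos s hs)).le (Real.exp_pos s).le)
  refine ⟨|P s₀ / 2| + |Real.exp s₀ - P s₀ / 2|, by positivity, fun s hs => ?_⟩
  have h3 := h1 Set.self_mem_Ici hs hs
  have h4 := h2 Set.self_mem_Ici hs hs
  simp only at h4
  have hE : Real.exp s * Real.exp (-s) = 1 := by rw [← Real.exp_add]; simp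
  have hp := Real.exp_pos (-s)
  have e1 : 1 - P s / 2 * Real.exp (-s) = (Real.exp s - P s / 2) * Real.exp (-s) := by
    rw [sub_mul, hE]
  constructor
  · rw [e1]
    have := neg_abs_le (Real.exp s₀ - P s₀ / 2)
    have := abs_nonneg (P s₀ / 2)
    nlinarith
  · have := neg_abs_le (P s₀ / 2)
    have := abs_nonneg (Real.exp s₀ - P s₀ / 2)
    nlinarith

/-- If `warp` stays in a compact subset of `(0, 1)`, it converges at rate `exp (-2s/3)`. -/
theorem warp_tendsto_of_bounds (h : IsLogSoliton lam s₀ x P t) (hlam : lam ≠ 0) {ε : ℝ}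
    (hε : 0 < ε) (hz : ∀ s, s₀ ≤ s → ε ≤ warp x s ∧ warp x s ≤ 1 - ε) :
    ∃ l, ε ≤ l ∧ l ≤ 1 - ε ∧
      (fun s => warp x s - l) =O[atTop] (fun s => Real.exp (-(2 / 3) * s)) := by
  obtain ⟨B, hB0, hB⟩ := h.theta_bounds
  set θ : ℝ → ℝ := fun s => 1 - P s / 2 * Real.exp (-s) with hθ
  have hε1 : ε ≤ 1 / 2 := by linarith [(hz s₀ le_rfl).1, (hz s₀ le_rfl).2]
  -- The gap is rescaled by its expected size. The restoring coefficient `2z(1-z)eˢ/x` is of order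
  -- `e^{2s/3}` because `x` is of order `e^{s/3}`; `A` is what remains of it, bounded below by `ε³`.
  set W : ℝ → ℝ := fun s => Real.exp (2 / 3 * s) * (warp x s - θ s) with hWdef
  set A : ℝ → ℝ := fun s => 2 * (warp x s * (1 - warp x s)) * (Real.exp (1 / 3 * s) / x s)
    with hAdef
  set f : ℝ → ℝ := fun s => warp x s * (1 - warp x s) * (4 - 6 * warp x s) with hfdef
  have hW : ∀ s, s₀ ≤ s → HasDerivAt W
      (-(1 / 3) * W s + Real.exp (2 / 3 * s) * (f s - lam * A s * W s)) s := by
    intro s hs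
    have hx := h.x_pos s hs
    have h1 : HasDerivAt (fun s : ℝ => Real.exp (2 / 3 * s)) (Real.exp (2 / 3 * s) * (2 / 3)) s := by
      have : HasDerivAt (fun s : ℝ => 2 / 3 * s) (2 / 3) s := by
        simpa using (hasDerivAt_id s).const_mul (2 / 3 : ℝ)
      exact this.exp
    refine (h1.fun_mul ((h.deriv_warp hs).fun_sub (h.deriv_theta hs))).congr_deriv ?_
    have e1 : Real.exp s = Real.exp (1 / 3 * s) * Real.exp (2 / 3 * s) := by
      rw [← Real.exp_add]; ring_nf
    have e2 : warp x s * Real.exp s - (Real.exp s - P s / 2) =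
        Real.exp s * (warp x s - θ s) := by
      simp only [hθ, Real.exp_neg]; field_simp
    simp only [ratioRate]
    rw [e2, e1]
    simp only [hWdef, hfdef, hAdef]
    change Real.exp (2 / 3 * s) * (2 / 3) * (warp x s - θ s) + Real.exp (2 / 3 * s) *
      (_ - (warp x s - θ s)) = _
    field_simp
    ring
  have hxb : ∀ s, s₀ ≤ s → x s ≤ 2 / ε * Real.exp (1 / 3 * s) := by
    intro s hs
    have hx := h.x_pos s hs
    refine le_of_pow_le_pow_left₀ (n := 3) (by norm_num) (by positivity) ?_
    rw [mul_pow, ← Real.exp_nat_mul, show ((3 : ℕ) : ℝ) * (1 / 3 * s) = s by push_cast; ring,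
      cube_eq hx, div_le_iff₀ (warp_pos hx)]
    have h1 : 1 ≤ 2 / ε := by rw [le_div_iff₀ hε]; linarith
    have h2 : 2 / ε ≤ (2 / ε) ^ 3 := le_self_pow₀ h1 (by norm_num)
    have h3 : 2 ≤ 2 / ε * warp x s := by
      rw [div_mul_eq_mul_div, le_div_iff₀ hε]; linarith [(hz s hs).1]
    have h4 := warp_pos hx
    calc 2 * (1 - warp x s) * Real.exp s ≤ 2 * Real.exp s := by
          have := Real.exp_pos s; nlinarith
      _ ≤ 2 / ε * warp x s * Real.exp s := by gcongr
      _ ≤ (2 / ε) ^ 3 * warp x s * Real.exp s := by gcongr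
      _ = _ := by ring
  have hA : ∀ s, s₀ ≤ s → ε ^ 3 ≤ A s := by
    intro s hs
    have hx := h.x_pos s hs
    have h1 : ε / 2 ≤ Real.exp (1 / 3 * s) / x s := by
      rw [le_div_iff₀ hx]
      have := hxb s hs
      rw [div_mul_eq_mul_div, le_div_iff₀ hε] at this
      linarith
    have h2 : ε * ε ≤ warp x s * (1 - warp x s) :=
      mul_le_mul (hz s hs).1 (by linarith [(hz s hs).2]) hε.le (warp_pos hx).le
    calc ε ^ 3 = 2 * (ε * ε) * (ε / 2) := by ring
      _ ≤ A s := by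
        have h3 : 0 ≤ warp x s * (1 - warp x s) := (mul_nonneg hε.le hε.le).trans h2
        exact mul_le_mul (by linarith) h1 (by positivity) (by linarith)
  have hf : ∀ s, s₀ ≤ s → |f s| ≤ 1 := by
    intro s hs
    have h0 := warp_pos (h.x_pos s hs)
    have h1 := warp_lt_one (h.x_pos s hs)
    have h2 : warp x s * (1 - warp x s) ≤ 1 / 4 := by nlinarith [sq_nonneg (warp x s - 1 / 2)]
    have h3 : 0 ≤ warp x s * (1 - warp x s) := mul_nonneg h0.le (by linarith)
    simp only [hfdef, abs_mul]
    rw [← abs_mul, abs_of_nonneg h3]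
    have h4 : |4 - 6 * warp x s| ≤ 4 := abs_le.2 ⟨by linarith, by linarith⟩
    calc warp x s * (1 - warp x s) * |4 - 6 * warp x s| ≤ 1 / 4 * 4 := by gcongr
      _ = 1 := by norm_num
  have hWB : ∀ s, s₀ ≤ s → |W s| ≤ (2 + B * Real.exp (-s₀)) * Real.exp (2 / 3 * s) := by
    intro s hs
    have h0 := warp_pos (h.x_pos s hs)
    have h1 := warp_lt_one (h.x_pos s hs)
    simp only [hWdef, abs_mul, abs_of_pos (Real.exp_pos _)]
    rw [mul_comm]
    gcongr
    have h2 := hB s hs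
    have h3 : B * Real.exp (-s) ≤ B * Real.exp (-s₀) := by gcongr
    rw [abs_le]
    constructor <;> simp only [hθ] <;> linarith [h2.1, h2.2]
  obtain ⟨M₁, hM₁0, hM₁⟩ := bddAbove_of_fast_linear hlam (by positivity) hA hf hW
    (fun s hs => (le_abs_self _).trans (hWB s hs))
  -- The linear equation is invariant under changing the signs of `W` and `f`, which yields the
  -- lower bound.
  obtain ⟨M₂, hM₂0, hM₂⟩ := bddAbove_of_fast_linear (W := fun s => -W s) (f := fun s => -f s)
    hlam (by positivity) hA (by simpa using hf)
    (fun s hs => (hW s hs).neg.congr_deriv (by ring))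
    (fun s hs => (neg_le_abs _).trans (hWB s hs))
  have hg : ∀ s, s₀ ≤ s → |warp x s - θ s| ≤ (M₁ + M₂) * Real.exp (-(2 / 3) * s) := by
    intro s hs
    have h1 : warp x s - θ s = W s * Real.exp (-(2 / 3) * s) := by
      simp only [hWdef]
      rw [mul_right_comm, ← Real.exp_add, show 2 / 3 * s + -(2 / 3) * s = 0 by ring, Real.exp_zero,
        one_mul]
    rw [h1, abs_mul, abs_of_pos (Real.exp_pos _)]
    gcongr
    have h2 := hM₁ s hs
    have h3 := hM₂ s hs
    exact abs_le.2 ⟨by linarith, by linarith⟩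
  -- As `θ' = z - θ` decays exponentially, `θ` converges, and `z` follows at the same rate.
  obtain ⟨l, hl⟩ := exists_limit_of_exp_decay (by norm_num : (0 : ℝ) < 2 / 3)
    (fun s hs => h.deriv_theta hs) hg
  have hO : (fun s => warp x s - l) =O[atTop] (fun s => Real.exp (-(2 / 3) * s)) := by
    refine IsBigO.of_bound (M₁ + M₂ + (M₁ + M₂) / (2 / 3)) ?_
    filter_upwards [eventually_ge_atTop s₀] with s hs
    have h1 := hg s hs
    have h2 := hl s hs
    rw [Real.norm_eq_abs, Real.norm_eq_abs, abs_of_pos (Real.exp_pos _), add_mul]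
    have := abs_add_le (warp x s - θ s) (θ s - l)
    rw [sub_add_sub_cancel] at this
    exact this.trans (add_le_add h1 h2)
  have hlim : Tendsto (warp x) atTop (𝓝 l) := by
    have h0 : Tendsto (fun s : ℝ => Real.exp (-(2 / 3) * s)) atTop (𝓝 0) :=
      Real.tendsto_exp_atBot.comp (tendsto_id.const_mul_atTop_of_neg (by norm_num))
    simpa using (hO.trans_tendsto h0).add_const l
  exact ⟨l, ge_of_tendsto hlim ((eventually_ge_atTop s₀).mono fun s hs => (hz s hs).1),
    le_of_tendsto hlim ((eventually_ge_atTop s₀).mono fun s hs => (hz s hs).2), hO⟩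

/-- If `warp` stays in a compact subset of `(0, 1)`, the end is asymptotically conical. -/
theorem conical (h : IsLogSoliton lam s₀ x P t) (hlam : lam ≠ 0) {ε : ℝ}
    (hε : 0 < ε) (hz : ∀ s, s₀ ≤ s → ε ≤ warp x s ∧ warp x s ≤ 1 - ε) :
    Tendsto t atTop atTop ∧ ∃ c₁ c₂ k : ℝ, IsClosedSp2Cone c₁ c₂ ∧
      (fun s => x s - c₁ * (t s + k)) =O[atTop] (fun s => (t s)⁻¹) ∧
      (fun s => √(Real.exp s / x s) - c₂ * (t s + k)) =O[atTop] (fun s => (t s)⁻¹) := by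
  obtain ⟨l, hl0, hl1, hO⟩ := h.warp_tendsto_of_bounds hlam hε hz
  have hl : 0 < l := by linarith
  have hl' : 0 < 1 - l := by linarith
  set ρ : ℝ → ℝ := fun s => Real.exp (1 / 3 * s) with hρ
  have hρ0 : ∀ s, 0 < ρ s := fun s => Real.exp_pos _
  have hρ3 : ∀ s, ρ s ^ 3 = Real.exp s := fun s => by
    simp only [hρ]; rw [← Real.exp_nat_mul]; push_cast; ring_nf
  have hρtop : Tendsto ρ atTop atTop :=
    Real.tendsto_exp_atTop.comp (tendsto_id.const_mul_atTop (by norm_num))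
  have hO' : (fun s => warp x s - l) =O[atTop] (fun s => (ρ s ^ 2)⁻¹) := by
    refine hO.congr_right fun s => ?_
    simp only [hρ]; rw [← Real.exp_nat_mul, ← Real.exp_neg]; push_cast; ring_nf
  -- The limit of `x e^{-s/3}`, found by setting `z = l` in `x³e⁻ˢ = 2(1-z)/z`.
  obtain ⟨ξ₀, hξ₀, hξ₀3⟩ : ∃ ξ₀ : ℝ, 0 < ξ₀ ∧ ξ₀ ^ 3 = 2 * (1 - l) / l :=
    ⟨(2 * (1 - l) / l) ^ (1 / 3 : ℝ), by positivity, by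
      rw [← Real.rpow_natCast, ← Real.rpow_mul (by positivity)]; norm_num⟩
  set ξ : ℝ → ℝ := fun s => x s / ρ s with hξ
  have hξp : ∀ s, s₀ ≤ s → 0 < ξ s := fun s hs => div_pos (h.x_pos s hs) (hρ0 s)
  have hξ3 : ∀ s, s₀ ≤ s → ξ s ^ 3 = 2 * (1 - warp x s) / warp x s := by
    intro s hs
    have := (warp_pos (h.x_pos s hs)).ne'
    simp only [hξ]
    rw [div_pow, hρ3, cube_eq (h.x_pos s hs)]
    field_simp
  have hξO : (fun s => ξ s - ξ₀) =O[atTop] (fun s => (ρ s ^ 2)⁻¹) := by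
    refine IsBigO.trans (IsBigO.of_bound (2 / (ε * l * ξ₀ ^ 2)) ?_) hO'
    filter_upwards [eventually_ge_atTop s₀] with s hs
    have hw := warp_pos (h.x_pos s hs)
    -- The difference of cubes passes the rate of `z` on to `ξ`: its quadratic cofactor is at least
    -- `ξ₀²`.
    have e1 : (ξ s - ξ₀) * (ξ s ^ 2 + ξ s * ξ₀ + ξ₀ ^ 2) = -(2 / (warp x s * l)) * (warp x s - l) := by
      calc _ = ξ s ^ 3 - ξ₀ ^ 3 := by ring
        _ = _ := by rw [hξ3 s hs, hξ₀3]; field_simp; ring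
    have e2 := congrArg abs e1
    have hp := hξp s hs
    rw [abs_mul, abs_mul, abs_of_pos (by positivity : 0 < ξ s ^ 2 + ξ s * ξ₀ + ξ₀ ^ 2), abs_neg,
      abs_of_pos (by positivity : 0 < 2 / (warp x s * l))] at e2
    have h1 : |ξ s - ξ₀| * ξ₀ ^ 2 ≤ |ξ s - ξ₀| * (ξ s ^ 2 + ξ s * ξ₀ + ξ₀ ^ 2) := by
      have : 0 < ξ s * ξ₀ := by positivity
      gcongr
      nlinarith [sq_nonneg (ξ s)]
    have h2 : 2 / (warp x s * l) * |warp x s - l| ≤ 2 / (ε * l) * |warp x s - l| := by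
      have := (hz s hs).1
      gcongr
    rw [Real.norm_eq_abs, Real.norm_eq_abs]
    calc |ξ s - ξ₀| = |ξ s - ξ₀| * ξ₀ ^ 2 / ξ₀ ^ 2 := by field_simp
      _ ≤ 2 / (ε * l) * |warp x s - l| / ξ₀ ^ 2 :=
        div_le_div_of_nonneg_right (by linarith) (by positivity)
      _ = _ := by field_simp
  have hρ2 : Tendsto (fun s => (ρ s ^ 2)⁻¹) atTop (𝓝 0) :=
    (tendsto_pow_atTop (by norm_num : 2 ≠ 0) |>.comp hρtop).inv_tendsto_atTop
  have hξlim : Tendsto ξ atTop (𝓝 ξ₀) := by simpa using (hξO.trans_tendsto hρ2).add_const ξ₀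
  have hzlim : Tendsto (warp x) atTop (𝓝 l) := by simpa using (hO'.trans_tendsto hρ2).add_const l
  -- Since `dt/ds = zξρ` with `zξ = κ + O(ρ⁻²)`, integration gives `t = 3κρ + k + O(ρ⁻¹)`. Thus `ρ`
  -- is linear in `t` up to `O(t⁻¹)`, and the constant `k` becomes the time translation.
  set κ := l * ξ₀ with hκ
  have hκ0 : 0 < κ := by positivity
  have hzξ : (fun s => warp x s * ξ s - κ) =O[atTop] (fun s => (ρ s ^ 2)⁻¹) := by
    have h1 : (fun s => (warp x s - l) * ξ s) =O[atTop] (fun s => (ρ s ^ 2)⁻¹) := by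
      simpa using hO'.mul (hξlim.isBigO_one ℝ)
    refine (h1.add (hξO.const_mul_left l)).congr_left fun s => ?_
    simp only [hκ]; ring
  obtain ⟨C, hC⟩ := hzξ.bound
  obtain ⟨s₁, hs₁⟩ := eventually_atTop.1 hC
  have hρd : ∀ s, HasDerivAt ρ (ρ s / 3) s := fun s => by
    have : HasDerivAt (fun s : ℝ => 1 / 3 * s) (1 / 3) s := by
      simpa using (hasDerivAt_id s).const_mul (1 / 3 : ℝ)
    exact this.exp.congr_deriv (by simp only [hρ]; ring)
  have hρe : ∀ s, Real.exp (-(1 / 3) * s) = (ρ s)⁻¹ := fun s => by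
    simp only [hρ]; rw [← Real.exp_neg]; ring_nf
  obtain ⟨k, hk⟩ := exists_limit_of_exp_decay (f := fun s => t s - 3 * κ * ρ s)
    (f' := fun s => (warp x s * ξ s - κ) * ρ s) (s₀ := max s₀ s₁) (C := C)
    (by norm_num : (0 : ℝ) < 1 / 3)
    (fun s hs => ((h.deriv_t s ((le_max_left _ _).trans hs)).fun_sub
      ((hρd s).const_mul (3 * κ))).congr_deriv (by
        have := (hρ0 s).ne'
        simp only [hξ]; field_simp))
    (fun s hs => by
      have h1 := hs₁ s ((le_max_right _ _).trans hs)
      rw [Real.norm_eq_abs, Real.norm_eq_abs, abs_of_pos (inv_pos.2 (pow_pos (hρ0 s) 2))] at h1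
      rw [abs_mul, abs_of_pos (hρ0 s), hρe]
      calc _ ≤ C * (ρ s ^ 2)⁻¹ * ρ s := by have := hρ0 s; gcongr
        _ = _ := by have := (hρ0 s).ne'; field_simp)
  have hρinv : Tendsto (fun s => (ρ s)⁻¹) atTop (𝓝 0) := hρtop.inv_tendsto_atTop
  have htO : (fun s => t s - 3 * κ * ρ s - k) =O[atTop] (fun s => (ρ s)⁻¹) := by
    refine IsBigO.of_bound (C / (1 / 3)) ?_
    filter_upwards [eventually_ge_atTop (max s₀ s₁)] with s hs
    have := hk s hs
    rwa [hρe, ← abs_of_pos (inv_pos.2 (hρ0 s)), ← Real.norm_eq_abs, ← Real.norm_eq_abs] at this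
  have htlim : Tendsto (fun s => t s - 3 * κ * ρ s) atTop (𝓝 k) := by
    simpa using (htO.trans_tendsto hρinv).add_const k
  have httop : Tendsto t atTop atTop := by
    have := htlim.add_atTop (hρtop.const_mul_atTop (show 0 < 3 * κ by positivity))
    refine this.congr fun s => by ring
  have htρ : (fun s => (ρ s)⁻¹) =O[atTop] (fun s => (t s)⁻¹) := by
    have h1 : t =O[atTop] ρ := by
      have h2 : (fun s => t s - 3 * κ * ρ s) =O[atTop] ρ :=
        (htlim.isBigO_one ℝ).trans (isBigO_of_le' (c := 1) _ (fun s => by simp) |>.trans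
          (((isLittleO_const_left.2 (Or.inr (tendsto_norm_atTop_atTop.comp hρtop))).isBigO :
            (fun _ => (1 : ℝ)) =O[atTop] ρ)))
      refine (h2.add ((isBigO_refl ρ atTop).const_mul_left (3 * κ))).congr_left fun s => by ring
    refine h1.inv_rev ?_
    filter_upwards [httop.eventually_gt_atTop 0] with s hs h0
    exact absurd h0 hs.ne'
  set η₀ := 1 / √ξ₀ with hη₀
  have hη₀0 : 0 < η₀ := by positivity
  set η : ℝ → ℝ := fun s => √(Real.exp s / x s) / ρ s with hη
  have hηO : (fun s => η s - η₀) =O[atTop] (fun s => (ρ s ^ 2)⁻¹) := by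
    refine IsBigO.trans (IsBigO.of_bound (2 / (ξ₀ * ξ₀ * η₀)) ?_) hξO
    filter_upwards [eventually_ge_atTop s₀, hξlim.eventually (lt_mem_nhds
      (show ξ₀ / 2 < ξ₀ by linarith))] with s hs hhalf
    have hx := h.x_pos s hs
    have hp := hξp s hs
    have hη2 : η s ^ 2 = 1 / ξ s := by
      have := hρ0 s
      simp only [hη, hξ]
      rw [div_pow, Real.sq_sqrt (by positivity), ← hρ3]
      field_simp
    have hη02 : η₀ ^ 2 = 1 / ξ₀ := by
      rw [hη₀, div_pow, Real.sq_sqrt hξ₀.le, one_pow]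
    have hηp : 0 ≤ η s := div_nonneg (Real.sqrt_nonneg _) (hρ0 s).le
    have e1 : (η s - η₀) * (η s + η₀) = -(1 / (ξ s * ξ₀)) * (ξ s - ξ₀) := by
      calc _ = η s ^ 2 - η₀ ^ 2 := by ring
        _ = _ := by rw [hη2, hη02]; field_simp; ring
    have e2 := congrArg abs e1
    rw [abs_mul, abs_mul, abs_of_pos (by positivity : 0 < η s + η₀), abs_neg,
      abs_of_pos (by positivity : 0 < 1 / (ξ s * ξ₀))] at e2
    have h1 : |η s - η₀| * η₀ ≤ |η s - η₀| * (η s + η₀) := by gcongr; linarith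
    have h2 : 1 / (ξ s * ξ₀) * |ξ s - ξ₀| ≤ 1 / (ξ₀ / 2 * ξ₀) * |ξ s - ξ₀| := by
      gcongr
    rw [Real.norm_eq_abs, Real.norm_eq_abs]
    calc |η s - η₀| = |η s - η₀| * η₀ / η₀ := by field_simp
      _ ≤ 1 / (ξ₀ / 2 * ξ₀) * |ξ s - ξ₀| / η₀ :=
        div_le_div_of_nonneg_right (by linarith) (by positivity)
      _ = _ := by field_simp
  have final : ∀ (ζ : ℝ → ℝ) (ζ₀ : ℝ), (fun s => ζ s - ζ₀) =O[atTop] (fun s => (ρ s ^ 2)⁻¹) →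
      (fun s => ζ s * ρ s - ζ₀ / (3 * κ) * (t s + -k)) =O[atTop] (fun s => (t s)⁻¹) := by
    intro ζ ζ₀ hζ
    refine IsBigO.trans ?_ htρ
    have h1 : (fun s => (ζ s - ζ₀) * ρ s) =O[atTop] (fun s => (ρ s)⁻¹) := by
      refine (hζ.mul (isBigO_refl ρ atTop)).congr_right fun s => ?_
      have := (hρ0 s).ne'
      field_simp
    refine (h1.add (htO.const_mul_left (-(ζ₀ / (3 * κ))))).congr_left fun s => ?_
    field_simp
    ring
  refine ⟨httop, ξ₀ / (3 * κ), η₀ / (3 * κ), -k, ⟨by positivity, by positivity, ?_⟩, ?_, ?_⟩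
  · have hη02 : η₀ ^ 2 = 1 / ξ₀ := by
      rw [hη₀, div_pow, Real.sq_sqrt hξ₀.le, one_pow]
    rw [div_pow η₀, hη02, hκ]
    have h3 : l * ξ₀ ^ 3 = 2 * (1 - l) := by rw [hξ₀3]; field_simp
    field_simp
    nlinarith
  · refine (final ξ ξ₀ hξO).congr_left fun s => ?_
    have := (hρ0 s).ne'
    simp only [hξ]; field_simp
  · refine (final η η₀ hηO).congr_left fun s => ?_
    have := (hρ0 s).ne'
    simp only [hη]; field_simp

end IsLogSoliton

namespace IsLogSoliton

variable {lam s₀ : ℝ} {x P t : ℝ → ℝ}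

/-! ### Expanders -/

/-- If `Q = eˢ - P/2` were never positive, monotonicity would bound it on both sides. Then `b =
e²ˢ/x⁴` stays away from zero, since `ratioRate` is nonnegative whenever `b` is small at late times.
But such a bound keeps `Q' = z eˢ` above a positive constant, so `Q` is unbounded. -/
theorem exists_Q_pos (h : IsLogSoliton lam s₀ x P t) (hlam : 0 < lam) :
    ∃ s, s₀ ≤ s ∧ 0 < Real.exp s - P s / 2 := by
  by_contra hcon
  push Not at hcon
  have hmono := monotoneOn_Ici_of_hasDerivAt_nonneg (fun s hs => h.deriv_Q hs)
    (fun s hs => mul_nonneg (warp_pos (h.x_pos s hs)).le (Real.exp_pos s).le)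
  set C := -(Real.exp s₀ - P s₀ / 2) with hC
  have hC0 : 0 ≤ C := by linarith [hcon s₀ le_rfl]
  have hQ : ∀ s, s₀ ≤ s → -C ≤ Real.exp s - P s / 2 := fun s hs => by
    have := hmono Set.self_mem_Ici hs hs
    simp only at this
    linarith
  -- The constants make `ratioRate ≥ 4 - 3 - 1/2 - 1/2 = 0` when `b ≤ b₀` and `x ≥ X`: `X² ≥ 16 b₀`
  -- gives `z ≤ 1/2`, `4λb₀ = 1/2` bounds the next term, and `X ≥ 4λC` bounds the contribution of
  -- `Q`.
  set b₀ := 1 / (8 * lam) with hb₀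
  have hb₀0 : 0 < b₀ := by positivity
  set X := 4 * lam * C + 1 + 16 * b₀ with hX
  have hX1 : 1 ≤ X := by have : 0 ≤ 4 * lam * C := by positivity
                         linarith
  have hX0 : 0 < X := by linarith
  set b : ℝ → ℝ := fun s => Real.exp s ^ 2 / x s ^ 4 with hb
  have hbd : ∀ s, s₀ ≤ s → HasDerivAt b (b s * (2 / 3 + 4 / 3 * ratioRate lam x P s)) s := by
    intro s hs
    have hx := h.x_pos s hs
    refine (((Real.hasDerivAt_exp s).fun_pow 2).fun_div ((h.deriv_x' hs).fun_pow 4)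
      (by positivity)).congr_deriv ?_
    simp only [hb]
    field_simp
    push_cast
    ring
  -- At such late times `b ≤ b₀` already forces `x ≥ X`.
  obtain ⟨s₁, hs₁0, hs₁⟩ : ∃ s₁, s₀ ≤ s₁ ∧ ∀ s, s₁ ≤ s → b₀ * X ^ 4 + 1 ≤ Real.exp s := by
    obtain ⟨N, hN⟩ := eventually_atTop.1
      (Real.tendsto_exp_atTop.eventually_ge_atTop (b₀ * X ^ 4 + 1))
    exact ⟨max s₀ N, le_max_left _ _, fun s hs => hN s ((le_max_right _ _).trans hs)⟩
  have hb_pos : ∀ s, s₀ ≤ s → 0 < b s := fun s hs => by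
    have := h.x_pos s hs
    simp only [hb]; positivity
  have hlow := barrier_ge (s₀ := s₁) (c := min (b s₁) b₀) (fun s hs => hbd s (hs₁0.trans hs))
    (min_le_left _ _) (fun s hs _ he => by
      have hs0 := hs₁0.trans hs
      have hx := h.x_pos s hs0
      have hbb : b s ≤ b₀ := he ▸ min_le_right _ _
      have hbp := hb_pos s hs0
      have hv := hs₁ s hs
      have hv1 : 1 ≤ Real.exp s := by have : 0 ≤ b₀ * X ^ 4 := by positivity
                                      linarith
      have hbx : b s * x s ^ 4 = Real.exp s ^ 2 := by
        simp only [hb]; field_simp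
      have hxX : X ≤ x s := by
        refine le_of_pow_le_pow_left₀ (n := 4) (by norm_num) hx.le ?_
        have h1 : b₀ * X ^ 4 ≤ b₀ * x s ^ 4 := by
          calc b₀ * X ^ 4 ≤ Real.exp s := by linarith
            _ ≤ Real.exp s ^ 2 := le_self_pow₀ hv1 (by norm_num)
            _ = b s * x s ^ 4 := hbx.symm
            _ ≤ b₀ * x s ^ 4 := by gcongr
        exact le_of_mul_le_mul_left h1 hb₀0
      have hw0 := warp_pos hx
      have hwle : warp x s ≤ 2 * Real.exp s / x s ^ 3 := by
        unfold warp
        have := Real.exp_pos s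
        gcongr
        linarith
      have hz : warp x s ≤ 1 / 2 := by
        refine le_of_pow_le_pow_left₀ (n := 2) (by norm_num) (by norm_num) ?_
        calc warp x s ^ 2 ≤ (2 * Real.exp s / x s ^ 3) ^ 2 := by gcongr
          _ = 4 * b s / x s ^ 2 := by simp only [hb]; field_simp; ring
          _ ≤ 4 * b₀ / X ^ 2 := by gcongr
          _ ≤ (1 / 2) ^ 2 := by
            rw [div_le_iff₀ (by positivity)]
            have : X ≤ X ^ 2 := le_self_pow₀ hX1 (by norm_num)
            have : 0 ≤ 4 * lam * C := by positivity
            linarith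
      have hA : 2 * lam / x s * (warp x s * Real.exp s) ≤ 1 / 2 := by
        calc 2 * lam / x s * (warp x s * Real.exp s)
            ≤ 2 * lam / x s * (2 * Real.exp s / x s ^ 3 * Real.exp s) := by gcongr
          _ = 4 * lam * b s := by simp only [hb]; field_simp; ring
          _ ≤ 4 * lam * b₀ := by gcongr
          _ = 1 / 2 := by rw [hb₀]; field_simp; ring
      have hB : 2 * lam / x s * C ≤ 1 / 2 := by
        rw [div_mul_eq_mul_div, div_le_iff₀ hx]
        linarith
      have hC' : 2 * lam / x s * -(Real.exp s - P s / 2) ≤ 2 * lam / x s * C := by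
        have := hQ s hs0
        gcongr
        linarith
      have hR : 0 ≤ ratioRate lam x P s := by
        unfold ratioRate
        rw [mul_sub]
        linarith
      positivity)
  set c := min (b s₁) b₀ with hc
  have hc0 : 0 < c := lt_min (hb_pos s₁ hs₁0) hb₀0
  have htop := tendsto_atTop_of_le_hasDerivAt (s₀ := s₁) (c := 2 / (4 + 1 / c)) (by positivity)
    (fun s hs => h.deriv_Q (hs₁0.trans hs)) (fun s hs => by
      have hx := h.x_pos s (hs₁0.trans hs)
      have hv := hs₁ s hs
      have hv1 : 1 ≤ Real.exp s := by have : 0 ≤ b₀ * X ^ 4 := by positivity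
                                      linarith
      have h1 := hlow s hs
      simp only [hb] at h1
      rw [le_div_iff₀ (by positivity)] at h1
      have h2 : x s ^ 4 ≤ Real.exp s ^ 2 * (1 / c) := by
        rw [mul_one_div, le_div_iff₀ hc0]; linarith
      have h3 : x s ^ 3 ≤ 1 + x s ^ 4 := by
        rcases le_total (x s) 1 with h4 | h4
        · have : x s ^ 3 ≤ 1 := pow_le_one₀ hx.le h4
          have : 0 < x s ^ 4 := by positivity
          linarith
        · have : x s ^ 3 ≤ x s ^ 4 := pow_le_pow_right₀ h4 (by norm_num)
          linarith
      unfold warp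
      rw [div_mul_eq_mul_div, div_le_div_iff₀ (by positivity) (by positivity)]
      nlinarith)
  obtain ⟨s, hs1, hs2⟩ := ((htop.eventually_gt_atTop 0).and (eventually_ge_atTop s₀)).exists
  linarith [hcon s hs2]

/-- While `z ≥ ε`, its average `θ` also stays at least `ε`. When `z` touches `ε`, the `λ`-term
therefore pushes upwards, and `4 - 6ε > 0` makes the push strict. -/
theorem warp_ge_of_Q_pos (h : IsLogSoliton lam s₀ x P t) (hlam : 0 < lam)
    (hQ : 0 < Real.exp s₀ - P s₀ / 2) : ∃ ε > 0, ∀ s, s₀ ≤ s → ε ≤ warp x s := by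
  set ε := min (warp x s₀) (min ((Real.exp s₀ - P s₀ / 2) / Real.exp s₀) (1 / 2)) with hε
  have hε0 : 0 < ε := lt_min (warp_pos (h.x_pos s₀ le_rfl))
    (lt_min (div_pos hQ (Real.exp_pos _)) (by norm_num))
  have hε1 : ε ≤ 1 / 2 := (min_le_right _ _).trans (min_le_right _ _)
  have hε2 : ε * Real.exp s₀ ≤ Real.exp s₀ - P s₀ / 2 := by
    rw [← le_div_iff₀ (Real.exp_pos _)]
    exact (min_le_right _ _).trans (min_le_left _ _)
  refine ⟨ε, hε0, barrier_ge (fun s hs => h.deriv_warp hs) (min_le_left _ _)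
    fun s hs hist he => ?_⟩
  have hx := h.x_pos s hs
  have hmono := monotoneOn_Icc_of_hasDerivAt_nonneg (s₀ := s₀) (s₁ := s)
    (f := fun σ => Real.exp σ - P σ / 2 - ε * Real.exp σ)
    (f' := fun σ => warp x σ * Real.exp σ - ε * Real.exp σ)
    (fun σ hσ => (h.deriv_Q hσ.1).fun_sub ((Real.hasDerivAt_exp σ).const_mul ε))
    (fun σ hσ => by
      have := hist σ hσ.1 hσ.2
      have := Real.exp_pos σ
      nlinarith) ⟨le_rfl, hs⟩ ⟨hs, le_rfl⟩ hs
  simp only at hmono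
  have hR : 0 < ratioRate lam x P s := by
    unfold ratioRate
    have h1 : 2 * lam / x s * (warp x s * Real.exp s - (Real.exp s - P s / 2)) ≤ 0 :=
      mul_nonpos_of_nonneg_of_nonpos (by positivity) (by rw [he]; linarith)
    linarith
  have := warp_pos hx
  have : 0 < 1 - warp x s := by linarith
  positivity

/-- The mirror image of the lower barrier: `P > 0` says that the average `θ` starts below `1`, and
`4 - 6(1-ε) < 0` since `ε ≤ 1/4`. -/
theorem warp_le_of_P_pos (h : IsLogSoliton lam s₀ x P t) (hlam : 0 < lam)
    (hP : 0 < P s₀) : ∃ ε > 0, ∀ s, s₀ ≤ s → warp x s ≤ 1 - ε := by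
  set ε := min (1 - warp x s₀) (min (P s₀ / (2 * Real.exp s₀)) (1 / 4)) with hε
  have hε0 : 0 < ε := lt_min (sub_pos.2 (warp_lt_one (h.x_pos s₀ le_rfl)))
    (lt_min (by positivity) (by norm_num))
  have hε1 : ε ≤ 1 / 4 := (min_le_right _ _).trans (min_le_right _ _)
  have hε2 : ε * (2 * Real.exp s₀) ≤ P s₀ := by
    rw [← le_div_iff₀ (by positivity)]
    exact (min_le_right _ _).trans (min_le_left _ _)
  refine ⟨ε, hε0, barrier_le (fun s hs => h.deriv_warp hs)
    (by linarith [min_le_left (1 - warp x s₀) (min (P s₀ / (2 * Real.exp s₀)) (1 / 4))])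
    fun s hs hist he => ?_⟩
  have hx := h.x_pos s hs
  have hmono := monotoneOn_Icc_of_hasDerivAt_nonneg (s₀ := s₀) (s₁ := s)
    (f := fun σ => P σ - 2 * ε * Real.exp σ)
    (f' := fun σ => warp x σ * x σ ^ 3 - 2 * ε * Real.exp σ)
    (fun σ hσ => (h.deriv_P σ hσ.1).fun_sub ((Real.hasDerivAt_exp σ).const_mul (2 * ε)))
    (fun σ hσ => by
      have := hist σ hσ.1 hσ.2
      have := Real.exp_pos σ
      rw [warp_mul_cube (h.x_pos σ hσ.1)]
      nlinarith) ⟨le_rfl, hs⟩ ⟨hs, le_rfl⟩ hs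
  simp only at hmono
  have hR : ratioRate lam x P s < 0 := by
    unfold ratioRate
    have h1 : 0 ≤ 2 * lam / x s * (warp x s * Real.exp s - (Real.exp s - P s / 2)) :=
      mul_nonneg (by positivity) (by rw [he]; linarith)
    linarith
  have h1 := warp_pos hx
  have h2 : 0 < 1 - warp x s := by linarith
  exact mul_neg_of_pos_of_neg (by positivity) hR

/-- Expanders with `P ≤ 0` throughout have the doubly exponential asymptotics. -/
theorem expander_asymptotics (h : IsLogSoliton lam s₀ x P t) (hlam : 0 < lam)
    (hP : ∀ s, s₀ ≤ s → P s ≤ 0) {ε : ℝ} (hε : 0 < ε) (hz : ∀ s, s₀ ≤ s → ε ≤ warp x s) :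
    Tendsto t atTop atTop ∧ Tendsto (fun s => Real.exp s / x s ^ 3) atTop atTop ∧
      Tendsto (fun s => t s * x s) atTop (𝓝 (3 / lam)) ∧
      Tendsto (fun s => s / t s ^ 2) atTop (𝓝 (lam / 6)) ∧
      Tendsto x atTop (𝓝 0) := by
  -- At `x = M` the derivative is at most `M(1 - λεM²/3)`, which is negative once `λεM² > 3`.
  set M := max (x s₀) (3 / (lam * ε) + 1) with hM
  have hM1 : 1 ≤ M := le_max_of_le_right (by have : 0 < 3 / (lam * ε) := by positivity
                                             linarith)
  have hM0 : 0 < M := by linarith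
  have hM2 : 3 < lam * ε * M ^ 2 := by
    have h1 : 3 / (lam * ε) < M := lt_of_lt_of_le (by linarith) (le_max_right _ _)
    have h2 : M ≤ M ^ 2 := le_self_pow₀ hM1 (by norm_num)
    rw [div_lt_iff₀ (by positivity)] at h1
    have : lam * ε * M ≤ lam * ε * M ^ 2 := by gcongr
    linarith
  have hxM : ∀ s, s₀ ≤ s → x s ≤ M := by
    refine barrier_le h.deriv_x (le_max_left _ _) fun s hs _ he => ?_
    have hx := h.x_pos s hs
    have h1 : lam / 3 * (P s - warp x s * x s ^ 3) ≤ lam / 3 * (0 - ε * x s ^ 3) := by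
      have := hP s hs
      have := hz s hs
      gcongr
    have h2 : 0 ≤ 2 * (1 - warp x s) * x s := by
      have := warp_lt_one hx
      have : 0 < 1 - warp x s := by linarith
      positivity
    rw [he] at h1 h2 ⊢
    have h3 : M * 3 < M * (lam * ε * M ^ 2) := by gcongr
    nlinarith
  have hζ : ∀ s, s₀ ≤ s → 1 - warp x s ≤ M ^ 3 / 2 * Real.exp (-s) := by
    intro s hs
    have hx := h.x_pos s hs
    refine (one_sub_warp_le hx).trans ?_
    rw [Real.exp_neg, ← div_eq_mul_inv, div_div]
    gcongr
    exact hxM s hs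
  have hexp0 : Tendsto (fun s : ℝ => Real.exp (-s)) atTop (𝓝 0) := Real.tendsto_exp_neg_atTop_nhds_zero
  have hz1 : Tendsto (warp x) atTop (𝓝 1) := by
    have h1 : Tendsto (fun s => 1 - M ^ 3 / 2 * Real.exp (-s)) atTop (𝓝 1) := by
      simpa using (hexp0.const_mul (M ^ 3 / 2)).const_sub 1
    refine tendsto_of_tendsto_of_tendsto_of_le_of_le' h1 tendsto_const_nhds ?_ ?_
    · filter_upwards [eventually_ge_atTop s₀] with s hs
      linarith [hζ s hs]
    · filter_upwards [eventually_ge_atTop s₀] with s hs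
      exact (warp_lt_one (h.x_pos s hs)).le
  have hPmono := monotoneOn_Ici_of_hasDerivAt_nonneg (fun s hs => h.deriv_P s hs)
    (fun s hs => mul_nonneg (warp_pos (h.x_pos s hs)).le (pow_pos (h.x_pos s hs) 3).le)
  obtain ⟨L, hL, -⟩ := exists_tendsto_of_monotoneOn_Ici hPmono hP
  -- `P` is nondecreasing and bounded by `0`, so it converges. Its derivative dominates `ε x³`, and
  -- Barbalat's lemma applies.
  have hx0 : Tendsto x atTop (𝓝 0) := by
    refine tendsto_zero_of_convergent_of_lipschitz h.deriv_P hL h.deriv_x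
      (C := M + lam / 3 * (|P s₀| + M ^ 3)) (fun s hs => ?_) (fun e he => ?_)
    · have hx := h.x_pos s hs
      have hw := warp_pos hx
      have hw1 := warp_lt_one hx
      have h1 : |x s - 2 * (1 - warp x s) * x s| ≤ M := by
        have : x s - 2 * (1 - warp x s) * x s = (2 * warp x s - 1) * x s := by ring
        rw [this, abs_mul, abs_of_pos hx]
        have : |2 * warp x s - 1| ≤ 1 := abs_le.2 ⟨by linarith, by linarith⟩
        calc _ ≤ 1 * x s := by gcongr
          _ ≤ M := by linarith [hxM s hs]
      have h2 : |P s - warp x s * x s ^ 3| ≤ |P s₀| + M ^ 3 := by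
        refine (abs_sub _ _).trans (add_le_add ?_ ?_)
        · rw [abs_of_nonpos (hP s hs), abs_of_nonpos (hP s₀ le_rfl)]
          linarith [hPmono Set.self_mem_Ici hs hs]
        · rw [abs_of_pos (by positivity)]
          calc _ ≤ 1 * M ^ 3 := by
                have := hxM s hs
                gcongr
            _ = _ := one_mul _
      refine (abs_add_le _ _).trans (add_le_add h1 ?_)
      rw [abs_mul, abs_of_pos (by positivity : 0 < lam / 3)]
      gcongr
    · refine ⟨ε * e ^ 3, by positivity, ?_⟩
      filter_upwards [eventually_ge_atTop s₀] with s hs hk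
      rw [abs_of_pos (h.x_pos s hs)] at hk
      have := hz s hs
      have := warp_pos (h.x_pos s hs)
      gcongr
  -- Otherwise `x'` would tend to the nonzero number `λL/3` although `x` converges.
  have hL0 : L = 0 := by
    have h1 : Tendsto (fun s => x s - 2 * (1 - warp x s) * x s +
        lam / 3 * (P s - warp x s * x s ^ 3)) atTop (𝓝 (lam / 3 * L)) := by
      have := ((hx0.sub (((hz1.const_sub 1).const_mul 2).mul hx0)).add
        ((hL.sub (hz1.mul (hx0.pow 3))).const_mul (lam / 3)))
      simpa using this
    have := deriv_limit_eq_zero h.deriv_x hx0 h1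
    rcases mul_eq_zero.1 this with h2 | h2
    · linarith
    · exact h2
  rw [hL0] at hL
  set w : ℝ → ℝ := fun s => x s + lam / 3 * P s with hwdef
  have hw_lim : Tendsto w atTop (𝓝 0) := by
    simpa using hx0.add (hL.const_mul (lam / 3))
  have hw_nonneg : ∀ s, s₀ ≤ s → 0 ≤ w s := by
    have hanti := antitoneOn_Ici_of_hasDerivAt_nonpos (fun s hs => h.deriv_w_div hs)
      (fun s hs => by
        have hx := h.x_pos s hs
        have : 0 < 1 - warp x s := by linarith [warp_lt_one hx]
        have : 0 ≤ 2 * (1 - warp x s) * (x s * Real.exp (-s)) := by positivity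
        linarith)
    have hlim : Tendsto (fun s => w s * Real.exp (-s)) atTop (𝓝 0) := by
      simpa using hw_lim.mul hexp0
    intro s hs
    have : 0 ≤ w s * Real.exp (-s) := by
      refine le_of_tendsto hlim ?_
      filter_upwards [eventually_ge_atTop s] with σ hσ
      exact hanti hs (hs.trans hσ) hσ
    exact nonneg_of_mul_nonneg_left this (Real.exp_pos _)
  set K := M ^ 3 with hK
  have hK0 : 0 < K := by positivity
  obtain ⟨s₁, hs₁0, hs₁⟩ : ∃ s₁, s₀ ≤ s₁ ∧ ∀ s, s₁ ≤ s → K * Real.exp (-s) ≤ 1 / 2 := by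
    have h1 : Tendsto (fun s => K * Real.exp (-s)) atTop (𝓝 0) := by
      simpa using hexp0.const_mul K
    obtain ⟨N, hN⟩ := eventually_atTop.1 (h1.eventually (gt_mem_nhds (show (0:ℝ) < 1 / 2 by norm_num)))
    exact ⟨max s₀ N, le_max_left _ _, fun s hs => (hN s ((le_max_right _ _).trans hs)).le⟩
  -- This and `0 ≤ w` show that `w = x + λP/3` is exponentially small relative to `x`. The
  -- difference is nondecreasing and tends to zero, hence is nonpositive.
  have hwK : ∀ s, s₁ ≤ s → w s ≤ K * Real.exp (-s) * x s := by
    have hmono := monotoneOn_Ici_of_hasDerivAt_nonneg (s₀ := s₁)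
      (f := fun s => w s - K * Real.exp (-s) * x s)
      (f' := fun s => w s - 2 * (1 - warp x s) * x s - (K * -Real.exp (-s) * x s +
        K * Real.exp (-s) * (x s - 2 * (1 - warp x s) * x s +
          lam / 3 * (P s - warp x s * x s ^ 3))))
      (fun s hs => (h.deriv_w (hs₁0.trans hs)).fun_sub
        (((by simpa using (hasDerivAt_id s).neg.exp :
          HasDerivAt (fun s : ℝ => Real.exp (-s)) (-Real.exp (-s)) s).const_mul K).fun_mul
            (h.deriv_x s (hs₁0.trans hs))))
      (fun s hs => by
        have hs0 := hs₁0.trans hs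
        have hx := h.x_pos s hs0
        have hwp := warp_pos hx
        have h1 : x s - 2 * (1 - warp x s) * x s + lam / 3 * (P s - warp x s * x s ^ 3) ≤ w s := by
          have a1 : 0 ≤ (1 - warp x s) * x s :=
            mul_nonneg (by linarith [warp_lt_one hx]) hx.le
          have a2 : 0 ≤ lam / 3 * (warp x s * x s ^ 3) := by positivity
          simp only [hwdef]
          linarith
        have h2 : 2 * (1 - warp x s) * x s ≤ K * Real.exp (-s) * x s := by
          have := hζ s hs0
          exact mul_le_mul_of_nonneg_right (by linarith) hx.le
        have h3 : K * Real.exp (-s) * (x s - 2 * (1 - warp x s) * x s +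
            lam / 3 * (P s - warp x s * x s ^ 3)) ≤ K * Real.exp (-s) * w s := by
          gcongr
        have h4 : K * Real.exp (-s) * w s ≤ 1 / 2 * w s :=
          mul_le_mul_of_nonneg_right (hs₁ s hs) (hw_nonneg s hs0)
        have := hw_nonneg s hs0
        linarith)
    have hlim : Tendsto (fun s => w s - K * Real.exp (-s) * x s) atTop (𝓝 0) := by
      simpa using hw_lim.sub ((hexp0.const_mul K).mul hx0)
    intro s hs
    have : w s - K * Real.exp (-s) * x s ≤ 0 := by
      refine ge_of_tendsto hlim ?_
      filter_upwards [eventually_ge_atTop s] with σ hσ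
      exact hmono hs (hs.trans hσ) hσ
    linarith
  set η : ℝ → ℝ := fun s => -(lam / 3) * P s with hη
  have hηw : ∀ s, η s = x s - w s := fun s => by simp only [hη, hwdef]; ring
  have hηhalf : ∀ s, s₁ ≤ s → x s / 2 ≤ η s := fun s hs => by
    have hx := h.x_pos s (hs₁0.trans hs)
    rw [hηw]
    have := hwK s hs
    have := mul_le_mul_of_nonneg_right (hs₁ s hs) hx.le
    linarith
  have hη0 : ∀ s, s₁ ≤ s → 0 < η s := fun s hs =>
    lt_of_lt_of_le (half_pos (h.x_pos s (hs₁0.trans hs))) (hηhalf s hs)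
  have hratio : Tendsto (fun s => x s / η s) atTop (𝓝 1) := by
    have h1 : Tendsto (fun s => η s / x s) atTop (𝓝 1) := by
      have h2 : Tendsto (fun s => 1 - K * Real.exp (-s)) atTop (𝓝 1) := by
        simpa using (hexp0.const_mul K).const_sub 1
      refine tendsto_of_tendsto_of_tendsto_of_le_of_le' h2 tendsto_const_nhds ?_ ?_
      · filter_upwards [eventually_ge_atTop s₁] with s hs
        rw [le_div_iff₀ (h.x_pos s (hs₁0.trans hs)), hηw]
        linarith [hwK s hs]
      · filter_upwards [eventually_ge_atTop s₁] with s hs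
        rw [div_le_iff₀ (h.x_pos s (hs₁0.trans hs)), hηw]
        linarith [hw_nonneg s (hs₁0.trans hs)]
    simpa using h1.inv₀ one_ne_zero
  have hηlim : Tendsto η atTop (𝓝 0) := by
    simpa only [mul_zero] using hL.const_mul (-(lam / 3))
  -- Since `x/η → 1`, this says `d(1/η)/dt → λ/3`, from which both `t → ∞` and the limit of `tx`
  -- follow.
  have hηd : ∀ s, s₁ ≤ s → HasDerivAt (fun s => (η s)⁻¹)
      (lam / 3 * (x s / η s) ^ 2 * (warp x s * x s)) s := by
    intro s hs
    have := (hη0 s hs).ne'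
    refine (((h.deriv_P s (hs₁0.trans hs)).const_mul (-(lam / 3))).fun_inv this).congr_deriv ?_
    change _ / (η s) ^ 2 = _
    field_simp
  have hηtop : Tendsto (fun s => (η s)⁻¹) atTop atTop := by
    refine (tendsto_nhdsWithin_iff.2 ⟨hηlim, ?_⟩).inv_tendsto_nhdsGT_zero
    filter_upwards [eventually_ge_atTop s₁] with s hs using hη0 s hs
  have htpos : ∀ s, s₁ ≤ s → 0 < warp x s * x s := fun s hs =>
    mul_pos (warp_pos (h.x_pos s (hs₁0.trans hs))) (h.x_pos s (hs₁0.trans hs))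
  have httop : Tendsto t atTop atTop := by
    have hmono := monotoneOn_Ici_of_hasDerivAt_nonneg (s₀ := s₁)
      (f := fun s => lam / 3 * 4 * t s - (η s)⁻¹)
      (f' := fun s => lam / 3 * 4 * (warp x s * x s) -
        lam / 3 * (x s / η s) ^ 2 * (warp x s * x s))
      (fun s hs => ((h.deriv_t s (hs₁0.trans hs)).const_mul _).fun_sub (hηd s hs))
      (fun s hs => by
        have hx := h.x_pos s (hs₁0.trans hs)
        have h1 : x s / η s ≤ 2 := by
          rw [div_le_iff₀ (hη0 s hs)]; linarith [hηhalf s hs]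
        have h2 : (x s / η s) ^ 2 ≤ 4 := by
          have := hη0 s hs
          calc (x s / η s) ^ 2 ≤ 2 ^ 2 := by gcongr
            _ = 4 := by norm_num
        have h3 : lam / 3 * (x s / η s) ^ 2 * (warp x s * x s) ≤
            lam / 3 * 4 * (warp x s * x s) := by
          have := htpos s hs
          gcongr
        linarith)
    have h1 : Tendsto (fun s => lam / 3 * 4 * t s) atTop atTop := by
      refine tendsto_atTop_mono' _ ?_
        (tendsto_atTop_add_const_right _ (lam / 3 * 4 * t s₁ - (η s₁)⁻¹) hηtop)
      filter_upwards [eventually_ge_atTop s₁] with s hs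
      have := hmono Set.self_mem_Ici hs hs
      simp only at this
      linarith
    exact (tendsto_const_mul_atTop_of_pos (by positivity)).1 h1
  have hηt : Tendsto (fun s => (η s)⁻¹ / t s) atTop (𝓝 (lam / 3)) := by
    refine tendsto_div_of_tendsto_deriv_div hηd (fun s hs => h.deriv_t s (hs₁0.trans hs))
      htpos httop ?_
    have h1 : Tendsto (fun s => lam / 3 * (x s / η s) ^ 2) atTop (𝓝 (lam / 3)) := by
      simpa using (hratio.pow 2).const_mul (lam / 3)
    refine h1.congr' ?_
    filter_upwards [eventually_ge_atTop s₁] with s hs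
    rw [mul_div_cancel_right₀ _ (htpos s hs).ne']
  have htx : Tendsto (fun s => t s * x s) atTop (𝓝 (3 / lam)) := by
    have h1 := (hηt.inv₀ (by positivity)).mul hratio
    rw [mul_one, inv_div] at h1
    refine h1.congr' ?_
    filter_upwards [eventually_ge_atTop s₁] with s hs
    have := (hη0 s hs).ne'
    rw [inv_div, div_inv_eq_mul]
    field_simp
  refine ⟨httop, ?_, htx, ?_, hx0⟩
  · refine tendsto_atTop_mono' _ ?_ (Real.tendsto_exp_atTop.atTop_mul_const (inv_pos.2 hK0))
    filter_upwards [eventually_ge_atTop s₀] with s hs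
    have hx := h.x_pos s hs
    have := hxM s hs
    rw [div_eq_mul_inv, hK]
    gcongr
  · obtain ⟨s₂, hs₂⟩ := eventually_atTop.1 (httop.eventually_gt_atTop 0)
    have h12 : s₁ ≤ max s₁ s₂ := le_max_left _ _
    refine tendsto_div_of_tendsto_deriv_div (s₀ := max s₁ s₂) (f := fun s => s) (f' := fun _ => 1)
      (g' := fun s => 2 * t s * (warp x s * x s)) (fun s _ => hasDerivAt_id s)
      (fun s hs => ((h.deriv_t s (hs₁0.trans (h12.trans hs))).fun_pow 2).congr_deriv
        (by push_cast; ring))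
      (fun s hs => by
        have := htpos s (h12.trans hs)
        have := hs₂ s ((le_max_right _ _).trans hs)
        positivity)
      ((tendsto_pow_atTop (by norm_num : 2 ≠ 0)).comp httop) ?_
    have h1 : Tendsto (fun s => (2 * warp x s * (t s * x s))⁻¹) atTop (𝓝 (lam / 6)) := by
      have h2 := ((hz1.const_mul 2).mul htx).inv₀ (by positivity)
      convert h2 using 2
      field_simp
      norm_num
    refine h1.congr fun s => ?_
    rw [one_div]
    ring

end IsLogSoliton

/-! ### The planar system of collapsing shrinker ends -/

/-- The right-hand side of the equation for `a`. -/
noncomputable def collapseField (a n z : ℝ) : ℝ :=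
  9 / 2 * n * (1 - z) ^ 2 * a - 6 * z * (1 - z) * a - (a + 1 / 3) * (a + 4 / 3 - 2 * z)

/-- The system satisfied by `a = -(log r)' / 3`, where `r = y² / x²`, the rescaled `n = y⁴ / x²`
and `z = warp x` on a shrinker end with `r → 0`, in logarithmic volume time. -/
structure IsCollapsing (s₀ : ℝ) (a n z : ℝ → ℝ) : Prop where
  a_pos : ∀ s, s₀ ≤ s → 0 < a s
  n_pos : ∀ s, s₀ ≤ s → 0 < n s
  z_pos : ∀ s, s₀ ≤ s → 0 < z s
  z_le : ∀ s, s₀ ≤ s → z s ≤ 1 / 36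
  z_lim : Tendsto z atTop (𝓝 0)
  deriv_a : ∀ s, s₀ ≤ s → HasDerivAt a (collapseField (a s) (n s) (z s)) s
  deriv_n : ∀ s, s₀ ≤ s → HasDerivAt n (n s * (2 / 3 - 4 * a s)) s
  deriv_z : ∀ s, s₀ ≤ s → HasDerivAt z (-3 * a s * (z s * (1 - z s))) s

/-- With `n` well below its equilibrium value `1`, the variable `a` is driven down at a definite
rate, eventually against its positivity. -/
theorem collapseField_le {a n z : ℝ} (ha : 0 < a) (hn : n ≤ 1 / 3) (hz : 0 < z)
    (hz' : z ≤ 1 / 36) : collapseField a n z ≤ -(5 / 12) := by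
  unfold collapseField
  have h1 : (1 - z) ^ 2 ≤ 1 := pow_le_one₀ (by linarith) (by linarith)
  have h2 : 9 / 2 * n * (1 - z) ^ 2 * a ≤ 9 / 2 * (1 / 3) * 1 * a := by gcongr
  have h3 : 0 ≤ 6 * z * (1 - z) * a := by
    have : 0 ≤ 1 - z := by linarith
    positivity
  have h4 : z * a ≤ 1 / 36 * a := by gcongr
  nlinarith [sq_nonneg a]

/-- `m - 1 - log m`, a convex function of `m > 0` with minimum `0` at `m = 1`. -/
noncomputable def logGap (m : ℝ) : ℝ := m - 1 - Real.log m

theorem logGap_nonneg {m : ℝ} (hm : 0 < m) : 0 ≤ logGap m := by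
  unfold logGap; linarith [Real.log_le_sub_one_of_pos hm]

theorem logGap_one : logGap 1 = 0 := by simp [logGap]

theorem le_of_logGap_le {m K : ℝ} (hm : 0 < m) (h : logGap m ≤ K) : m ≤ 2 * K + 2 := by
  unfold logGap at h
  have h1 := Real.log_le_sub_one_of_pos (half_pos hm)
  rw [Real.log_div hm.ne' (by norm_num)] at h1
  have := Real.log_two_lt_d9
  linarith

theorem exp_le_of_logGap_le {m K : ℝ} (hm : 0 < m) (h : logGap m ≤ K) :
    Real.exp (-(K + 1)) ≤ m := by
  unfold logGap at h
  rw [← Real.le_log_iff_exp_le hm]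
  linarith

/-- The left branch is excluded: on `[1/4, 1]` the gap is at most `2 log 2 - 3/4 < 2/3`. -/
theorem le_of_le_logGap {m : ℝ} (hm : 1 / 4 ≤ m) (h : 2 / 3 ≤ logGap m) : 5 / 3 ≤ m := by
  unfold logGap at h
  rcases le_total m 1 with h1 | h1
  · exfalso
    have hm0 : 0 < m := by linarith
    have h2 : Real.log m = Real.log (4 * m) - 2 * Real.log 2 := by
      rw [Real.log_mul (by norm_num) hm0.ne', show (4 : ℝ) = 2 ^ 2 by norm_num, Real.log_pow]
      push_cast; ring
    have h3 := Real.one_sub_inv_le_log_of_pos (show 0 < 4 * m by linarith)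
    have h4 := Real.log_two_lt_d9
    have h5 : m + (4 * m)⁻¹ ≤ 5 / 4 := by
      rw [← sub_nonneg]
      have : 5 / 4 - (m + (4 * m)⁻¹) = (1 - m) * (4 * m - 1) / (4 * m) := by field_simp; ring
      rw [this]
      apply div_nonneg (mul_nonneg _ _) <;> linarith
    linarith
  · have := Real.log_nonneg h1
    linarith

theorem hasDerivAt_logGap {m : ℝ} (hm : m ≠ 0) : HasDerivAt logGap (1 - m⁻¹) m :=
  ((hasDerivAt_id m).sub_const 1).fun_sub (Real.hasDerivAt_log hm)

/-- The energy, monotone along the limiting planar system. -/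
noncomputable def collapseEnergy (a n : ℝ) : ℝ := 9 / 2 * logGap n + 2 / 3 * logGap (6 * a)

theorem collapseEnergy_bounds {a n : ℝ} (ha : 0 < a) (hn : 0 < n) (h : collapseEnergy a n ≤ 4) :
    n ≤ 4 ∧ a ≤ 7 / 3 ∧ Real.exp (-7) / 6 ≤ a := by
  unfold collapseEnergy at h
  have h1 := logGap_nonneg hn
  have h2 := logGap_nonneg (show 0 < 6 * a by linarith)
  have h3 := le_of_logGap_le hn (show logGap n ≤ 1 by linarith)
  have h4 := le_of_logGap_le (show 0 < 6 * a by linarith) (show logGap (6 * a) ≤ 6 by linarith)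
  have h5 := exp_le_of_logGap_le (show 0 < 6 * a by linarith) (show logGap (6 * a) ≤ 6 by linarith)
  norm_num at h5
  exact ⟨by linarith, by linarith, by linarith⟩

/-- For `z = 0` the energy has derivative `4(a - 1/6)²(8/3 - a)/a`, nonnegative where the energy is
at most `4` because then `a ≤ 7/3`. A positive `z` adds an error of size `O(z)`. Since `z` itself
decays at rate about `3a`, with `a` bounded below on this energy region, subtracting `C z` absorbs
the error. -/
theorem exists_energy_deriv_ge : ∃ C : ℝ, 0 ≤ C ∧ ∀ a n z : ℝ, 0 < a → 0 < n → 0 < z →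
    z ≤ 1 / 36 → collapseEnergy a n ≤ 4 → (a - 1 / 6) ^ 2 / 2 + z ≤
      9 / 2 * ((1 - n⁻¹) * (n * (2 / 3 - 4 * a))) +
        2 / 3 * ((1 - (6 * a)⁻¹) * (6 * collapseField a n z)) -
        C * (-3 * a * (z * (1 - z))) := by
  set a₀ := Real.exp (-7) / 6 with ha₀
  have ha₀0 : 0 < a₀ := by positivity
  set E := 46 + 2 / (3 * a₀) with hE
  have hE0 : 0 < E := by positivity
  set C := (10 * E + 1) / a₀ with hC
  have hC0 : 0 < C := by positivity
  refine ⟨C, hC0.le, fun a n z ha hn hz hz' hH => ?_⟩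
  obtain ⟨hn4, ha7, haa⟩ := collapseEnergy_bounds ha hn hH
  set e := -(9 / 2 * n * (2 - z)) + 2 + 2 / (3 * a) - 6 * (1 - z) with he
  have hid : 9 / 2 * ((1 - n⁻¹) * (n * (2 / 3 - 4 * a))) +
      2 / 3 * ((1 - (6 * a)⁻¹) * (6 * collapseField a n z)) =
      4 * (a - 1 / 6) ^ 2 * (8 / 3 - a) / a + 4 * (a - 1 / 6) * (z * e) := by
    rw [he]; unfold collapseField
    field_simp
    ring
  have hinv : 2 / (3 * a) ≤ 2 / (3 * a₀) := by gcongr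
  have hinv0 : 0 < 2 / (3 * a) := by positivity
  have heE : |e| ≤ E := by
    rw [he, hE, abs_le]
    constructor <;> nlinarith [mul_pos hn hz]
  have hk : |a - 1 / 6| ≤ 5 / 2 := abs_le.2 ⟨by linarith, by linarith⟩
  have h1 : |4 * (a - 1 / 6) * (z * e)| ≤ 10 * E * z := by
    rw [abs_mul, abs_mul, abs_mul, abs_of_pos hz, abs_of_pos (by norm_num : (0 : ℝ) < 4)]
    calc 4 * |a - 1 / 6| * (z * |e|) ≤ 4 * (5 / 2) * (z * E) := by gcongr
      _ = _ := by ring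
  have h2 : (a - 1 / 6) ^ 2 / 2 ≤ 4 * (a - 1 / 6) ^ 2 * (8 / 3 - a) / a := by
    rw [le_div_iff₀ ha]
    nlinarith [sq_nonneg (a - 1 / 6)]
  have h3 : (10 * E + 1) * z ≤ -(C * (-3 * a * (z * (1 - z)))) := by
    have : C * a ≥ 10 * E + 1 := by
      calc C * a ≥ C * a₀ := by gcongr
        _ = _ := by rw [hC]; field_simp
    have h4 : C * a * z ≥ (10 * E + 1) * z := by gcongr
    have h5 : 0 < C * a * z := by positivity
    nlinarith
  have := neg_abs_le (4 * (a - 1 / 6) * (z * e))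
  rw [hid]
  linarith

namespace IsCollapsing

variable {s₀ : ℝ} {a n z : ℝ → ℝ}

theorem mono (h : IsCollapsing s₀ a n z) {s₁ : ℝ} (hs : s₀ ≤ s₁) : IsCollapsing s₁ a n z where
  a_pos s h1 := h.a_pos s (hs.trans h1)
  n_pos s h1 := h.n_pos s (hs.trans h1)
  z_pos s h1 := h.z_pos s (hs.trans h1)
  z_le s h1 := h.z_le s (hs.trans h1)
  z_lim := h.z_lim
  deriv_a s h1 := h.deriv_a s (hs.trans h1)
  deriv_n s h1 := h.deriv_n s (hs.trans h1)
  deriv_z s h1 := h.deriv_z s (hs.trans h1)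

theorem not_forall_n_le (h : IsCollapsing s₀ a n z) : ¬ ∀ s, s₀ ≤ s → n s ≤ 1 / 3 := by
  intro hn
  have := tendsto_atTop_of_le_hasDerivAt (f := fun s => -a s) (s₀ := s₀)
    (by norm_num : (0 : ℝ) < 5 / 12) (fun s hs => (h.deriv_a s hs).neg) (fun s hs => by
      linarith [collapseField_le (h.a_pos s hs) (hn s hs) (h.z_pos s hs)
        (h.z_le s hs)])
  obtain ⟨s, h1, h2⟩ := ((this.eventually_gt_atTop 0).and (eventually_ge_atTop s₀)).exists
  linarith [h.a_pos s h2]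

/-- Starting with `a ≤ 1/6` and `n < 1/4`, the value of `n` would remain below `1/3` forever, which
`not_forall_n_le` forbids. -/
theorem n_ge (h : IsCollapsing s₀ a n z) {s : ℝ} (hs : s₀ ≤ s) (ha : a s ≤ 1 / 6) :
    1 / 4 ≤ n s := by
  by_contra hlt
  push Not at hlt
  have hexp : Real.exp (8 / 5 * (1 / 6)) ≤ 4 / 3 := by
    have h1 : Real.exp (2 / 15) ≤ 15 / 13 := by
      have h2 := Real.one_sub_le_exp_neg (2 / 15)
      rw [Real.exp_neg] at h2
      have h3 := inv_anti₀ (by norm_num) h2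
      rw [inv_inv] at h3
      norm_num at h3 ⊢
      linarith
    have h4 : Real.exp (8 / 5 * (1 / 6)) = Real.exp (2 / 15) ^ 2 := by
      rw [← Real.exp_nat_mul]; norm_num
    rw [h4]
    calc _ ≤ (15 / 13 : ℝ) ^ 2 := by gcongr
      _ ≤ _ := by norm_num
  -- The exponent `8/5` balances the growth of `n`: `8/5 · 5/12 = 2/3` leaves the negative rate
  -- `-4a`. The initial value is controlled by `1/4 · 4/3 = 1/3`.
  have hn_le : ∀ σ, s ≤ σ → n σ * Real.exp (8 / 5 * a σ) ≤ 1 / 3 := by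
    refine barrier_le (f' := fun σ => n σ * (2 / 3 - 4 * a σ) * Real.exp (8 / 5 * a σ) +
      n σ * (Real.exp (8 / 5 * a σ) * (8 / 5 * collapseField (a σ) (n σ) (z σ))))
      (fun σ hσ => (h.deriv_n σ (hs.trans hσ)).fun_mul
        ((h.deriv_a σ (hs.trans hσ)).const_mul (8 / 5)).exp) ?_ ?_
    · have : Real.exp (8 / 5 * a s) ≤ Real.exp (8 / 5 * (1 / 6)) := by gcongr
      have := h.n_pos s hs
      calc n s * Real.exp (8 / 5 * a s) ≤ 1 / 4 * (4 / 3) := by gcongr; linarith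
        _ = 1 / 3 := by norm_num
    · intro σ hσ _ he
      have hσ0 := hs.trans hσ
      have hap := h.a_pos σ hσ0
      have hnp := h.n_pos σ hσ0
      have h1 : 1 ≤ Real.exp (8 / 5 * a σ) := Real.one_le_exp (by positivity)
      have hn3 : n σ ≤ 1 / 3 := by
        have := mul_le_mul_of_nonneg_left h1 hnp.le
        linarith
      have h2 := collapseField_le hap hn3 (h.z_pos σ hσ0) (h.z_le σ hσ0)
      have h3 : n σ * (2 / 3 - 4 * a σ) * Real.exp (8 / 5 * a σ) +
          n σ * (Real.exp (8 / 5 * a σ) * (8 / 5 * collapseField (a σ) (n σ) (z σ))) =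
          n σ * Real.exp (8 / 5 * a σ) *
            (2 / 3 - 4 * a σ + 8 / 5 * collapseField (a σ) (n σ) (z σ)) := by ring
      rw [h3]
      exact mul_neg_of_pos_of_neg (by positivity) (by linarith)
  refine (h.mono hs).not_forall_n_le fun σ hσ => ?_
  have h1 : 1 ≤ Real.exp (8 / 5 * a σ) :=
    Real.one_le_exp (by have := h.a_pos σ (hs.trans hσ); positivity)
  have := mul_le_mul_of_nonneg_left h1 (h.n_pos σ (hs.trans hσ)).le
  linarith [hn_le σ hσ]

theorem deriv_a_bound (h : IsCollapsing s₀ a n z) {A N : ℝ}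
    (hA : ∀ s, s₀ ≤ s → a s ≤ A) (hN : ∀ s, s₀ ≤ s → n s ≤ N) :
    ∀ s, s₀ ≤ s → |collapseField (a s) (n s) (z s)| ≤
      9 / 2 * N * A + A + (A + 1 / 3) * (A + 4 / 3) := by
  intro s hs
  have ha := h.a_pos s hs
  have hn := h.n_pos s hs
  have hz := h.z_pos s hs
  have hz' := h.z_le s hs
  have hA' := hA s hs
  have hN' := hN s hs
  have hA0 : 0 < A := ha.trans_le hA'
  have hN0 : 0 < N := hn.trans_le hN'
  have h0 : 0 < 1 - z s := by linarith
  have h1 : (1 - z s) ^ 2 ≤ 1 := pow_le_one₀ (by linarith) (by linarith)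
  have h2 : 9 / 2 * n s * (1 - z s) ^ 2 * a s ≤ 9 / 2 * N * 1 * A := by gcongr
  have h2' : 0 ≤ 9 / 2 * n s * (1 - z s) ^ 2 * a s := by positivity
  have h3 : 6 * z s * (1 - z s) * a s ≤ 1 * A := by
    have : 6 * z s * (1 - z s) ≤ 1 := by nlinarith
    gcongr
  have h3' : 0 ≤ 6 * z s * (1 - z s) * a s := by positivity
  have h4 : (a s + 1 / 3) * (a s + 4 / 3 - 2 * z s) ≤ (A + 1 / 3) * (A + 4 / 3) := by
    apply mul_le_mul <;> linarith
  have h4' : 0 ≤ (a s + 1 / 3) * (a s + 4 / 3 - 2 * z s) := by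
    apply mul_nonneg <;> linarith
  have h5 : 0 ≤ 9 / 2 * N * A := by positivity
  have h6 : 0 ≤ (A + 1 / 3) * (A + 4 / 3) := by positivity
  unfold collapseField
  rw [abs_le]
  constructor <;> linarith

/-- With `a → 1/6` and `z → 0`, the difference `a' - (3/4)(n - 1)` tends to zero, so convergence of
`a` forces `n → 1` by Barbalat's lemma. -/
theorem n_tendsto_one (h : IsCollapsing s₀ a n z) {A N : ℝ}
    (hA : ∀ s, s₀ ≤ s → a s ≤ A) (hN : ∀ s, s₀ ≤ s → n s ≤ N)
    (ha : Tendsto a atTop (𝓝 (1 / 6))) : Tendsto n atTop (𝓝 1) := by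
  have hA0 : 0 < A := (h.a_pos s₀ le_rfl).trans_le (hA s₀ le_rfl)
  have key : Tendsto (fun s => 3 / 4 * (n s - 1)) atTop (𝓝 0) := by
    refine tendsto_zero_of_convergent_deriv_asymp h.deriv_a ha
      (g' := fun s => 3 / 4 * (n s * (2 / 3 - 4 * a s))) (C := 3 / 4 * (N * (2 / 3 + 4 * A)))
      (fun s hs => ((h.deriv_n s hs).sub_const 1).const_mul (3 / 4)) (fun s hs => ?_) ?_
    · have h1 := h.a_pos s hs
      have h2 := h.n_pos s hs
      have h3 := hA s hs
      have h4 := hN s hs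
      have h5 : |2 / 3 - 4 * a s| ≤ 2 / 3 + 4 * A := abs_le.2 ⟨by linarith, by linarith⟩
      rw [abs_mul, abs_mul, abs_of_pos h2, abs_of_pos (by norm_num : (0:ℝ) < 3 / 4)]
      have : 0 < N := h2.trans_le h4
      gcongr
    · have hz := h.z_lim
      have h1 : Tendsto (fun s => 9 / 2 * (1 - z s) ^ 2 * a s - 3 / 4) atTop (𝓝 0) := by
        have := ((((hz.const_sub 1).pow 2).const_mul (9 / 2)).mul ha).sub_const (3 / 4)
        norm_num at this
        exact this
      have h2 : Tendsto (fun s => 6 * z s * (1 - z s) * a s) atTop (𝓝 0) := by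
        simpa using (((hz.const_mul 6).mul (hz.const_sub 1)).mul ha)
      have h3 : Tendsto (fun s => (a s + 1 / 3) * (a s + 4 / 3 - 2 * z s) - 3 / 4) atTop (𝓝 0) := by
        have := (((ha.add_const (1 / 3)).mul ((ha.add_const (4 / 3)).sub (hz.const_mul 2))).sub_const
          (3 / 4))
        norm_num at this
        exact this
      have h4 : Tendsto (fun s => n s * (9 / 2 * (1 - z s) ^ 2 * a s - 3 / 4)) atTop (𝓝 0) := by
        have hb : IsBoundedUnder (· ≤ ·) atTop (fun s => ‖n s‖) := by
          refine ⟨N, eventually_map.2 ?_⟩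
          filter_upwards [eventually_ge_atTop s₀] with s hs
          rw [Real.norm_eq_abs, abs_of_pos (h.n_pos s hs)]
          exact hN s hs
        exact isBoundedUnder_le_mul_tendsto_zero hb h1
      have h5 := (h4.sub h2).sub h3
      simp only [sub_zero] at h5
      refine h5.congr fun s => ?_
      unfold collapseField
      ring
  have := (key.const_mul (4 / 3)).add_const 1
  norm_num at this
  refine this.congr fun s => by ring

theorem energy_tendsto_zero (ha : Tendsto a atTop (𝓝 (1 / 6))) (hn : Tendsto n atTop (𝓝 1)) :
    Tendsto (fun s => collapseEnergy (a s) (n s)) atTop (𝓝 0) := by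
  have hc : ContinuousAt logGap 1 := (hasDerivAt_logGap one_ne_zero).continuousAt
  have h1 : Tendsto (fun s => logGap (n s)) atTop (𝓝 0) := by
    rw [← logGap_one]; exact hc.tendsto.comp hn
  have h2 : Tendsto (fun s => logGap (6 * a s)) atTop (𝓝 0) := by
    rw [← logGap_one]
    refine hc.tendsto.comp ?_
    have := ha.const_mul 6
    norm_num at this
    exact this
  simpa [collapseEnergy] using (h1.const_mul (9 / 2)).add (h2.const_mul (2 / 3))

theorem deriv_energy (h : IsCollapsing s₀ a n z) (C : ℝ) {s : ℝ} (hs : s₀ ≤ s) :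
    HasDerivAt (fun s => collapseEnergy (a s) (n s) - C * z s)
      (9 / 2 * ((1 - (n s)⁻¹) * (n s * (2 / 3 - 4 * a s))) +
        2 / 3 * ((1 - (6 * a s)⁻¹) * (6 * collapseField (a s) (n s) (z s))) -
        C * (-3 * a s * (z s * (1 - z s)))) s := by
  have ha := h.a_pos s hs
  have h1 := (hasDerivAt_logGap (h.n_pos s hs).ne').comp s (h.deriv_n s hs)
  have h2 := (hasDerivAt_logGap (show 6 * a s ≠ 0 by positivity)).comp s
    ((h.deriv_a s hs).const_mul 6)
  exact ((h1.const_mul (9 / 2)).fun_add (h2.const_mul (2 / 3))).fun_sub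
    ((h.deriv_z s hs).const_mul C)

/-- The variable `n` cannot increase to infinity with `a < 1/6`. -/
theorem exists_n_bound (h : IsCollapsing s₀ a n z) (ha : ∀ s, s₀ ≤ s → a s < 1 / 6) :
    ∃ N, ∀ s, s₀ ≤ s → n s ≤ N := by
  by_contra hcon
  push Not at hcon
  have hmono := monotoneOn_Ici_of_hasDerivAt_nonneg h.deriv_n (fun s hs =>
    mul_nonneg (h.n_pos s hs).le (by linarith [ha s hs]))
  obtain ⟨s₁, hs₁, hn₁⟩ := hcon 8
  have hn8 : ∀ s, s₁ ≤ s → 8 < n s := fun s hs =>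
    hn₁.trans_le (hmono hs₁ (hs₁.trans hs) hs)
  have hfield : ∀ s, s₁ ≤ s → 3 * (n s * a s) - 3 / 4 ≤ collapseField (a s) (n s) (z s) := by
    intro s hs
    have hs0 := hs₁.trans hs
    have hap := h.a_pos s hs0
    have hlt := ha s hs0
    have hn := hn8 s hs
    have hz := h.z_pos s hs0
    have hz' := h.z_le s hs0
    have h1 : (35 / 36 : ℝ) ^ 2 ≤ (1 - z s) ^ 2 := by gcongr; linarith
    have hna : 0 < n s * a s := mul_pos (by linarith) hap
    have h2 : n s * a s * (35 / 36 : ℝ) ^ 2 ≤ n s * a s * (1 - z s) ^ 2 := by gcongr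
    have h3 : 6 * z s * (1 - z s) * a s ≤ 1 / 6 * a s := by
      have : 6 * z s * (1 - z s) ≤ 1 / 6 := by nlinarith
      gcongr
    have h4 : (a s + 1 / 3) * (a s + 4 / 3 - 2 * z s) ≤ 1 / 2 * (3 / 2) := by
      apply mul_le_mul <;> linarith
    have h5 : 8 * a s ≤ n s * a s := by gcongr
    unfold collapseField
    nlinarith
  -- If `n a` exceeded `1/3`, it would stay at least `1/3`, making `a' ≥ 1/4` and carrying `a` past
  -- `1/6`.
  have hsmall : ∀ s, s₁ ≤ s → n s * a s ≤ 1 / 3 := by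
    intro s hs
    by_contra hgt
    push Not at hgt
    have hs0 := hs₁.trans hs
    have hstay := barrier_ge (s₀ := s) (c := 1 / 3) (f := fun s => n s * a s)
      (f' := fun s => n s * (2 / 3 - 4 * a s) * a s + n s * collapseField (a s) (n s) (z s))
      (fun σ hσ => (h.deriv_n σ (hs0.trans hσ)).fun_mul (h.deriv_a σ (hs0.trans hσ))) hgt.le
      (fun σ hσ _ he => by
        have h1 := hfield σ (hs.trans hσ)
        have hnp := h.n_pos σ (hs0.trans hσ)
        have hap := h.a_pos σ (hs0.trans hσ)
        have h2 : 0 < 2 / 3 - 4 * a σ := by linarith [ha σ (hs0.trans hσ)]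
        have h3 : 0 < collapseField (a σ) (n σ) (z σ) := by linarith
        positivity)
    have htop := tendsto_atTop_of_le_hasDerivAt (s₀ := s) (by norm_num : (0 : ℝ) < 1 / 4)
      (fun σ hσ => h.deriv_a σ (hs0.trans hσ)) (fun σ hσ => by
        have h1 := hfield σ (hs.trans hσ)
        have h2 := hstay σ hσ
        linarith)
    obtain ⟨σ, h1, h2⟩ := ((htop.eventually_gt_atTop (1 / 6)).and (eventually_ge_atTop s)).exists
    linarith [ha σ (hs0.trans h2)]
  -- The rate at which `log z` decreases is at most `3a ≤ 1/n`, which is compensated by the growth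
  -- of `-2/n`. So `z` could not tend to zero.
  have hlog := monotoneOn_Ici_of_hasDerivAt_nonneg (s₀ := s₁)
    (f := fun s => Real.log (z s) - 2 * (n s)⁻¹)
    (f' := fun s => (-3 * a s * (z s * (1 - z s))) / z s -
      2 * (-(n s * (2 / 3 - 4 * a s)) / n s ^ 2))
    (fun s hs => ((h.deriv_z s (hs₁.trans hs)).log (h.z_pos s (hs₁.trans hs)).ne').fun_sub
      (((h.deriv_n s (hs₁.trans hs)).fun_inv (h.n_pos s (hs₁.trans hs)).ne').const_mul 2))
    (fun s hs => by
      have hs0 := hs₁.trans hs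
      have hz := h.z_pos s hs0
      have hn := hn8 s hs
      have hn0 := h.n_pos s hs0
      have hap := h.a_pos s hs0
      have hsm := hsmall s hs
      have h5 : 8 * a s ≤ n s * a s := by gcongr
      have : (-3 * a s * (z s * (1 - z s))) / z s -
          2 * (-(n s * (2 / 3 - 4 * a s)) / n s ^ 2) =
          (4 / 3 - 8 * a s - 3 * (n s * a s) * (1 - z s)) / n s := by
        field_simp
        ring
      rw [this]
      apply div_nonneg _ hn0.le
      have h6 : 0 < n s * a s * z s := by positivity
      nlinarith)
  have hlow : ∀ s, s₁ ≤ s → Real.exp (Real.log (z s₁) - 2 * (n s₁)⁻¹) ≤ z s := by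
    intro s hs
    rw [← Real.le_log_iff_exp_le (h.z_pos s (hs₁.trans hs))]
    have h1 := hlog Set.self_mem_Ici hs hs
    simp only at h1
    have : 0 < (n s)⁻¹ := inv_pos.2 (h.n_pos s (hs₁.trans hs))
    linarith
  have := ge_of_tendsto h.z_lim ((eventually_ge_atTop s₁).mono hlow)
  linarith [Real.exp_pos (Real.log (z s₁) - 2 * (n s₁)⁻¹)]

/-- Here `n` is monotone and bounded, and `n' = 4n(1/6 - a)` controls the distance of `a` from
`1/6`; Barbalat's lemma gives convergence. -/
theorem a_tendsto_of_le (h : IsCollapsing s₀ a n z) {N : ℝ} (ha : ∀ s, s₀ ≤ s → a s ≤ 1 / 6)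
    (hN : ∀ s, s₀ ≤ s → n s ≤ N) : Tendsto a atTop (𝓝 (1 / 6)) := by
  have hmono := monotoneOn_Ici_of_hasDerivAt_nonneg h.deriv_n (fun s hs =>
    mul_nonneg (h.n_pos s hs).le (by linarith [ha s hs]))
  obtain ⟨L, hL, -⟩ := exists_tendsto_of_monotoneOn_Ici hmono hN
  have key : Tendsto (fun s => a s - 1 / 6) atTop (𝓝 0) := by
    refine tendsto_zero_of_convergent_of_lipschitz h.deriv_n hL
      (fun s hs => (h.deriv_a s hs).sub_const (1 / 6)) (h.deriv_a_bound ha hN) (fun ε hε => ?_)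
    refine ⟨n s₀ * (4 * ε), by have := h.n_pos s₀ le_rfl; positivity, ?_⟩
    filter_upwards [eventually_ge_atTop s₀] with s hs hk
    rw [abs_of_nonpos (by linarith [ha s hs])] at hk
    exact mul_le_mul (hmono Set.self_mem_Ici hs hs) (by linarith) (by positivity)
      (h.n_pos s hs).le
  exact tendsto_sub_nhds_zero_iff.1 key

/-- Now `n` decreases, yet cannot fall below `1/3` since it would stay there. The bound on `a` comes
from the damping `-a²`, which beats `(9/2)n a` once `a ≥ 5 n s₀`. -/
theorem a_tendsto_of_ge (h : IsCollapsing s₀ a n z) (ha : ∀ s, s₀ ≤ s → 1 / 6 ≤ a s) :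
    Tendsto a atTop (𝓝 (1 / 6)) ∧ ∃ A N, ∀ s, s₀ ≤ s → a s ≤ A ∧ n s ≤ N := by
  have hanti := antitoneOn_Ici_of_hasDerivAt_nonpos h.deriv_n (fun s hs =>
    mul_nonpos_of_nonneg_of_nonpos (h.n_pos s hs).le (by linarith [ha s hs]))
  have hN : ∀ s, s₀ ≤ s → n s ≤ n s₀ := fun s hs => hanti Set.self_mem_Ici hs hs
  have hlow : ∀ s, s₀ ≤ s → 1 / 3 ≤ n s := by
    intro s hs
    by_contra hlt
    push Not at hlt
    exact (h.mono hs).not_forall_n_le fun σ hσ => (hanti hs (hs.trans hσ) hσ).trans hlt.le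
  have hn0 := h.n_pos s₀ le_rfl
  have hA : ∀ s, s₀ ≤ s → a s ≤ max (a s₀) (5 * n s₀) := by
    refine barrier_le h.deriv_a (le_max_left _ _) fun s hs _ he => ?_
    have hge : 5 * n s₀ ≤ a s := he ▸ le_max_right _ _
    have hap := h.a_pos s hs
    have hz := h.z_pos s hs
    have hz' := h.z_le s hs
    have h1 : (1 - z s) ^ 2 ≤ 1 := pow_le_one₀ (by linarith) (by linarith)
    have h2 : 9 / 2 * n s * (1 - z s) ^ 2 * a s ≤ 9 / 2 * n s₀ * 1 * a s := by
      have := h.n_pos s hs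
      have := hN s hs
      gcongr
    have h3 : 0 ≤ 6 * z s * (1 - z s) * a s := by
      have : 0 ≤ 1 - z s := by linarith
      positivity
    have h4 : a s * a s ≤ (a s + 1 / 3) * (a s + 4 / 3 - 2 * z s) := by
      apply mul_le_mul <;> linarith
    have h5 : 5 * n s₀ * a s ≤ a s * a s := by gcongr
    have h6 : 0 < n s₀ * a s := by positivity
    unfold collapseField
    nlinarith
  obtain ⟨L, hL, -⟩ := exists_tendsto_of_antitoneOn_Ici hanti hlow
  refine ⟨?_, _, _, fun s hs => ⟨hA s hs, hN s hs⟩⟩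
  have key : Tendsto (fun s => a s - 1 / 6) atTop (𝓝 0) := by
    refine tendsto_zero_of_convergent_of_lipschitz (fun s hs => (h.deriv_n s hs).neg) hL.neg
      (fun s hs => (h.deriv_a s hs).sub_const (1 / 6)) (h.deriv_a_bound hA hN) (fun ε hε => ?_)
    refine ⟨1 / 3 * (4 * ε), by positivity, ?_⟩
    filter_upwards [eventually_ge_atTop s₀] with s hs hk
    rw [abs_of_nonneg (by linarith [ha s hs])] at hk
    rw [← mul_neg]
    exact mul_le_mul (hlow s hs) (by linarith) (by positivity) (h.n_pos s hs).le
  exact tendsto_sub_nhds_zero_iff.1 key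

/-- The collapsing system converges to its equilibrium `a = 1/6`, `n = 1`. -/
theorem tendsto_equilibrium (h : IsCollapsing s₀ a n z) :
    Tendsto a atTop (𝓝 (1 / 6)) ∧ Tendsto n atTop (𝓝 1) := by
  obtain ⟨C, hC0, hC⟩ := exists_energy_deriv_ge
  obtain ⟨s₁, hs₁0, hs₁⟩ : ∃ s₁, s₀ ≤ s₁ ∧ ∀ s, s₁ ≤ s → C * z s ≤ 1 := by
    have h1 : Tendsto (fun s => C * z s) atTop (𝓝 0) := by simpa using h.z_lim.const_mul C
    obtain ⟨N, hN⟩ := eventually_atTop.1 (h1.eventually (gt_mem_nhds zero_lt_one))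
    exact ⟨max s₀ N, le_max_left _ _, fun s hs => (hN s ((le_max_right _ _).trans hs)).le⟩
  have h := h.mono hs₁0
  clear hs₁0
  have hderiv : ∀ s, s₁ ≤ s → collapseEnergy (a s) (n s) ≤ 4 → (a s - 1 / 6) ^ 2 / 2 + z s ≤
      9 / 2 * ((1 - (n s)⁻¹) * (n s * (2 / 3 - 4 * a s))) +
        2 / 3 * ((1 - (6 * a s)⁻¹) * (6 * collapseField (a s) (n s) (z s))) -
        C * (-3 * a s * (z s * (1 - z s))) := fun s hs hH =>
    hC _ _ _ (h.a_pos s hs) (h.n_pos s hs) (h.z_pos s hs) (h.z_le s hs) hH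
  -- The margin `C z ≤ 1` keeps the energy at most `4` where the corrected energy equals `3`, so
  -- this level can only be crossed upwards. Above it, the sign of `a - 1/6` eventually settles and
  -- convergence to the equilibrium, where the energy vanishes, gives a contradiction. Below it, the
  -- corrected energy is monotone and bounded.
  by_cases hcase : ∃ s₂, s₁ ≤ s₂ ∧ 3 ≤ collapseEnergy (a s₂) (n s₂) - C * z s₂
  · exfalso
    obtain ⟨s₂, hs₂, h3⟩ := hcase
    have hstay := barrier_ge (s₀ := s₂) (c := 3)
      (fun s hs => h.deriv_energy C (hs₂.trans hs)) h3 (fun s hs _ he => by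
        have h1 := hderiv s (hs₂.trans hs) (by linarith [hs₁ s (hs₂.trans hs)])
        have h2 := h.z_pos s (hs₂.trans hs)
        have h4 := sq_nonneg (a s - 1 / 6)
        linarith)
    have h := h.mono hs₂
    have hH : ∀ s, s₂ ≤ s → 3 ≤ collapseEnergy (a s) (n s) := fun s hs => by
      have h1 := hstay s hs
      have : 0 ≤ C * z s := mul_nonneg hC0 (h.z_pos s hs).le
      linarith
    have contra : Tendsto a atTop (𝓝 (1 / 6)) → Tendsto n atTop (𝓝 1) → False := by
      intro ha hn
      have := ge_of_tendsto (energy_tendsto_zero ha hn) ((eventually_ge_atTop s₂).mono hH)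
      linarith
    by_cases hup : ∃ s₃, s₂ ≤ s₃ ∧ 1 / 6 ≤ a s₃
    · obtain ⟨s₃, hs₃, ha₃⟩ := hup
      -- At `a = 1/6` the energy lies entirely in `n`, so `logGap n ≥ 2/3`. With `n ≥ 1/4` this
      -- means `n ≥ 5/3`, where the field points to larger `a`.
      have hge := barrier_ge (s₀ := s₃) (fun s hs => h.deriv_a s (hs₃.trans hs)) ha₃
        (fun s hs _ he => by
          have hs2 := hs₃.trans hs
          have h1 := hH s hs2
          unfold collapseEnergy at h1
          rw [he, show (6 : ℝ) * (1 / 6) = 1 by norm_num, logGap_one] at h1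
          have h2 := le_of_le_logGap (h.n_ge hs2 he.le) (by linarith)
          have hz := h.z_pos s hs2
          have hz' := h.z_le s hs2
          have h3 : (35 / 36 : ℝ) ^ 2 ≤ (1 - z s) ^ 2 := by gcongr; linarith
          have h4 : 5 / 3 * (35 / 36 : ℝ) ^ 2 ≤ n s * (1 - z s) ^ 2 := by gcongr
          unfold collapseField
          rw [he]
          nlinarith)
      obtain ⟨ha, A, N, hAN⟩ := (h.mono hs₃).a_tendsto_of_ge hge
      exact contra ha ((h.mono hs₃).n_tendsto_one (fun s hs => (hAN s hs).1)
        (fun s hs => (hAN s hs).2) ha)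
    · push Not at hup
      obtain ⟨N, hN⟩ := h.exists_n_bound hup
      have ha := h.a_tendsto_of_le (fun s hs => (hup s hs).le) hN
      exact contra ha (h.n_tendsto_one (fun s hs => (hup s hs).le) hN ha)
  · push Not at hcase
    have hH : ∀ s, s₁ ≤ s → collapseEnergy (a s) (n s) ≤ 4 := fun s hs => by
      linarith [hcase s hs, hs₁ s hs]
    have hb : ∀ s, s₁ ≤ s → n s ≤ 4 ∧ a s ≤ 7 / 3 := fun s hs =>
      have := collapseEnergy_bounds (h.a_pos s hs) (h.n_pos s hs) (hH s hs)
      ⟨this.1, this.2.1⟩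
    have hmono := monotoneOn_Ici_of_hasDerivAt_nonneg (fun s hs => h.deriv_energy C hs)
      (fun s hs => by
        have h1 := hderiv s hs (hH s hs)
        have h2 := h.z_pos s hs
        have h4 := sq_nonneg (a s - 1 / 6)
        linarith)
    obtain ⟨L, hL, -⟩ := exists_tendsto_of_monotoneOn_Ici hmono (fun s hs => (hcase s hs).le)
    have key : Tendsto (fun s => a s - 1 / 6) atTop (𝓝 0) := by
      refine tendsto_zero_of_convergent_of_lipschitz (fun s hs => h.deriv_energy C hs) hL
        (fun s hs => (h.deriv_a s hs).sub_const (1 / 6))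
        (h.deriv_a_bound (fun s hs => (hb s hs).2) (fun s hs => (hb s hs).1)) (fun ε hε => ?_)
      refine ⟨ε ^ 2 / 2, by positivity, ?_⟩
      filter_upwards [eventually_ge_atTop s₁] with s hs hk
      have h1 := hderiv s hs (hH s hs)
      have h2 := h.z_pos s hs
      have h3 : ε ^ 2 ≤ (a s - 1 / 6) ^ 2 := by
        rw [← sq_abs (a s - 1 / 6)]; gcongr
      linarith
    have ha : Tendsto a atTop (𝓝 (1 / 6)) := tendsto_sub_nhds_zero_iff.1 key
    exact ⟨ha, h.n_tendsto_one (fun s hs => (hb s hs).2) (fun s hs => (hb s hs).1) ha⟩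

end IsCollapsing

namespace IsLogSoliton

variable {lam s₀ : ℝ} {x P t : ℝ → ℝ}

/-! ### Shrinkers -/

theorem ratioRate_eq (h : IsLogSoliton lam s₀ x P t) {s : ℝ} (hs : s₀ ≤ s) :
    ratioRate lam x P s = 4 - 6 * warp x s -
      2 * lam * (warp x s - (1 - P s / 2 * Real.exp (-s))) / (x s * Real.exp (-s)) := by
  have := (h.x_pos s hs).ne'
  rw [ratioRate, Real.exp_neg]
  field_simp

/-- `W = (x + λP/3)e⁻ˢ` is nonincreasing and bounded below, hence convergent, and its derivative is
`-2(1-z)xe⁻ˢ`. If `xe⁻ˢ` is not small at a late time, `x³` dwarfs `eˢ` and `1 - z ≥ 1/2`. Barbalat's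
lemma then gives `xe⁻ˢ → 0`, so `θ` inherits its limit from `W`. -/
theorem exists_theta_limit (h : IsLogSoliton lam s₀ x P t) (hlam : lam ≠ 0) :
    Tendsto (fun s => x s * Real.exp (-s)) atTop (𝓝 0) ∧
      ∃ l, 0 ≤ l ∧ l ≤ 1 ∧ Tendsto (fun s => 1 - P s / 2 * Real.exp (-s)) atTop (𝓝 l) := by
  obtain ⟨B, hB0, hB⟩ := h.theta_bounds
  have hexp0 : Tendsto (fun s : ℝ => B * Real.exp (-s)) atTop (𝓝 0) := by
    simpa using Real.tendsto_exp_neg_atTop_nhds_zero.const_mul B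
  set D := B * Real.exp (-s₀) with hD
  have hD0 : 0 ≤ D := by positivity
  have hBD : ∀ s, s₀ ≤ s → B * Real.exp (-s) ≤ D := fun s hs => by rw [hD]; gcongr
  set W : ℝ → ℝ := fun s => (x s + lam / 3 * P s) * Real.exp (-s) with hW
  set y : ℝ → ℝ := fun s => x s * Real.exp (-s) with hy
  have hy0 : ∀ s, s₀ ≤ s → 0 < y s := fun s hs => mul_pos (h.x_pos s hs) (Real.exp_pos _)
  have hPb : ∀ s, s₀ ≤ s → |lam / 3 * (P s * Real.exp (-s))| ≤ |lam / 3| * (2 * (1 + D)) := by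
    intro s hs
    rw [abs_mul]
    gcongr
    have h1 := hB s hs
    have h2 := hBD s hs
    rw [abs_le]
    constructor <;> linarith [h1.1, h1.2]
  have hWy : ∀ s, W s = y s + lam / 3 * (P s * Real.exp (-s)) := fun s => by
    simp only [hW, hy]; ring
  have hanti : AntitoneOn W (Set.Ici s₀) :=
    antitoneOn_Ici_of_hasDerivAt_nonpos (fun s hs => h.deriv_w_div hs) (fun s hs => by
      have hx := h.x_pos s hs
      have : 0 < 1 - warp x s := by linarith [warp_lt_one hx]
      have : 0 ≤ 2 * (1 - warp x s) * (x s * Real.exp (-s)) := by positivity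
      linarith)
  set K := |lam / 3| * (2 * (1 + D)) with hK
  have hWlow : ∀ s, s₀ ≤ s → -K ≤ W s := fun s hs => by
    rw [hWy]; linarith [hy0 s hs, (abs_le.1 (hPb s hs)).1]
  obtain ⟨L, hL, -⟩ := exists_tendsto_of_antitoneOn_Ici hanti hWlow
  have hWabs : ∀ s, s₀ ≤ s → |W s| ≤ |W s₀| + K := fun s hs => by
    have h1 := hanti Set.self_mem_Ici hs hs
    have h2 := hWlow s hs
    have h3 := le_abs_self (W s₀)
    have h4 := abs_nonneg (W s₀)
    have h5 : 0 ≤ K := (abs_nonneg _).trans (hPb s hs)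
    exact abs_le.2 ⟨by linarith, by linarith⟩
  have hyle : ∀ s, s₀ ≤ s → y s ≤ |W s₀| + 2 * K := fun s hs => by
    have h1 := hWy s
    have h2 := (abs_le.1 (hPb s hs)).1
    have h3 := (abs_le.1 (hWabs s hs)).2
    linarith
  have hyd : ∀ s, s₀ ≤ s → HasDerivAt y
      (W s - 2 * (1 - warp x s) * y s - lam / 3 * (2 * (1 - warp x s)) - y s) s := by
    intro s hs
    have h1 : HasDerivAt (fun s : ℝ => Real.exp (-s)) (-Real.exp (-s)) s := by
      simpa using (hasDerivAt_id s).neg.exp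
    refine ((h.deriv_x s hs).fun_mul h1).congr_deriv ?_
    rw [warp_mul_cube (h.x_pos s hs)]
    have hE : Real.exp s * Real.exp (-s) = 1 := by rw [← Real.exp_add]; simp
    simp only [hW, hy]
    linear_combination (-(lam / 3) * 2 * (1 - warp x s)) * hE
  have hylim : Tendsto y atTop (𝓝 0) := by
    refine tendsto_zero_of_convergent_of_lipschitz (fun s hs => (h.deriv_w_div hs).neg) hL.neg
      hyd (C := (|W s₀| + K) + 3 * (|W s₀| + 2 * K) + |lam / 3| * 2) (fun s hs => ?_)
      (fun e he => ?_)
    · have hx := h.x_pos s hs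
      have hw := warp_pos hx
      have hw1 := warp_lt_one hx
      have h1 := abs_le.1 (hWabs s hs)
      have h2 := hyle s hs
      have h3 := hy0 s hs
      have h4 : |lam / 3 * (2 * (1 - warp x s))| ≤ |lam / 3| * 2 := by
        rw [abs_mul]
        gcongr
        rw [abs_le]; constructor <;> linarith
      have h5 := abs_le.1 h4
      have h6 : 2 * (1 - warp x s) * y s ≤ 2 * y s := by nlinarith
      have h7 : 0 ≤ 2 * (1 - warp x s) * y s := by
        have : 0 < 1 - warp x s := by linarith
        positivity
      rw [abs_le]
      constructor <;> linarith [h1.1, h1.2, h5.1, h5.2]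
    · refine ⟨e, he, ?_⟩
      filter_upwards [eventually_ge_atTop s₀,
        Real.tendsto_exp_atTop.eventually_ge_atTop (2 / e ^ 3 + 1)] with s hs hv hk
      have hx := h.x_pos s hs
      rw [abs_of_pos (hy0 s hs)] at hk
      have hv1 : 1 ≤ Real.exp s := by have : 0 < 2 / e ^ 3 := by positivity
                                      linarith
      have hxe : e * Real.exp s ≤ x s := by
        have := mul_le_mul_of_nonneg_right hk (Real.exp_pos s).le
        simp only [hy] at this
        rwa [mul_assoc, ← Real.exp_add, neg_add_cancel, Real.exp_zero, mul_one] at this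
      have hcube : 2 * Real.exp s ≤ x s ^ 3 := by
        calc 2 * Real.exp s = e ^ 3 * (2 / e ^ 3) * Real.exp s := by field_simp
          _ ≤ e ^ 3 * Real.exp s * Real.exp s := by gcongr; linarith
          _ ≤ e ^ 3 * Real.exp s * Real.exp s * Real.exp s :=
            le_mul_of_one_le_right (by positivity) hv1
          _ = (e * Real.exp s) ^ 3 := by ring
          _ ≤ x s ^ 3 := by gcongr
      have hζ : 1 / 2 ≤ 1 - warp x s := by
        rw [one_sub_warp hx, le_div_iff₀ (by positivity)]
        linarith
      rw [neg_neg]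
      change e ≤ 2 * (1 - warp x s) * y s
      nlinarith [hy0 s hs]
  refine ⟨hylim, 1 - 3 / (2 * lam) * L, ?_⟩
  have hθ : Tendsto (fun s => 1 - P s / 2 * Real.exp (-s)) atTop (𝓝 (1 - 3 / (2 * lam) * L)) := by
    have h1 := ((hL.sub hylim).const_mul (3 / (2 * lam))).const_sub 1
    rw [sub_zero] at h1
    refine h1.congr fun s => ?_
    rw [hWy]
    field_simp
    ring
  refine ⟨?_, ?_, hθ⟩
  · refine le_of_tendsto_of_tendsto (by simpa using hexp0.neg) hθ ?_
    filter_upwards [eventually_ge_atTop s₀] with s hs using (hB s hs).1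
  · refine le_of_tendsto_of_tendsto hθ (by simpa using hexp0.const_add 1) ?_
    filter_upwards [eventually_ge_atTop s₀] with s hs using (hB s hs).2

/-- On a shrinker end, `warp` has the same limit as its average. -/
theorem warp_tendsto (h : IsLogSoliton lam s₀ x P t) (hlam : lam < 0) {l : ℝ}
    (hy : Tendsto (fun s => x s * Real.exp (-s)) atTop (𝓝 0))
    (hθ : Tendsto (fun s => 1 - P s / 2 * Real.exp (-s)) atTop (𝓝 l)) :
    Tendsto (warp x) atTop (𝓝 l) := by
  set μ := -lam with hμ
  have hμ0 : 0 < μ := by linarith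
  have hlamμ : lam = -μ := by rw [hμ]; ring
  set y : ℝ → ℝ := fun s => x s * Real.exp (-s) with hydef
  have hxy : ∀ s, x s = y s * Real.exp s := fun s => by
    simp only [hydef]; rw [mul_assoc, ← Real.exp_add]; simp
  have hR := fun s (hs : s₀ ≤ s) => h.ratioRate_eq hs
  have late : ∀ ε > 0, ∃ s₁, s₀ ≤ s₁ ∧ ∀ s, s₁ ≤ s → l - ε / 2 ≤ 1 - P s / 2 * Real.exp (-s) ∧
      1 - P s / 2 * Real.exp (-s) ≤ l + ε / 2 ∧ 0 < y s ∧ 6 * y s ≤ μ * ε := by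
    intro ε hε
    have h1 := hθ.eventually (lt_mem_nhds (show l - ε / 2 < l by linarith))
    have h2 := hθ.eventually (gt_mem_nhds (show l < l + ε / 2 by linarith))
    have h3 := hy.eventually (gt_mem_nhds (show 0 < μ * ε / 6 by positivity))
    obtain ⟨N, hN⟩ := eventually_atTop.1 (h1.and (h2.and h3))
    refine ⟨max s₀ N, le_max_left _ _, fun s hs => ?_⟩
    have h4 := hN s ((le_max_right _ _).trans hs)
    exact ⟨h4.1.le, h4.2.1.le, mul_pos (h.x_pos s ((le_max_left _ _).trans hs)) (Real.exp_pos _),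
      by linarith [h4.2.2]⟩
  rw [Metric.tendsto_nhds]
  intro ε hε
  obtain ⟨s₁, hs₁, hl⟩ := late ε hε
  -- A deviation of `ε` from `l` is at least `ε/2` from `θ`, and the factor `1/(xe⁻ˢ) → ∞` makes the
  -- repulsion dominate `4 - 6z`. The deviation therefore persists.
  have rate_ge : ∀ s, s₁ ≤ s → l + ε ≤ warp x s →
      -2 + μ * ε / y s ≤ ratioRate lam x P s := by
    intro s hs hz
    obtain ⟨h1, h2, h3, h4⟩ := hl s hs
    have hw := warp_lt_one (h.x_pos s (hs₁.trans hs))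
    rw [hR s (hs₁.trans hs), hlamμ]
    have : μ * ε / y s ≤ 2 * μ * (warp x s - (1 - P s / 2 * Real.exp (-s))) / y s := by
      gcongr ?_ / _
      nlinarith
    have e : 2 * -μ * (warp x s - (1 - P s / 2 * Real.exp (-s))) / (x s * Real.exp (-s)) =
      -(2 * μ * (warp x s - (1 - P s / 2 * Real.exp (-s))) / y s) := by
      simp only [hydef]; ring
    rw [e]
    linarith
  have rate_le : ∀ s, s₁ ≤ s → warp x s ≤ l - ε →
      ratioRate lam x P s ≤ 4 - μ * ε / y s := by
    intro s hs hz
    obtain ⟨h1, h2, h3, h4⟩ := hl s hs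
    have hw := warp_pos (h.x_pos s (hs₁.trans hs))
    rw [hR s (hs₁.trans hs), hlamμ]
    have : μ * ε / y s ≤ 2 * μ * ((1 - P s / 2 * Real.exp (-s)) - warp x s) / y s := by
      gcongr ?_ / _
      nlinarith
    have e : 2 * -μ * (warp x s - (1 - P s / 2 * Real.exp (-s))) / (x s * Real.exp (-s)) =
      (2 * μ * ((1 - P s / 2 * Real.exp (-s)) - warp x s) / y s) := by
      simp only [hydef]; ring
    rw [e]
    linarith
  have six : ∀ s, s₁ ≤ s → 6 ≤ μ * ε / y s := fun s hs => by
    obtain ⟨h1, h2, h3, h4⟩ := hl s hs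
    rwa [le_div_iff₀ h3]
  filter_upwards [eventually_ge_atTop s₁] with s hs
  rw [Real.dist_eq, abs_lt]
  constructor
  · by_contra hcon
    push Not at hcon
    have hstay := barrier_le (s₀ := s) (c := l - ε)
      (fun σ hσ => h.deriv_warp (hs₁.trans (hs.trans hσ))) (by linarith) (fun σ hσ _ he => by
        have hx := h.x_pos σ (hs₁.trans (hs.trans hσ))
        have h1 := rate_le σ (hs.trans hσ) he.le
        have h2 := six σ (hs.trans hσ)
        have h3 := warp_pos hx
        have h4 : 0 < 1 - warp x σ := by linarith [warp_lt_one hx]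
        exact mul_neg_of_pos_of_neg (by positivity) (by linarith))
    -- If `z` stays below, `x` grows at least like a multiple of `e^σ`, against `xe^{-σ} → 0`.
    have hmono := monotoneOn_Ici_of_hasDerivAt_nonneg (s₀ := s)
      (f := fun σ => x σ - μ * ε / 6 * Real.exp σ)
      (f' := fun σ => x σ * (1 - ratioRate lam x P σ) / 3 - μ * ε / 6 * Real.exp σ)
      (fun σ hσ => (h.deriv_x' (hs₁.trans (hs.trans hσ))).fun_sub
        ((Real.hasDerivAt_exp σ).const_mul _))
      (fun σ hσ => by
        have hx := h.x_pos σ (hs₁.trans (hs.trans hσ))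
        have h1 := rate_le σ (hs.trans hσ) (hstay σ hσ)
        obtain ⟨-, -, h3, h4⟩ := hl σ (hs.trans hσ)
        have h2 : x σ * (μ * ε / y σ - 3) ≤ x σ * (1 - ratioRate lam x P σ) :=
          mul_le_mul_of_nonneg_left (by linarith) hx.le
        have h5 : x σ * (μ * ε / y σ - 3) = (μ * ε - 3 * y σ) * Real.exp σ := by
          rw [hxy]; field_simp
        have h6 : μ * ε / 2 * Real.exp σ ≤ (μ * ε - 3 * y σ) * Real.exp σ := by
          gcongr; linarith
        linarith)
    have hlim : Tendsto (fun σ => y σ - μ * ε / 6 -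
        (x s - μ * ε / 6 * Real.exp s) * Real.exp (-σ)) atTop (𝓝 (-(μ * ε / 6))) := by
      have := (hy.sub_const (μ * ε / 6)).sub
        (Real.tendsto_exp_neg_atTop_nhds_zero.const_mul (x s - μ * ε / 6 * Real.exp s))
      simpa using this
    have : 0 ≤ -(μ * ε / 6) := by
      refine ge_of_tendsto hlim ?_
      filter_upwards [eventually_ge_atTop s] with σ hσ
      have h1 := hmono Set.self_mem_Ici hσ hσ
      simp only at h1
      have h2 := mul_le_mul_of_nonneg_right h1 (Real.exp_pos (-σ)).le
      have hE : Real.exp σ * Real.exp (-σ) = 1 := by rw [← Real.exp_add]; simp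
      have h3 : (x σ - μ * ε / 6 * Real.exp σ) * Real.exp (-σ) = y σ - μ * ε / 6 := by
        simp only [hydef]
        linear_combination (-(μ * ε / 6)) * hE
      rw [h3] at h2
      linarith
    have : 0 < μ * ε := by positivity
    linarith
  · by_contra hcon
    push Not at hcon
    have hstay := barrier_ge (s₀ := s) (c := l + ε)
      (fun σ hσ => h.deriv_warp (hs₁.trans (hs.trans hσ))) (by linarith) (fun σ hσ _ he => by
        have hx := h.x_pos σ (hs₁.trans (hs.trans hσ))
        have h1 := rate_ge σ (hs.trans hσ) he.ge
        have h2 := six σ (hs.trans hσ)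
        have h3 := warp_pos hx
        have h4 : 0 < 1 - warp x σ := by linarith [warp_lt_one hx]
        exact mul_pos (by positivity) (by linarith))
    -- If `z` stays above, `x` decreases at a definite rate and would become negative.
    have htop := tendsto_atTop_of_le_hasDerivAt (s₀ := s) (f := fun σ => -x σ)
      (c := μ * ε / 6 * Real.exp s) (by positivity)
      (fun σ hσ => (h.deriv_x' (hs₁.trans (hs.trans hσ))).neg)
      (fun σ hσ => by
        have hx := h.x_pos σ (hs₁.trans (hs.trans hσ))
        have h1 := rate_ge σ (hs.trans hσ) (hstay σ hσ)
        obtain ⟨-, -, h3, h4⟩ := hl σ (hs.trans hσ)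
        have h2 : x σ * (1 - ratioRate lam x P σ) ≤ x σ * (3 - μ * ε / y σ) :=
          mul_le_mul_of_nonneg_left (by linarith) hx.le
        have h5 : x σ * (3 - μ * ε / y σ) = -((μ * ε - 3 * y σ) * Real.exp σ) := by
          rw [hxy]; field_simp; ring
        have h6 : μ * ε / 2 * Real.exp s ≤ (μ * ε - 3 * y σ) * Real.exp σ := by
          have : 0 < μ * ε := by positivity
          apply mul_le_mul _ (Real.exp_le_exp.2 hσ) (Real.exp_pos _).le <;> linarith
        linarith)
    obtain ⟨σ, h1, h2⟩ := ((htop.eventually_gt_atTop 0).and (eventually_ge_atTop s)).exists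
    linarith [h.x_pos σ (hs₁.trans (hs.trans h2))]

/-- The limit `1` makes `we⁻ˢ` decrease to zero, so `w = x + λP/3 ≥ 0`. Then the cubic term,
positive for a shrinker, dominates: `x' ≥ c x³`, and `x` blows up at a finite `s`. -/
theorem not_warp_tendsto_one (h : IsLogSoliton lam s₀ x P t) (hlam : lam < 0)
    (hy : Tendsto (fun s => x s * Real.exp (-s)) atTop (𝓝 0))
    (hθ : Tendsto (fun s => 1 - P s / 2 * Real.exp (-s)) atTop (𝓝 1)) : False := by
  have hz := h.warp_tendsto hlam hy hθ
  set μ := -lam with hμ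
  have hμ0 : 0 < μ := by linarith
  have hlamμ : lam = -μ := by rw [hμ]; ring
  have hW : Tendsto (fun s => (x s + lam / 3 * P s) * Real.exp (-s)) atTop (𝓝 0) := by
    have := hy.add ((hθ.const_sub 1).const_mul (2 * lam / 3))
    norm_num at this
    refine this.congr fun s => by ring
  have hanti := antitoneOn_Ici_of_hasDerivAt_nonpos (fun s hs => h.deriv_w_div hs)
    (fun s hs => by
      have hx := h.x_pos s hs
      have : 0 < 1 - warp x s := by linarith [warp_lt_one hx]
      have : 0 ≤ 2 * (1 - warp x s) * (x s * Real.exp (-s)) := by positivity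
      linarith)
  have hw : ∀ s, s₀ ≤ s → 0 ≤ x s + lam / 3 * P s := by
    intro s hs
    have : 0 ≤ (x s + lam / 3 * P s) * Real.exp (-s) := by
      refine le_of_tendsto hW ?_
      filter_upwards [eventually_ge_atTop s] with σ hσ
      exact hanti hs (hs.trans hσ) hσ
    exact nonneg_of_mul_nonneg_left this (Real.exp_pos _)
  obtain ⟨N, hN⟩ := eventually_atTop.1 ((hz.eventually
    (lt_mem_nhds (show (1 / 2 : ℝ) < 1 by norm_num))).and
    (hy.eventually (gt_mem_nhds (show 0 < μ / 12 by positivity))))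
  set s₁ := max s₀ N
  have h01 : s₀ ≤ s₁ := le_max_left _ _
  have htop := tendsto_atTop_of_le_hasDerivAt (s₀ := s₁) (f := fun s => -(x s ^ 2)⁻¹)
    (c := μ / 6) (by positivity)
    (fun s hs => (((h.deriv_x s (h01.trans hs)).fun_pow 2).fun_inv
      (pow_pos (h.x_pos s (h01.trans hs)) 2).ne').neg)
    (fun s hs => by
      have hs0 := h01.trans hs
      have hx := h.x_pos s hs0
      obtain ⟨h1, h2⟩ := hN s ((le_max_right _ _).trans hs)
      have h3 := hw s hs0
      have h4 : 2 * (1 - warp x s) * x s ≤ x s ^ 3 * (x s * Real.exp (-s)) := by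
        have h5 := one_sub_warp_le hx
        have h6 : 2 * (1 - warp x s) * x s ≤ 2 * (x s ^ 3 / (2 * Real.exp s)) * x s := by gcongr
        refine h6.trans (le_of_eq ?_)
        rw [Real.exp_neg]; field_simp
      have h5 : x s ^ 3 * (x s * Real.exp (-s)) ≤ x s ^ 3 * (μ / 12) := by gcongr
      have h6 : μ / 3 * (1 / 2 * x s ^ 3) ≤ μ / 3 * (warp x s * x s ^ 3) := by gcongr
      have h7 : μ / 12 * x s ^ 3 ≤ x s - 2 * (1 - warp x s) * x s +
          lam / 3 * (P s - warp x s * x s ^ 3) := by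
        rw [hlamμ] at h3 ⊢
        linarith
      rw [← neg_div, neg_neg, le_div_iff₀ (by positivity)]
      push_cast
      have h8 : 2 * x s * (μ / 12 * x s ^ 3) ≤ 2 * x s * (x s - 2 * (1 - warp x s) * x s +
          lam / 3 * (P s - warp x s * x s ^ 3)) := by gcongr
      simp only [pow_one]
      nlinarith)
  obtain ⟨s, h1, h2⟩ := ((htop.eventually_gt_atTop 0).and (eventually_ge_atTop s₁)).exists
  have : 0 < (x s ^ 2)⁻¹ := inv_pos.2 (pow_pos (h.x_pos s (h01.trans h2)) 2)
  linarith

theorem deriv_ratioRate (h : IsLogSoliton lam s₀ x P t) {s : ℝ} (hs : s₀ ≤ s) :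
    HasDerivAt (ratioRate lam x P)
      (-6 * (warp x s * (1 - warp x s) * ratioRate lam x P s) -
        2 * lam / x s * (warp x s * (1 - warp x s) * ratioRate lam x P s * Real.exp s) -
        (ratioRate lam x P s - 4 + 6 * warp x s) * (1 - ratioRate lam x P s) / 3) s := by
  have hx := (h.x_pos s hs).ne'
  have hw := h.deriv_warp hs
  have h1 : HasDerivAt (fun s => 2 * lam / x s)
      (-(2 * lam / x s) * (1 - ratioRate lam x P s) / 3) s := by
    refine ((hasDerivAt_const s (2 * lam)).fun_div (h.deriv_x' hs) hx).congr_deriv ?_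
    field_simp
    ring
  refine (((hw.const_mul 6).const_sub 4).fun_sub
    (h1.fun_mul ((hw.fun_mul (Real.hasDerivAt_exp s)).fun_sub (h.deriv_Q hs)))).congr_deriv ?_
  have e : ratioRate lam x P s - 4 + 6 * warp x s = -(2 * lam / x s *
      (warp x s * Real.exp s - (Real.exp s - P s / 2))) := by rw [ratioRate]; ring
  rw [e]
  ring

/-- Shrinker ends with `warp → 0` are governed by the collapsing planar system. -/
theorem exists_isCollapsing (h : IsLogSoliton lam s₀ x P t) (hlam : lam < 0)
    (hz : Tendsto (warp x) atTop (𝓝 0)) :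
    ∃ s₁, s₀ ≤ s₁ ∧ IsCollapsing s₁ (fun s => -ratioRate lam x P s / 3)
      (fun s => -(8 * lam / 9) * (Real.exp s ^ 2 / x s ^ 4)) (warp x) := by
  obtain ⟨N, hN⟩ := eventually_atTop.1 (hz.eventually
    (gt_mem_nhds (show (0 : ℝ) < 1 / 36 by norm_num)))
  set s₁ := max s₀ N
  have h01 : s₀ ≤ s₁ := le_max_left _ _
  set a : ℝ → ℝ := fun s => -ratioRate lam x P s / 3 with ha
  set n : ℝ → ℝ := fun s => -(8 * lam / 9) * (Real.exp s ^ 2 / x s ^ 4) with hn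
  have hda : ∀ s, s₁ ≤ s → HasDerivAt a (collapseField (a s) (n s) (warp x s)) s := by
    intro s hs
    have hx := h.x_pos s (h01.trans hs)
    refine ((h.deriv_ratioRate (h01.trans hs)).neg.div_const 3).congr_deriv ?_
    have e : 9 / 2 * n s * (1 - warp x s) = -(2 * lam) * warp x s * Real.exp s / x s := by
      have h1 := warp_mul_cube hx
      simp only [hn]
      field_simp
      linear_combination 4 * lam * h1
    have e2 : collapseField (a s) (n s) (warp x s) =
        -(2 * lam) * warp x s * Real.exp s / x s * (1 - warp x s) * a s -
        6 * warp x s * (1 - warp x s) * a s - (a s + 1 / 3) * (a s + 4 / 3 - 2 * warp x s) := by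
      rw [← e]; unfold collapseField; ring
    rw [e2]
    simp only [ha]
    generalize ratioRate lam x P s = R
    field_simp
    ring
  have hdz : ∀ s, s₁ ≤ s → HasDerivAt (warp x) (-3 * a s * (warp x s * (1 - warp x s))) s := by
    intro s hs
    refine (h.deriv_warp (h01.trans hs)).congr_deriv ?_
    simp only [ha]
    ring
  have hwz : ∀ s, s₁ ≤ s → warp x s ≤ 1 / 36 := fun s hs => (hN s ((le_max_right _ _).trans hs)).le
  refine ⟨s₁, h01, ?_, ?_, fun s hs => warp_pos (h.x_pos s (h01.trans hs)), hwz, hz, hda, ?_, hdz⟩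
  -- Once `a ≤ 0` it stays so, because the field at `a = 0` is negative. Then `z` is nondecreasing,
  -- incompatible with `z > 0` and `z → 0`.
  · intro s hs
    by_contra hcon
    push Not at hcon
    have hstay := barrier_le (s₀ := s) (fun σ hσ => hda σ (hs.trans hσ)) hcon
      (fun σ hσ _ he => by
        rw [he]; unfold collapseField
        have := hwz σ (hs.trans hσ)
        linarith)
    have hmono := monotoneOn_Ici_of_hasDerivAt_nonneg (s₀ := s)
      (fun σ hσ => hdz σ (hs.trans hσ)) (fun σ hσ => by
        have hx := h.x_pos σ (h01.trans (hs.trans hσ))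
        have h1 := hstay σ hσ
        have h2 : 0 ≤ warp x σ * (1 - warp x σ) :=
          mul_nonneg (warp_pos hx).le (by linarith [warp_lt_one hx])
        exact mul_nonneg (by linarith) h2)
    have : warp x s ≤ 0 := by
      refine ge_of_tendsto hz ?_
      filter_upwards [eventually_ge_atTop s] with σ hσ
      exact hmono Set.self_mem_Ici hσ hσ
    linarith [warp_pos (h.x_pos s (h01.trans hs))]
  · intro s hs
    have hx := h.x_pos s (h01.trans hs)
    have : 0 < -(8 * lam / 9) := by linarith
    simp only [hn]
    positivity
  · intro s hs
    have hx := h.x_pos s (h01.trans hs)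
    refine ((((Real.hasDerivAt_exp s).fun_pow 2).fun_div ((h.deriv_x' (h01.trans hs)).fun_pow 4)
      (by positivity)).const_mul (-(8 * lam / 9))).congr_deriv ?_
    simp only [hn, ha]
    field_simp
    push_cast
    ring

/-- At the equilibrium `(log x)' = a + 1/3 → 1/2` and `dt/ds = 2(1-z)eˢ/x² → 1/(2q)` with `q =
√(-λ/18)`; the rates in `t` are quotients of these. -/
theorem shrinker_asymptotics (h : IsLogSoliton lam s₀ x P t) (hlam : lam < 0)
    (hz : Tendsto (warp x) atTop (𝓝 0)) :
    Tendsto t atTop atTop ∧ Tendsto (fun s => Real.exp s / x s ^ 3) atTop (𝓝 0) ∧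
      Tendsto (fun s => Real.log (x s) / t s) atTop (𝓝 √(-lam / 18)) ∧
      Tendsto (fun s => Real.exp s ^ 2 / x s ^ 4) atTop (𝓝 (-9 / (8 * lam))) ∧
      Tendsto (fun s => s / t s) atTop (𝓝 (2 * √(-lam / 18))) := by
  obtain ⟨s₁, h01, hcol⟩ := h.exists_isCollapsing hlam hz
  obtain ⟨ha, hn⟩ := hcol.tendsto_equilibrium
  have hb : Tendsto (fun s => Real.exp s ^ 2 / x s ^ 4) atTop (𝓝 (-9 / (8 * lam))) := by
    have := hn.const_mul (-9 / (8 * lam))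
    rw [mul_one] at this
    refine this.congr fun s => ?_
    rw [← mul_assoc]
    have : -9 / (8 * lam) * -(8 * lam / 9) = 1 := by
      have := hlam.ne
      field_simp
    rw [this, one_mul]
  set q := √(-lam / 18) with hq
  have hq0 : 0 < q := Real.sqrt_pos.2 (by linarith)
  have hq2 : q ^ 2 = -lam / 18 := Real.sq_sqrt (by linarith)
  have hv : Tendsto (fun s => Real.exp s / x s ^ 2) atTop (𝓝 (1 / (4 * q))) := by
    have h1 := hb.sqrt
    have e : √(-9 / (8 * lam)) = 1 / (4 * q) := by
      rw [Real.sqrt_eq_iff_mul_self_eq_of_pos (by positivity)]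
      have : lam = -(18 * q ^ 2) := by rw [hq2]; ring
      rw [this]
      field_simp
      norm_num
    rw [e] at h1
    refine h1.congr' ?_
    filter_upwards [eventually_ge_atTop s₀] with s hs
    have hx := h.x_pos s hs
    rw [Real.sqrt_eq_iff_mul_self_eq_of_pos (by positivity)]
    field_simp
  have htd : Tendsto (fun s => warp x s * x s) atTop (𝓝 (1 / (2 * q))) := by
    have h1 := ((hz.const_sub 1).const_mul 2).mul hv
    have e : 2 * (1 - 0) * (1 / (4 * q)) = 1 / (2 * q) := by field_simp; norm_num
    rw [e] at h1
    refine h1.congr' ?_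
    filter_upwards [eventually_ge_atTop s₀] with s hs
    have hx := h.x_pos s hs
    have := warp_mul_cube hx
    field_simp
    linarith
  have htop : Tendsto t atTop atTop := by
    obtain ⟨N, hN⟩ := eventually_atTop.1 (htd.eventually
      (lt_mem_nhds (show 1 / (4 * q) < 1 / (2 * q) by
        rw [div_lt_div_iff₀ (by positivity) (by positivity)]; linarith)))
    exact tendsto_atTop_of_le_hasDerivAt (s₀ := max s₀ N) (c := 1 / (4 * q)) (by positivity)
      (fun s hs => h.deriv_t s ((le_max_left _ _).trans hs))
      (fun s hs => (hN s ((le_max_right _ _).trans hs)).le)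
  have htpos : ∀ s, s₀ ≤ s → 0 < warp x s * x s := fun s hs =>
    mul_pos (warp_pos (h.x_pos s hs)) (h.x_pos s hs)
  refine ⟨htop, ?_, ?_, hb, ?_⟩
  · have h1 := hz.div ((hz.const_sub 1).const_mul 2) (by norm_num)
    norm_num at h1
    refine h1.congr' ?_
    filter_upwards [eventually_ge_atTop s₀] with s hs
    have hx := h.x_pos s hs
    have hw : 0 < 1 - warp x s := by linarith [warp_lt_one hx]
    have := warp_mul_cube hx
    simp only [Pi.div_apply]
    field_simp
    linarith
  · refine tendsto_div_of_tendsto_deriv_div (f' := fun s => (1 - ratioRate lam x P s) / 3)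
      (fun s hs => ((h.deriv_x' hs).log (h.x_pos s hs).ne').congr_deriv (by
        have := (h.x_pos s hs).ne'
        field_simp)) h.deriv_t htpos htop ?_
    have h1 := (ha.add_const (1 / 3)).div htd (by positivity)
    have e : (1 / 6 + 1 / 3) / (1 / (2 * q)) = q := by field_simp; norm_num
    rw [e] at h1
    refine h1.congr fun s => ?_
    simp only [Pi.div_apply]
    ring
  · refine tendsto_div_of_tendsto_deriv_div (f := fun s => s) (f' := fun _ => 1)
      (fun s _ => hasDerivAt_id s) h.deriv_t htpos htop ?_
    have h1 := htd.inv₀ (by positivity)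
    rw [one_div, inv_inv] at h1
    simpa using h1

/-! ### The dichotomy for ends of infinite volume -/

/-- Bounds on `warp` translate into bounds for the ratio `y² / x²`. -/
theorem ratio_bounds {ε s : ℝ} (hx : 0 < x s) (hε : 0 < ε)
    (hz : ε ≤ warp x s ∧ warp x s ≤ 1 - ε) :
    ε / 2 ≤ Real.exp s / x s ^ 3 ∧ Real.exp s / x s ^ 3 ≤ 1 / (2 * ε) := by
  have h1 := warp_mul_cube hx
  have h2 := warp_pos hx
  have h3 := Real.exp_pos s
  have h4 : 0 < x s ^ 3 := by positivity
  rw [le_div_iff₀ h4, div_le_div_iff₀ h4 (by positivity)]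
  constructor
  · have : ε * x s ^ 3 ≤ warp x s * x s ^ 3 := by gcongr; exact hz.1
    nlinarith
  · have : ε * Real.exp s ≤ (1 - warp x s) * Real.exp s := by gcongr; linarith [hz.2]
    have : warp x s * x s ^ 3 ≤ 1 * x s ^ 3 := by gcongr; exact (warp_lt_one hx).le
    linarith

theorem dichotomy (h : IsLogSoliton lam s₀ x P t) (hlam : lam ≠ 0) :
    Tendsto t atTop atTop ∧
    ((∃ s₁ ε, s₀ ≤ s₁ ∧ 0 < ε ∧ (∀ s, s₁ ≤ s → ε ≤ warp x s ∧ warp x s ≤ 1 - ε)) ∨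
    (0 < lam ∧ Tendsto (fun s => Real.exp s / x s ^ 3) atTop atTop ∧
      Tendsto (fun s => t s * x s) atTop (𝓝 (3 / lam)) ∧
      Tendsto (fun s => s / t s ^ 2) atTop (𝓝 (lam / 6)) ∧
      Tendsto x atTop (𝓝 0)) ∨
    (lam < 0 ∧ Tendsto (fun s => Real.exp s / x s ^ 3) atTop (𝓝 0) ∧
      Tendsto (fun s => Real.log (x s) / t s) atTop (𝓝 √(-lam / 18)) ∧
      Tendsto (fun s => Real.exp s ^ 2 / x s ^ 4) atTop (𝓝 (-9 / (8 * lam))) ∧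
      Tendsto (fun s => s / t s) atTop (𝓝 (2 * √(-lam / 18))))) := by
  rcases lt_or_gt_of_ne hlam with hneg | hpos
  · obtain ⟨hy, l, hl0, hl1, hθ⟩ := h.exists_theta_limit hlam
    have hz := h.warp_tendsto hneg hy hθ
    rcases hl1.eq_or_lt with rfl | hl1
    · exact (h.not_warp_tendsto_one hneg hy hθ).elim
    rcases hl0.eq_or_lt with rfl | hl0
    · obtain ⟨h1, h2⟩ := h.shrinker_asymptotics hneg hz
      exact ⟨h1, Or.inr (Or.inr ⟨hneg, h2⟩)⟩
    · set ε := min (l / 2) ((1 - l) / 2) with hε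
      have hε0 : 0 < ε := lt_min (by linarith) (by linarith)
      have he1 : ε ≤ l / 2 := min_le_left _ _
      have he2 : ε ≤ (1 - l) / 2 := min_le_right _ _
      obtain ⟨N, hN⟩ := eventually_atTop.1 ((hz.eventually (lt_mem_nhds
        (show ε < l by linarith))).and (hz.eventually (gt_mem_nhds
        (show l < 1 - ε by linarith))))
      have hb : ∀ s, max s₀ N ≤ s → ε ≤ warp x s ∧ warp x s ≤ 1 - ε := fun s hs =>
        have := hN s ((le_max_right _ _).trans hs)
        ⟨this.1.le, this.2.le⟩
      exact ⟨((h.mono (le_max_left _ _)).conical hlam hε0 hb).1,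
        Or.inl ⟨_, ε, le_max_left _ _, hε0, hb⟩⟩
  · obtain ⟨s₁, h01, hQ⟩ := h.exists_Q_pos hpos
    have h1 := h.mono h01
    obtain ⟨ε₁, hε₁, hz₁⟩ := h1.warp_ge_of_Q_pos hpos hQ
    by_cases hP : ∃ s₂, s₁ ≤ s₂ ∧ 0 < P s₂
    · obtain ⟨s₂, h12, hP⟩ := hP
      obtain ⟨ε₂, hε₂, hz₂⟩ := (h1.mono h12).warp_le_of_P_pos hpos hP
      have hb : ∀ s, s₂ ≤ s → min ε₁ ε₂ ≤ warp x s ∧ warp x s ≤ 1 - min ε₁ ε₂ := fun s hs =>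
        ⟨(min_le_left _ _).trans (hz₁ s (h12.trans hs)),
          (hz₂ s hs).trans (by linarith [min_le_right ε₁ ε₂])⟩
      exact ⟨((h1.mono h12).conical hlam (lt_min hε₁ hε₂) hb).1,
        Or.inl ⟨s₂, _, h01.trans h12, lt_min hε₁ hε₂, hb⟩⟩
    · push Not at hP
      obtain ⟨h2, h3⟩ := h1.expander_asymptotics hpos hP hε₁ hz₁
      exact ⟨h2, Or.inr (Or.inl ⟨hpos, h3⟩)⟩

end IsLogSoliton

/-! ### The reduced system and its extension property -/

/-- The soliton system written in terms of `x`, `v = x y²` and `p = τ₁ - u x²`. -/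
structure IsReducedSoliton (lam a : ℝ) (T : EReal) (x v p : ℝ → ℝ) : Prop where
  x_pos : ∀ t : ℝ, a < t → (t : EReal) < T → 0 < x t
  v_pos : ∀ t : ℝ, a < t → (t : EReal) < T → 0 < v t
  deriv_x : ∀ t : ℝ, a < t → (t : EReal) < T → HasDerivAt x
    (p t / (3 * x t) - (2 * lam * v t - p t) * x t ^ 2 / (6 * v t) + 1
      - x t ^ 3 / (2 * v t)) t
  deriv_v : ∀ t : ℝ, a < t → (t : EReal) < T → HasDerivAt v (x t ^ 2 / 2 + v t / x t) t
  deriv_p : ∀ t : ℝ, a < t → (t : EReal) < T → HasDerivAt p (lam * x t ^ 2) t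

/-- The torsion component `τ₁` in terms of `x`, `v = x y²` and `p = τ₁ - u x²`. -/
noncomputable def reducedTorsion₁ (lam x v p : ℝ) : ℝ :=
  2 * p / 3 - (2 * lam * v - p) * x ^ 3 / (3 * v)

/-- The torsion component `τ₂` in terms of `x`, `v = x y²` and `p = τ₁ - u x²`. -/
noncomputable def reducedTorsion₂ (lam x v p : ℝ) : ℝ :=
  (2 * lam * v - p) / 6 - p * v / (3 * x ^ 3)

/-- The soliton vector field in terms of `x`, `v = x y²` and `p = τ₁ - u x²`. -/
noncomputable def reducedField (lam x v p : ℝ) : ℝ :=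
  -(p / x ^ 2 + (2 * lam * v - p) * x / v) / 3

theorem eventually_mem_interval {a t : ℝ} {T : EReal} (ha : a < t) (hT : (t : EReal) < T) :
    ∀ᶠ s : ℝ in 𝓝 t, a < s ∧ (s : EReal) < T :=
  (lt_mem_nhds ha).and
    ((isOpen_lt continuous_coe_real_ereal continuous_const).mem_nhds hT)

theorem hasDerivAt_of_sq {f : ℝ → ℝ} {d t : ℝ} (hf : ∀ᶠ s in 𝓝 t, 0 < f s)
    (h : HasDerivAt (fun s => f s ^ 2) d t) : HasDerivAt f (d / (2 * f t)) t := by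
  have h0 : 0 < f t := hf.self_of_nhds
  have := h.sqrt (by positivity)
  rw [Real.sqrt_sq h0.le] at this
  refine this.congr_of_eventuallyEq ?_
  filter_upwards [hf] with s hs
  rw [Real.sqrt_sq hs.le]

/-! ### Equivalence of the full and the reduced system -/

namespace IsSp2Soliton

variable {lam a : ℝ} {T : EReal} {x y τ₁ τ₂ u : ℝ → ℝ}

theorem hasDerivAt_x (h : IsSp2Soliton lam a T x y τ₁ τ₂ u) {t : ℝ} (ha : a < t)
    (hT : (t : EReal) < T) :
    HasDerivAt x ((τ₁ t + 2 * x t - x t ^ 3 / y t ^ 2) / (2 * x t)) t := by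
  refine hasDerivAt_of_sq ?_ (h.torsion₁ t ha hT)
  filter_upwards [eventually_mem_interval ha hT] with s hs
  exact h.x_pos s hs.1 hs.2

/-- The torsion `τ` is of type `Ω²₁₄`. -/
theorem torsion_orthogonal (h : IsSp2Soliton lam a T x y τ₁ τ₂ u) {t : ℝ} (ha : a < t)
    (hT : (t : EReal) < T) : y t ^ 2 * τ₁ t + 2 * x t ^ 2 * τ₂ t = 0 := by
  have hx := h.x_pos t ha hT
  have hy := h.y_pos t ha hT
  have := ((h.hasDerivAt_x ha hT).fun_mul (h.torsion₂ t ha hT)).unique (h.closure t ha hT)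
  field_simp at this
  linarith

/-- Given `x`, `v`, `p`, the type condition and the conserved quantity are linear relations which,
with the definition of `p`, determine `u`, `τ₁` and `τ₂`. -/
theorem field_eq (h : IsSp2Soliton lam a T x y τ₁ τ₂ u) {t : ℝ} (ha : a < t)
    (hT : (t : EReal) < T) :
    u t = reducedField lam (x t) (x t * y t ^ 2) (τ₁ t - u t * x t ^ 2) := by
  have hx := h.x_pos t ha hT
  have hy := h.y_pos t ha hT
  have h1 := h.torsion_orthogonal ha hT
  have h2 := h.conserved t ha hT
  have h3 : 2 * lam * (x t * y t ^ 2) = τ₁ t + 2 * τ₂ t - u t * (x t ^ 2 + 2 * y t ^ 2) := by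
    linarith
  unfold reducedField
  rw [h3]
  field_simp
  linear_combination h1

theorem torsion₁_eq (h : IsSp2Soliton lam a T x y τ₁ τ₂ u) {t : ℝ} (ha : a < t)
    (hT : (t : EReal) < T) :
    τ₁ t = reducedTorsion₁ lam (x t) (x t * y t ^ 2) (τ₁ t - u t * x t ^ 2) := by
  have hx := h.x_pos t ha hT
  have hy := h.y_pos t ha hT
  have h1 := h.torsion_orthogonal ha hT
  have h2 := h.conserved t ha hT
  have h3 : 2 * lam * (x t * y t ^ 2) = τ₁ t + 2 * τ₂ t - u t * (x t ^ 2 + 2 * y t ^ 2) := by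
    linarith
  unfold reducedTorsion₁
  rw [h3]
  field_simp
  linear_combination h1

theorem torsion₂_eq (h : IsSp2Soliton lam a T x y τ₁ τ₂ u) {t : ℝ} (ha : a < t)
    (hT : (t : EReal) < T) :
    τ₂ t = reducedTorsion₂ lam (x t) (x t * y t ^ 2) (τ₁ t - u t * x t ^ 2) := by
  have hx := h.x_pos t ha hT
  have hy := h.y_pos t ha hT
  have h1 := h.torsion_orthogonal ha hT
  have h2 := h.conserved t ha hT
  have h3 : 2 * lam * (x t * y t ^ 2) = τ₁ t + 2 * τ₂ t - u t * (x t ^ 2 + 2 * y t ^ 2) := by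
    linarith
  unfold reducedTorsion₂
  rw [h3]
  field_simp
  linear_combination 6 * h1

theorem reduced (h : IsSp2Soliton lam a T x y τ₁ τ₂ u) :
    IsReducedSoliton lam a T x (fun t => x t * y t ^ 2) (fun t => τ₁ t - u t * x t ^ 2) where
  x_pos := h.x_pos
  v_pos t ha hT := mul_pos (h.x_pos t ha hT) (pow_pos (h.y_pos t ha hT) 2)
  deriv_x t ha hT := by
    have hx := h.x_pos t ha hT
    have hy := h.y_pos t ha hT
    refine (h.hasDerivAt_x ha hT).congr_deriv ?_
    have h1 := h.torsion₁_eq ha hT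
    unfold reducedTorsion₁ at h1
    generalize τ₁ t - u t * x t ^ 2 = q at h1 ⊢
    rw [h1]
    field_simp
    ring
  deriv_v t ha hT := by
    have hx := h.x_pos t ha hT
    refine (h.closure t ha hT).congr_deriv ?_
    field_simp
  deriv_p := h.soliton₁

end IsSp2Soliton

namespace IsReducedSoliton

variable {lam a : ℝ} {T : EReal} {x v p : ℝ → ℝ}

theorem isSp2Soliton (h : IsReducedSoliton lam a T x v p) :
    IsSp2Soliton lam a T x (fun t => √(v t / x t))
      (fun t => reducedTorsion₁ lam (x t) (v t) (p t))
      (fun t => reducedTorsion₂ lam (x t) (v t) (p t))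
      (fun t => reducedField lam (x t) (v t) (p t)) := by
  have hsq : ∀ t : ℝ, a < t → (t : EReal) < T → √(v t / x t) ^ 2 = v t / x t := fun t ha hT =>
    Real.sq_sqrt (div_nonneg (h.v_pos t ha hT).le (h.x_pos t ha hT).le)
  refine ⟨h.x_pos, fun t ha hT => Real.sqrt_pos.2 (div_pos (h.v_pos t ha hT) (h.x_pos t ha hT)),
    fun t ha hT => ?_, fun t ha hT => ?_, fun t ha hT => ?_, fun t ha hT => ?_,
    fun t ha hT => ?_, fun t ha hT => ?_⟩
  all_goals
    have hx := h.x_pos t ha hT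
    have hv := h.v_pos t ha hT
    have hev := eventually_mem_interval ha hT
  · refine ((h.deriv_x t ha hT).fun_pow 2).congr_deriv ?_
    simp only [hsq t ha hT, reducedTorsion₁]
    field_simp
    ring
  · have : HasDerivAt (fun s => v s / x s)
        (reducedTorsion₂ lam (x t) (v t) (p t) + x t) t := by
      refine ((h.deriv_v t ha hT).fun_div (h.deriv_x t ha hT) hx.ne').congr_deriv ?_
      unfold reducedTorsion₂
      field_simp
      ring
    exact this.congr_of_eventuallyEq (hev.mono fun s hs => hsq s hs.1 hs.2)
  · have : HasDerivAt v (x t ^ 2 / 2 + √(v t / x t) ^ 2) t := by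
      rw [hsq t ha hT]; exact h.deriv_v t ha hT
    refine this.congr_of_eventuallyEq (hev.mono fun s hs => ?_)
    have := h.x_pos s hs.1 hs.2
    simp only [hsq s hs.1 hs.2]
    field_simp
  · refine (h.deriv_p t ha hT).congr_of_eventuallyEq (hev.mono fun s hs => ?_)
    have := h.x_pos s hs.1 hs.2
    have := h.v_pos s hs.1 hs.2
    simp only [reducedTorsion₁, reducedField]
    field_simp
    ring
  -- The second soliton equation is not part of the reduced system: algebraically `τ₂ - u y² = (2λv
  -- - p)/2`, so it follows from the equations for `v` and `p`.
  · have : HasDerivAt (fun s => (2 * lam * v s - p s) / 2) (lam * √(v t / x t) ^ 2) t := by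
      refine ((((h.deriv_v t ha hT).const_mul (2 * lam)).fun_sub
        (h.deriv_p t ha hT)).div_const 2).congr_deriv ?_
      rw [hsq t ha hT]
      ring
    refine this.congr_of_eventuallyEq (hev.mono fun s hs => ?_)
    have := h.x_pos s hs.1 hs.2
    have := h.v_pos s hs.1 hs.2
    simp only [hsq s hs.1 hs.2, reducedTorsion₂, reducedField]
    field_simp
    ring
  · simp only [hsq t ha hT, reducedTorsion₁, reducedTorsion₂, reducedField]
    field_simp
    ring

end IsReducedSoliton

/-- Two functions whose values and derivatives match at `b` glue to a differentiable function. -/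
theorem hasDerivAt_glue {f f' g : ℝ → ℝ} {a b e : ℝ} (hab : a < b)
    (hf : ∀ t, a < t → t < b → HasDerivAt f (f' t) t)
    (hlim : Tendsto f (𝓝[<] b) (𝓝 (g b))) (hlim' : Tendsto f' (𝓝[<] b) (𝓝 e))
    (hg : HasDerivAt g e b) : HasDerivAt (fun t => if t < b then f t else g t) e b := by
  have heq : ∀ t, a < t → t < b →
      HasDerivAt (fun t => if t < b then f t else g t) (f' t) t := by
    intro t h1 h2
    refine (hf t h1 h2).congr_of_eventuallyEq ?_
    filter_upwards [gt_mem_nhds h2] with s hs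
    exact if_pos hs
  have hmem : Set.Ioo a b ∈ 𝓝[<] b := Ioo_mem_nhdsLT hab
  have hl : HasDerivWithinAt (fun t => if t < b then f t else g t) e (Set.Iic b) b := by
    refine hasDerivWithinAt_Iic_of_tendsto_deriv (s := Set.Ioo a b)
      (fun t ht => (heq t ht.1 ht.2).differentiableAt.differentiableWithinAt) ?_ hmem ?_
    · rw [ContinuousWithinAt, if_neg (lt_irrefl b)]
      refine (hlim.mono_left (nhdsWithin_mono b fun t ht => ht.2)).congr' ?_
      filter_upwards [self_mem_nhdsWithin] with t ht
      exact (if_pos ht.2).symm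
    · refine hlim'.congr' ?_
      filter_upwards [hmem] with t ht
      exact (heq t ht.1 ht.2).deriv.symm
  have hr : HasDerivWithinAt (fun t => if t < b then f t else g t) e (Set.Ici b) b :=
    hg.hasDerivWithinAt.congr (fun t ht => if_neg (not_lt.2 ht)) (if_neg (lt_irrefl b))
  have := hl.union hr
  rwa [Set.Iic_union_Ici, hasDerivWithinAt_univ] at this

/-- Local solvability of the reduced system. -/
theorem exists_local_reducedSoliton (lam t₀ : ℝ) {x₀ v₀ : ℝ} (p₀ : ℝ) (hx : 0 < x₀)
    (hv : 0 < v₀) :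
    ∃ ε > 0, ∃ x v p : ℝ → ℝ, x t₀ = x₀ ∧ v t₀ = v₀ ∧ p t₀ = p₀ ∧
      IsReducedSoliton lam (t₀ - ε) ((t₀ + ε : ℝ) : EReal) x v p := by
  let F : ℝ × ℝ × ℝ → ℝ × ℝ × ℝ := fun w =>
    (w.2.2 / (3 * w.1) - (2 * lam * w.2.1 - w.2.2) * w.1 ^ 2 / (6 * w.2.1) + 1
      - w.1 ^ 3 / (2 * w.2.1), w.1 ^ 2 / 2 + w.2.1 / w.1, lam * w.1 ^ 2)
  have hF : ContDiffAt ℝ 1 F (x₀, v₀, p₀) := by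
    have h1 : (3 * x₀) ≠ 0 := by positivity
    have h2 : (6 * v₀) ≠ 0 := by positivity
    have h3 : (2 * v₀) ≠ 0 := by positivity
    have h4 : x₀ ≠ 0 := hx.ne'
    have c1 : ContDiffAt ℝ 1 (fun w : ℝ × ℝ × ℝ => w.1) (x₀, v₀, p₀) := by fun_prop
    have c2 : ContDiffAt ℝ 1 (fun w : ℝ × ℝ × ℝ => w.2.1) (x₀, v₀, p₀) := by fun_prop
    have c3 : ContDiffAt ℝ 1 (fun w : ℝ × ℝ × ℝ => w.2.2) (x₀, v₀, p₀) := by fun_prop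
    refine ContDiffAt.prodMk ?_ (ContDiffAt.prodMk ?_ ?_)
    · exact (((c3.div (contDiffAt_const.mul c1) h1).sub
        ((((contDiffAt_const.mul c2).sub c3).mul (c1.pow 2)).div
          (contDiffAt_const.mul c2) h2)).add contDiffAt_const).sub
            ((c1.pow 3).div (contDiffAt_const.mul c2) h3)
    · exact ((c1.pow 2).div_const 2).add (c2.div c1 h4)
    · exact contDiffAt_const.mul (c1.pow 2)
  obtain ⟨α, hα0, ε, hε, hα⟩ :=
    hF.exists_forall_mem_closedBall_exists_eq_forall_mem_Ioo_hasDerivAt₀ t₀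
  have hc : ContinuousAt α t₀ := (hα t₀ ⟨by linarith, by linarith⟩).continuousAt
  have hpos : ∀ᶠ t in 𝓝 t₀, 0 < (α t).1 ∧ 0 < (α t).2.1 := by
    have e1 : Tendsto (fun t => (α t).1) (𝓝 t₀) (𝓝 x₀) := by
      have := hc.tendsto.fst_nhds; rwa [hα0] at this
    have e2 : Tendsto (fun t => (α t).2.1) (𝓝 t₀) (𝓝 v₀) := by
      have := hc.tendsto.snd_nhds.fst_nhds; rwa [hα0] at this
    exact (e1.eventually (lt_mem_nhds hx)).and (e2.eventually (lt_mem_nhds hv))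
  obtain ⟨δ, hδ, hball⟩ := Metric.eventually_nhds_iff.1 hpos
  have hdom : ∀ t : ℝ, t₀ - min ε δ < t → (t : EReal) < ((t₀ + min ε δ : ℝ) : EReal) →
      (0 < (α t).1 ∧ 0 < (α t).2.1) ∧ HasDerivAt α (F (α t)) t := by
    intro t h1 h2
    rw [EReal.coe_lt_coe_iff] at h2
    have m1 := min_le_left ε δ
    have m2 := min_le_right ε δ
    refine ⟨hball ?_, hα t ⟨by linarith, by linarith⟩⟩
    rw [Real.dist_eq, abs_lt]
    constructor <;> linarith
  refine ⟨min ε δ, lt_min hε hδ, fun t => (α t).1, fun t => (α t).2.1, fun t => (α t).2.2,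
    by simp [hα0], by simp [hα0], by simp [hα0], ?_⟩
  refine ⟨fun t h1 h2 => (hdom t h1 h2).1.1, fun t h1 h2 => (hdom t h1 h2).1.2,
    fun t h1 h2 => ?_, fun t h1 h2 => ?_, fun t h1 h2 => ?_⟩
  · exact hasFDerivAt_fst.comp_hasDerivAt t (hdom t h1 h2).2
  · exact hasFDerivAt_fst.comp_hasDerivAt t
      (hasFDerivAt_snd.comp_hasDerivAt t (hdom t h1 h2).2)
  · exact hasFDerivAt_snd.comp_hasDerivAt t
      (hasFDerivAt_snd.comp_hasDerivAt t (hdom t h1 h2).2)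

/-- A solution of the reduced system with an admissible limit at a finite time extends beyond. -/
theorem IsReducedSoliton.exists_extension {lam a b x₀ v₀ p₀ : ℝ} {x v p : ℝ → ℝ} (hab : a < b)
    (h : IsReducedSoliton lam a b x v p) (hx₀ : 0 < x₀) (hv₀ : 0 < v₀)
    (hx : Tendsto x (𝓝[<] b) (𝓝 x₀)) (hv : Tendsto v (𝓝[<] b) (𝓝 v₀))
    (hp : Tendsto p (𝓝[<] b) (𝓝 p₀)) :
    ∃ b' : ℝ, b < b' ∧ ∃ x' v' p' : ℝ → ℝ, IsReducedSoliton lam a b' x' v' p' ∧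
      ∀ t, t < b → x' t = x t ∧ v' t = v t ∧ p' t = p t := by
  obtain ⟨ε, hε, X, V, Q, hX, hV, hQ, hS⟩ := exists_local_reducedSoliton lam b p₀ hx₀ hv₀
  have hb1 : b - ε < b := by linarith
  have hb2 : (b : EReal) < ((b + ε : ℝ) : EReal) := by
    rw [EReal.coe_lt_coe_iff]; linarith
  refine ⟨b + ε, by linarith, fun t => if t < b then x t else X t,
    fun t => if t < b then v t else V t, fun t => if t < b then p t else Q t, ?_,
    fun t ht => by simp [ht]⟩
  have glue : ∀ {f f' g g' : ℝ → ℝ} {w : ℝ → ℝ},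
      (∀ t, a < t → t < b → HasDerivAt f (f' t) t) →
      Tendsto f (𝓝[<] b) (𝓝 (g b)) → Tendsto f' (𝓝[<] b) (𝓝 (g' b)) →
      (∀ t, b - ε < t → (t : EReal) < ((b + ε : ℝ) : EReal) → HasDerivAt g (g' t) t) →
      (∀ t, t < b → w t = f' t) → (∀ t, b ≤ t → w t = g' t) →
      ∀ t, a < t → (t : EReal) < ((b + ε : ℝ) : EReal) →
        HasDerivAt (fun t => if t < b then f t else g t) (w t) t := by
    intro f f' g g' w hf h1 h2 hg w1 w2 t ha hT
    rcases lt_trichotomy t b with htb | rfl | htb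
    · rw [w1 t htb]
      refine (hf t ha htb).congr_of_eventuallyEq ?_
      filter_upwards [gt_mem_nhds htb] with s hs
      exact if_pos hs
    · rw [w2 t le_rfl]
      exact hasDerivAt_glue hab hf h1 h2 (hg t hb1 hb2)
    · rw [w2 t htb.le]
      refine (hg t (by linarith) hT).congr_of_eventuallyEq ?_
      filter_upwards [lt_mem_nhds htb] with s hs
      exact if_neg (not_lt.2 hs.le)
  have coe : ∀ {t : ℝ}, t < b → (t : EReal) < b := fun ht => EReal.coe_lt_coe_iff.2 ht
  refine ⟨fun t ha hT => ?_, fun t ha hT => ?_,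
    glue (fun t ha hT => h.deriv_x t ha (coe hT)) (by rwa [hX]) ?_ hS.deriv_x
      (fun t ht => by simp [ht]) (fun t ht => by simp [not_lt.2 ht]),
    glue (fun t ha hT => h.deriv_v t ha (coe hT)) (by rwa [hV]) ?_ hS.deriv_v
      (fun t ht => by simp [ht]) (fun t ht => by simp [not_lt.2 ht]),
    glue (fun t ha hT => h.deriv_p t ha (coe hT)) (by rwa [hQ]) ?_ hS.deriv_p
      (fun t ht => by simp [ht]) (fun t ht => by simp [not_lt.2 ht])⟩
  · split_ifs with ht
    · exact h.x_pos t ha (coe ht)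
    · exact hS.x_pos t (by linarith) hT
  · split_ifs with ht
    · exact h.v_pos t ha (coe ht)
    · exact hS.v_pos t (by linarith) hT
  · rw [hX, hV, hQ]
    exact (((hp.div (hx.const_mul 3) (by positivity)).sub
      ((((hv.const_mul (2 * lam)).sub hp).mul (hx.pow 2)).div (hv.const_mul 6)
        (by positivity))).add_const 1).sub ((hx.pow 3).div (hv.const_mul 2) (by positivity))
  · rw [hX, hV]
    exact ((hx.pow 2).div_const 2).add (hv.div hx hx₀.ne')
  · rw [hX]
    exact (hx.pow 2).const_mul lam

/-- A soliton end has no admissible limit at a finite time. -/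
theorem IsSp2SolitonEnd.not_tendsto {lam a b x₀ v₀ p₀ : ℝ} {x y τ₁ τ₂ u : ℝ → ℝ}
    (h : IsSp2SolitonEnd lam a b x y τ₁ τ₂ u) (hx₀ : 0 < x₀) (hv₀ : 0 < v₀)
    (hx : Tendsto x (𝓝[<] b) (𝓝 x₀)) (hv : Tendsto (fun t => x t * y t ^ 2) (𝓝[<] b) (𝓝 v₀))
    (hp : Tendsto (fun t => τ₁ t - u t * x t ^ 2) (𝓝[<] b) (𝓝 p₀)) : False := by
  obtain ⟨b', hb', x', v', p', hR, heq⟩ := h.soliton.reduced.exists_extension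
    (EReal.coe_lt_coe_iff.1 h.lt) hx₀ hv₀ hx hv hp
  refine h.inextensible b' _ _ _ _ _ (EReal.coe_lt_coe_iff.2 hb') hR.isSp2Soliton
    fun t ha hT => ?_
  obtain ⟨e1, e2, e3⟩ := heq t (EReal.coe_lt_coe_iff.1 hT)
  have hxp := h.soliton.x_pos t ha hT
  simp only [e1, e2, e3]
  refine ⟨trivial, ?_, (h.soliton.torsion₁_eq ha hT).symm, (h.soliton.torsion₂_eq ha hT).symm,
    (h.soliton.field_eq ha hT).symm⟩
  rw [mul_div_cancel_left₀ _ hxp.ne', Real.sqrt_sq (h.soliton.y_pos t ha hT).le]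

/-! ### Finite existence time -/

theorem abs_sub_le_sub_of_hasDerivAt {f f' g g' : ℝ → ℝ} {s₀ b : ℝ}
    (hf : ∀ t, s₀ ≤ t → t < b → HasDerivAt f (f' t) t)
    (hg : ∀ t, s₀ ≤ t → t < b → HasDerivAt g (g' t) t)
    (h : ∀ t, s₀ ≤ t → t < b → |f' t| ≤ g' t) {r t : ℝ} (hr : s₀ ≤ r) (hrt : r ≤ t)
    (ht : t < b) : |f t - f r| ≤ g t - g r := by
  have h1 := monotoneOn_Icc_of_hasDerivAt_nonneg (f := fun s => g s + f s) (s₀ := r) (s₁ := t)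
    (fun s hs => (hg s (hr.trans hs.1) (hs.2.trans_lt ht)).fun_add
      (hf s (hr.trans hs.1) (hs.2.trans_lt ht)))
    (fun s hs => by linarith [neg_le_of_abs_le (h s (hr.trans hs.1) (hs.2.trans_lt ht))])
    (Set.left_mem_Icc.2 hrt) (Set.right_mem_Icc.2 hrt) hrt
  have h2 := monotoneOn_Icc_of_hasDerivAt_nonneg (f := fun s => g s - f s) (s₀ := r) (s₁ := t)
    (fun s hs => (hg s (hr.trans hs.1) (hs.2.trans_lt ht)).fun_sub
      (hf s (hr.trans hs.1) (hs.2.trans_lt ht)))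
    (fun s hs => by linarith [le_of_abs_le (h s (hr.trans hs.1) (hs.2.trans_lt ht))])
    (Set.left_mem_Icc.2 hrt) (Set.right_mem_Icc.2 hrt) hrt
  simp only at h1 h2
  rw [abs_le]
  constructor <;> linarith

/-- A function whose derivative is dominated by that of a bounded function has a left limit. -/
theorem exists_tendsto_left_of_hasDerivAt {f f' g g' : ℝ → ℝ} {s₀ b G : ℝ} (hb : s₀ < b)
    (hf : ∀ t, s₀ ≤ t → t < b → HasDerivAt f (f' t) t)
    (hg : ∀ t, s₀ ≤ t → t < b → HasDerivAt g (g' t) t)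
    (h : ∀ t, s₀ ≤ t → t < b → |f' t| ≤ g' t) (hG : ∀ t, s₀ ≤ t → t < b → g t ≤ G) :
    ∃ c, Tendsto f (𝓝[<] b) (𝓝 c) := by
  have key : ∀ r t, s₀ ≤ r → r ≤ t → t < b → |f t - f r| ≤ g t - g r := fun r t h1 h2 h3 =>
    abs_sub_le_sub_of_hasDerivAt hf hg h h1 h2 h3
  have hne : (Set.Ioo s₀ b).Nonempty := Set.nonempty_Ioo.2 hb
  have h1 := MonotoneOn.tendsto_nhdsWithin_Ioo_left (f := g) hne
    (fun r hr t ht hrt => by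
      have := (abs_nonneg _).trans (key r t hr.1.le hrt ht.2); linarith)
    ⟨G, by rintro _ ⟨t, ht, rfl⟩; exact hG t ht.1.le ht.2⟩
  have h2 := MonotoneOn.tendsto_nhdsWithin_Ioo_left (f := fun t => g t + f t) hne
    (fun r hr t ht hrt => by
      have := neg_le_of_abs_le (key r t hr.1.le hrt ht.2)
      simp only; linarith)
    ⟨2 * G + f s₀ - g s₀, by
      rintro _ ⟨t, ht, rfl⟩
      have h1 := hG t ht.1.le ht.2
      have h2 := le_of_abs_le (key s₀ t le_rfl ht.1.le ht.2)
      simp only; linarith⟩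
  refine ⟨_, (h2.sub h1).congr fun t => ?_⟩
  ring

namespace IsReducedSoliton

variable {lam a : ℝ} {T : EReal} {x v p : ℝ → ℝ}

theorem hasDerivAt_sq (h : IsReducedSoliton lam a T x v p) {t : ℝ} (ha : a < t)
    (hT : (t : EReal) < T) : HasDerivAt (fun s => x s ^ 2)
      (2 * p t / 3 - (2 * lam * v t - p t) * x t ^ 3 / (3 * v t) + 2 * x t
        - x t ^ 4 / v t) t := by
  have hx := h.x_pos t ha hT
  have hv := h.v_pos t ha hT
  refine ((h.deriv_x t ha hT).fun_pow 2).congr_deriv ?_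
  field_simp
  ring

theorem deriv_v_pos (h : IsReducedSoliton lam a T x v p) {t : ℝ} (ha : a < t)
    (hT : (t : EReal) < T) : 0 < x t ^ 2 / 2 + v t / x t := by
  have hx := h.x_pos t ha hT
  have hv := h.v_pos t ha hT
  positivity

theorem v_mono (h : IsReducedSoliton lam a T x v p) {r t : ℝ} (hr : a < r) (hrt : r ≤ t)
    (hT : (t : EReal) < T) : v r ≤ v t := by
  have hlt : ∀ s, s ≤ t → (s : EReal) < T := fun s hs =>
    (EReal.coe_le_coe_iff.2 hs).trans_lt hT
  exact monotoneOn_Icc_of_hasDerivAt_nonneg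
    (fun s hs => h.deriv_v s (hr.trans_le hs.1) (hlt s hs.2))
    (fun s hs => (h.deriv_v_pos (hr.trans_le hs.1) (hlt s hs.2)).le)
    (Set.left_mem_Icc.2 hrt) (Set.right_mem_Icc.2 hrt) hrt

/-- One of the two terms of `v' = x²/2 + v/x` is always bounded below: the second if `x ≤ 1`, the
first if `x ≥ 1`. -/
theorem v_tendsto_atTop (h : IsReducedSoliton lam a ⊤ x v p) : Tendsto v atTop atTop := by
  have ha : a < a + 1 := by linarith
  have hv₀ := h.v_pos (a + 1) ha (EReal.coe_lt_top _)
  refine tendsto_atTop_of_le_hasDerivAt (c := min (v (a + 1)) (1 / 2)) (s₀ := a + 1)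
    (lt_min hv₀ (by norm_num))
    (fun s hs => h.deriv_v s (ha.trans_le hs) (EReal.coe_lt_top _)) fun s hs => ?_
  have hx := h.x_pos s (ha.trans_le hs) (EReal.coe_lt_top _)
  have hv := h.v_mono ha hs (EReal.coe_lt_top _)
  rcases le_total (x s) 1 with h1 | h1
  · refine (min_le_left _ _).trans (hv.trans ?_)
    have : v s ≤ v s / x s := le_div_self (hv₀.le.trans hv) hx h1
    nlinarith [sq_nonneg (x s)]
  · refine (min_le_right _ _).trans ?_
    have : 0 ≤ v s / x s := div_nonneg (hv₀.le.trans hv) hx.le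
    nlinarith

/-- If `v` stays bounded up to a finite time, then `x²`, `v` and `p` have limits there. -/
theorem exists_limits {b s₀ V : ℝ} (h : IsReducedSoliton lam a b x v p) (ha : a < s₀)
    (hb : s₀ < b) (hV : ∀ t, s₀ ≤ t → t < b → v t ≤ V) :
    ∃ X v₁ p₁, 0 < v₁ ∧ Tendsto (fun t => x t ^ 2) (𝓝[<] b) (𝓝 X) ∧
      Tendsto v (𝓝[<] b) (𝓝 v₁) ∧ Tendsto p (𝓝[<] b) (𝓝 p₁) := by
  have coe : ∀ {t : ℝ}, t < b → (t : EReal) < b := fun ht => EReal.coe_lt_coe_iff.2 ht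
  have hxp : ∀ t, s₀ ≤ t → t < b → 0 < x t := fun t h1 h2 => h.x_pos t (ha.trans_le h1) (coe h2)
  have hvd : ∀ t, s₀ ≤ t → t < b → HasDerivAt v (x t ^ 2 / 2 + v t / x t) t := fun t h1 h2 =>
    h.deriv_v t (ha.trans_le h1) (coe h2)
  have hpd : ∀ t, s₀ ≤ t → t < b → HasDerivAt p (lam * x t ^ 2) t := fun t h1 h2 =>
    h.deriv_p t (ha.trans_le h1) (coe h2)
  have hv₀ : 0 < v s₀ := h.v_pos s₀ ha (coe hb)
  have hv₀V : v s₀ ≤ V := hV s₀ le_rfl hb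
  have hV0 : 0 < V := hv₀.trans_le hv₀V
  have hvm : ∀ t, s₀ ≤ t → t < b → v s₀ ≤ v t := fun t h1 h2 => h.v_mono ha h1 (coe h2)
  have hdom : ∀ t, s₀ ≤ t → t < b → |lam * x t ^ 2| ≤ 2 * |lam| * (x t ^ 2 / 2 + v t / x t) := by
    intro t h1 h2
    have h3 : 0 ≤ v t / x t := div_nonneg (hv₀.le.trans (hvm t h1 h2)) (hxp t h1 h2).le
    rw [abs_mul, abs_of_nonneg (sq_nonneg (x t))]
    have := mul_nonneg (abs_nonneg lam) h3
    linarith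
  have hgd : ∀ t, s₀ ≤ t → t < b →
      HasDerivAt (fun s => 2 * |lam| * v s) (2 * |lam| * (x t ^ 2 / 2 + v t / x t)) t :=
    fun t h1 h2 => (hvd t h1 h2).const_mul _
  obtain ⟨p₁, hp₁⟩ := exists_tendsto_left_of_hasDerivAt hb hpd hgd hdom
    (G := 2 * |lam| * V) (fun t h1 h2 => mul_le_mul_of_nonneg_left (hV t h1 h2) (by positivity))
  obtain ⟨v₁, hv₁⟩ := exists_tendsto_left_of_hasDerivAt hb hvd hvd
    (fun t h1 h2 => (abs_of_pos (h.deriv_v_pos (ha.trans_le h1) (coe h2))).le) hV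
  have hmem : ∀ᶠ t in 𝓝[<] b, s₀ ≤ t ∧ t < b := by
    filter_upwards [Ico_mem_nhdsLT hb] with t ht using ht
  have hv₁0 : 0 < v₁ :=
    hv₀.trans_le (ge_of_tendsto hv₁ (hmem.mono fun t ht => hvm t ht.1 ht.2))
  set Q : ℝ := |p s₀| + 2 * |lam| * V with hQ
  have hQ0 : 0 ≤ Q := by positivity
  have hpQ : ∀ t, s₀ ≤ t → t < b → |p t| ≤ Q := by
    intro t h1 h2
    have e1 := abs_sub_le_sub_of_hasDerivAt hpd hgd hdom le_rfl h1 h2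
    have e2 := abs_sub_abs_le_abs_sub (p t) (p s₀)
    have e3 := mul_le_mul_of_nonneg_left (hV t h1 h2) (by positivity : 0 ≤ 2 * |lam|)
    have e4 : 0 ≤ 2 * |lam| * v s₀ := by positivity
    linarith
  have hq : ∀ t, s₀ ≤ t → t < b → |2 * lam * v t - p t| ≤ 2 * |lam| * V + Q := by
    intro t h1 h2
    refine (abs_sub _ _).trans (add_le_add ?_ (hpQ t h1 h2))
    have : 0 ≤ v t := hv₀.le.trans (hvm t h1 h2)
    rw [abs_mul, abs_mul, abs_two, abs_of_nonneg this]
    exact mul_le_mul_of_nonneg_left (hV t h1 h2) (by positivity)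
  set W : ℝ := 2 * |lam| * V + Q with hW
  have hW0 : 0 ≤ W := by positivity
  have hquot : ∀ t, s₀ ≤ t → t < b → |(2 * lam * v t - p t) / v t| ≤ W / v s₀ := by
    intro t h1 h2
    rw [abs_div, abs_of_pos (hv₀.trans_le (hvm t h1 h2))]
    exact div_le_div₀ hW0 (hq t h1 h2) hv₀ (hvm t h1 h2)
  set K : ℝ := Q / 3 + W / v s₀ / 6 + 1 with hK
  have hK0 : 0 < K := by positivity
  -- At `x = M` the other terms of `x'` total at most `K M²`, while the damping is at least
  -- `M³/(2V)`; hence the requirement `M > 2VK`.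
  set M : ℝ := max (x s₀) (2 * V * K + 1) with hM
  have hM2 : 2 * V * K + 1 ≤ M := le_max_right _ _
  have hVK : 0 < 2 * V * K := by positivity
  have hM1 : 1 ≤ M := by linarith
  have hM0 : 0 < M := by linarith
  have hxM : ∀ t, s₀ ≤ t → t < b → x t ≤ M := by
    intro t h1 h2
    have := barrier_ge_Icc (f := fun s => -x s) (c := -M) h1
      (fun s hs hst => (h.deriv_x s (ha.trans_le hs) (coe (hst.trans_lt h2))).neg)
      (neg_le_neg (le_max_left _ _)) ?_
    · linarith
    · intro s hs hst _ heq
      have hxs : x s = M := by linarith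
      have hsb := hst.trans_lt h2
      have hvs : 0 < v s := hv₀.trans_le (hvm s hs hsb)
      rw [hxs]
      have e1 : p s / (3 * M) ≤ Q / 3 * M ^ 2 := by
        rw [div_le_iff₀ (by positivity)]
        have : p s ≤ Q := le_of_abs_le (hpQ s hs hsb)
        have h3 : 1 ≤ M ^ 3 := one_le_pow₀ hM1
        nlinarith
      have e2 : -((2 * lam * v s - p s) * M ^ 2 / (6 * v s)) ≤ W / v s₀ / 6 * M ^ 2 := by
        have := neg_le_of_abs_le (hquot s hs hsb)
        have e : -((2 * lam * v s - p s) * M ^ 2 / (6 * v s))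
            = -((2 * lam * v s - p s) / v s) * (M ^ 2 / 6) := by
          field_simp
        rw [e]
        have := mul_le_mul_of_nonneg_right (neg_le.1 this) (by positivity : 0 ≤ M ^ 2 / 6)
        linarith
      have e3 : 1 ≤ M ^ 2 := one_le_pow₀ hM1
      have e4 : K * M ^ 2 < M ^ 3 / (2 * v s) := by
        rw [lt_div_iff₀ (by positivity)]
        have : v s ≤ V := hV s hs hsb
        have h5 : K * (2 * v s) < M := by nlinarith
        nlinarith [mul_lt_mul_of_pos_right h5 (by positivity : 0 < M ^ 2)]
      have e5 : K * M ^ 2 = Q / 3 * M ^ 2 + W / v s₀ / 6 * M ^ 2 + M ^ 2 := by rw [hK]; ring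
      linarith
  set C : ℝ := 2 * Q / 3 + W / v s₀ * (M ^ 3 / 3) + 2 * M + M ^ 4 / v s₀ with hC
  have hEC : ∀ t, s₀ ≤ t → t < b → |2 * p t / 3 - (2 * lam * v t - p t) * x t ^ 3 / (3 * v t)
      + 2 * x t - x t ^ 4 / v t| ≤ C := by
    intro t h1 h2
    have hxt := hxp t h1 h2
    have hvt : 0 < v t := hv₀.trans_le (hvm t h1 h2)
    have hxm := hxM t h1 h2
    have e1 : |2 * p t / 3| ≤ 2 * Q / 3 := by
      rw [abs_div, abs_mul, abs_two, abs_of_pos (by norm_num : (0:ℝ) < 3)]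
      linarith [hpQ t h1 h2]
    have e2 : |(2 * lam * v t - p t) * x t ^ 3 / (3 * v t)| ≤ W / v s₀ * (M ^ 3 / 3) := by
      have e : (2 * lam * v t - p t) * x t ^ 3 / (3 * v t)
          = (2 * lam * v t - p t) / v t * (x t ^ 3 / 3) := by field_simp
      rw [e, abs_mul, abs_of_pos (by positivity : 0 < x t ^ 3 / 3)]
      refine mul_le_mul (hquot t h1 h2) ?_ (by positivity) (by positivity)
      have := pow_le_pow_left₀ hxt.le hxm 3
      linarith
    have e3 : |x t ^ 4 / v t| ≤ M ^ 4 / v s₀ := by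
      rw [abs_of_pos (by positivity)]
      exact div_le_div₀ (by positivity) (pow_le_pow_left₀ hxt.le hxm 4) hv₀ (hvm t h1 h2)
    rw [abs_le] at e1 e2 e3 ⊢
    constructor <;> linarith [e1.1, e1.2, e2.1, e2.2, e3.1, e3.2]
  have hCG : ∀ t, s₀ ≤ t → t < b → C * t ≤ |C| * (|s₀| + |b|) := by
    intro t h1 h2
    refine (le_abs_self _).trans ?_
    rw [abs_mul]
    refine mul_le_mul_of_nonneg_left ?_ (abs_nonneg C)
    rw [abs_le]
    constructor
    · linarith [neg_abs_le s₀, abs_nonneg b]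
    · linarith [le_abs_self b, abs_nonneg s₀]
  obtain ⟨X, hX⟩ := exists_tendsto_left_of_hasDerivAt (g := fun t => C * t) (g' := fun _ => C) hb
    (fun t h1 h2 => h.hasDerivAt_sq (ha.trans_le h1) (coe h2))
    (fun t _ _ => by simpa using (hasDerivAt_id t).const_mul C) hEC hCG
  exact ⟨X, v₁, p₁, hv₁0, hX, hv₁, hp₁⟩

/-- If `x` vanishes at a finite time while `v` and `p` converge, then `p` becomes negative. -/
theorem limit_p_neg {b v₁ p₁ : ℝ} (h : IsReducedSoliton lam a b x v p) (hab : a < b)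
    (hv₁ : 0 < v₁) (hx : Tendsto x (𝓝[<] b) (𝓝 0)) (hv : Tendsto v (𝓝[<] b) (𝓝 v₁))
    (hp : Tendsto p (𝓝[<] b) (𝓝 p₁)) : p₁ < 0 := by
  have coe : ∀ {t : ℝ}, t < b → (t : EReal) < b := fun ht => EReal.coe_lt_coe_iff.2 ht
  have hsq : Tendsto (fun t => x t ^ 2) (𝓝[<] b) (𝓝 0) := by simpa using hx.pow 2
  have hq : Tendsto (fun t => (2 * lam * v t - p t) * x t ^ 2 / (3 * v t)) (𝓝[<] b) (𝓝 0) := by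
    have := (((hv.const_mul (2 * lam)).sub hp).mul hsq).div (hv.const_mul 3) (by positivity)
    rw [mul_zero, zero_div] at this
    exact this
  have hr : Tendsto (fun t => x t ^ 3 / v t) (𝓝[<] b) (𝓝 0) := by
    have := (hx.pow 3).div hv hv₁.ne'
    rw [zero_pow three_ne_zero, zero_div] at this
    exact this
  by_contra hneg
  rw [not_lt] at hneg
  set L : ℝ := 2 / 3 * (|lam| * (b - a)) with hL
  have hL0 : 0 ≤ L := by have := sub_pos.2 hab; positivity
  have hB : Tendsto (fun t => 2 - L * x t - (2 * lam * v t - p t) * x t ^ 2 / (3 * v t)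
      - x t ^ 3 / v t) (𝓝[<] b) (𝓝 2) := by
    have := ((tendsto_const_nhds (x := (2:ℝ))).sub (hx.const_mul L)).sub hq |>.sub hr
    simpa using this
  have hev : ∀ᶠ t in 𝓝[<] b, (0 < 2 - L * x t - (2 * lam * v t - p t) * x t ^ 2 / (3 * v t)
      - x t ^ 3 / v t) ∧ (0 < p₁ → 0 < p t) := by
    refine (hB.eventually (lt_mem_nhds two_pos)).and ?_
    rcases hneg.eq_or_lt with h0 | h0
    · exact Eventually.of_forall fun t ht => absurd ht (by rw [← h0]; exact lt_irrefl 0)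
    · filter_upwards [hp.eventually (lt_mem_nhds h0)] with t ht _ using ht
  obtain ⟨l, hl, hlb⟩ := mem_nhdsLT_iff_exists_Ico_subset.1 (hev.and (Ioo_mem_nhdsLT hab))
  have hat : ∀ t, l ≤ t → t < b → a < t := fun t h1 h2 => (hlb ⟨h1, h2⟩).2.1
  have hxl := h.x_pos l (hat l le_rfl hl) (coe hl)
  obtain ⟨r, hr1, hr2⟩ := mem_nhdsLT_iff_exists_Ico_subset.1
    ((hx.eventually (gt_mem_nhds hxl)).and (Ioo_mem_nhdsLT hl))
  have hlr : l ≤ r := (hr2 ⟨le_rfl, hr1⟩).2.1.le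
  -- Since `x → 0`, the maximum of `x` over `[l, b)` is attained. There `(x²)'` will be shown to be
  -- positive, a contradiction. This also covers the degenerate case `p₁ = 0`.
  obtain ⟨m, hm, hmax⟩ := isCompact_Icc.exists_isMaxOn (Set.nonempty_Icc.2 hlr)
    (f := x) (fun t ht => (h.deriv_x t (hat t ht.1 (ht.2.trans_lt hr1))
      (coe (ht.2.trans_lt hr1))).continuousAt.continuousWithinAt)
  have hmb : m < b := hm.2.trans_lt hr1
  have hle : ∀ t, l ≤ t → t < b → x t ≤ x m := by
    intro t h1 h2
    rcases le_total t r with h3 | h3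
    · exact hmax ⟨h1, h3⟩
    · exact (hr2 ⟨h3, h2⟩).1.le.trans (hmax (Set.left_mem_Icc.2 hlr))
  have ham := hat m hm.1 hmb
  have hxm := h.x_pos m ham (coe hmb)
  have hvm := h.v_pos m ham (coe hmb)
  obtain ⟨⟨hBm, hpm⟩, -⟩ := hlb ⟨hm.1, hmb⟩
  -- If `p₁ = 0`, then `|p m|` is at most the integral of `|λ|x²` over `[m, b)`, which is quadratic
  -- in the maximum `x m` and so negligible against the term `2x` of `(x²)'`.
  have hpL : -(L * x m ^ 2) ≤ 2 * p m / 3 := by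
    rcases hneg.eq_or_lt with h0 | h0
    · have key : ∀ᶠ t in 𝓝[<] b, |p t - p m| ≤ |lam| * x m ^ 2 * (b - a) := by
        filter_upwards [Ico_mem_nhdsLT hmb] with t ht
        have := abs_sub_le_sub_of_hasDerivAt (g := fun s => |lam| * x m ^ 2 * s)
          (g' := fun _ => |lam| * x m ^ 2) (s₀ := m) (b := b)
          (fun s h1 h2 => h.deriv_p s (ham.trans_le h1) (coe h2))
          (fun s _ _ => by simpa using (hasDerivAt_id s).const_mul (|lam| * x m ^ 2))
          (fun s h1 h2 => ?_) le_rfl ht.1 ht.2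
        · refine this.trans ?_
          have : 0 ≤ |lam| * x m ^ 2 := by positivity
          rw [← mul_sub]
          exact mul_le_mul_of_nonneg_left (by linarith [ht.2]) this
        · rw [abs_mul, abs_of_nonneg (sq_nonneg (x s))]
          exact mul_le_mul_of_nonneg_left (pow_le_pow_left₀
            (h.x_pos s (ham.trans_le h1) (coe h2)).le (hle s (hm.1.trans h1) h2) 2)
            (abs_nonneg lam)
      have := le_of_tendsto (hp.sub_const (p m)).abs key
      rw [← h0, zero_sub, abs_neg] at this
      have h3 := neg_le_of_abs_le this
      have h4 : L * x m ^ 2 = 2 / 3 * (|lam| * x m ^ 2 * (b - a)) := by rw [hL]; ring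
      linarith
    · have := hpm h0
      have : 0 ≤ L * x m ^ 2 := by positivity
      linarith
  have hE : 0 < 2 * p m / 3 - (2 * lam * v m - p m) * x m ^ 3 / (3 * v m) + 2 * x m
        - x m ^ 4 / v m := by
    have e : x m * (2 - L * x m - (2 * lam * v m - p m) * x m ^ 2 / (3 * v m)
      - x m ^ 3 / v m) = -(L * x m ^ 2) - (2 * lam * v m - p m) * x m ^ 3 / (3 * v m)
        + 2 * x m - x m ^ 4 / v m := by
      field_simp
      ring
    have := mul_pos hxm hBm
    linarith
  have hd := h.hasDerivAt_sq ham (coe hmb)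
  rw [hasDerivAt_iff_tendsto_slope] at hd
  have hs := (hd.mono_left (nhdsWithin_mono m
    (show Set.Ioi m ⊆ {m}ᶜ from fun t ht => ne_of_gt ht))).eventually (lt_mem_nhds hE)
  obtain ⟨t, ht1, ht2⟩ := (hs.and (Ioo_mem_nhdsGT hmb)).exists
  rw [slope_def_field, lt_div_iff₀ (by linarith [ht2.1]), zero_mul] at ht1
  have := pow_le_pow_left₀ (h.x_pos t (ham.trans ht2.1) (coe ht2.2)).le
    (hle t (hm.1.trans ht2.1.le) ht2.2) 2
  linarith

/-- If `x` vanishes at a finite time while `v` and `p` converge, then `x²` vanishes linearly. -/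
theorem sq_linear {b v₁ p₁ : ℝ} (h : IsReducedSoliton lam a b x v p) (hab : a < b)
    (hv₁ : 0 < v₁) (hx : Tendsto x (𝓝[<] b) (𝓝 0)) (hv : Tendsto v (𝓝[<] b) (𝓝 v₁))
    (hp : Tendsto p (𝓝[<] b) (𝓝 p₁)) :
    ∃ e > 0, ∀ᶠ t in 𝓝[<] b, e / 2 * (b - t) ≤ x t ^ 2 ∧ x t ^ 2 ≤ 2 * e * (b - t) := by
  have coe : ∀ {t : ℝ}, t < b → (t : EReal) < b := fun ht => EReal.coe_lt_coe_iff.2 ht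
  have hneg := h.limit_p_neg hab hv₁ hx hv hp
  have hsq : Tendsto (fun t => x t ^ 2) (𝓝[<] b) (𝓝 0) := by simpa using hx.pow 2
  have hE : Tendsto (fun t => 2 * p t / 3 - (2 * lam * v t - p t) * x t ^ 3 / (3 * v t)
      + 2 * x t - x t ^ 4 / v t) (𝓝[<] b) (𝓝 (2 * p₁ / 3)) := by
    have h1 := (((hv.const_mul (2 * lam)).sub hp).mul (hx.pow 3)).div (hv.const_mul 3)
      (by positivity)
    have h2 := (hx.pow 4).div hv hv₁.ne'
    have := ((((hp.const_mul 2).div_const 3).sub h1).add (hx.const_mul 2)).sub h2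
    simpa using this
  -- The derivative of `x²` tends to `-e`, so near `b` it lies between `-2e` and `-e/2`.
  set e : ℝ := -(2 * p₁ / 3) with he
  have he0 : 0 < e := by rw [he]; linarith
  have hev := (hE.eventually (lt_mem_nhds (show -(2 * e) < 2 * p₁ / 3 by linarith))).and
    (hE.eventually (gt_mem_nhds (show 2 * p₁ / 3 < -(e / 2) by linarith)))
  obtain ⟨l, hl, hlb⟩ := mem_nhdsLT_iff_exists_Ico_subset.1 (hev.and (Ioo_mem_nhdsLT hab))
  have hbt : ∀ c : ℝ, Tendsto (fun t => x t ^ 2 - c * (b - t)) (𝓝[<] b) (𝓝 0) := by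
    intro c
    have : Tendsto (fun t => b - t) (𝓝[<] b) (𝓝 0) := by
      have : Tendsto (fun t : ℝ => b - t) (𝓝 b) (𝓝 (b - b)) :=
        tendsto_const_nhds.sub tendsto_id
      rw [sub_self] at this
      exact this.mono_left nhdsWithin_le_nhds
    simpa using hsq.sub (this.const_mul c)
  have hd : ∀ c t, l ≤ t → t < b → HasDerivAt (fun s => x s ^ 2 - c * (b - s))
      (2 * p t / 3 - (2 * lam * v t - p t) * x t ^ 3 / (3 * v t)
      + 2 * x t - x t ^ 4 / v t + c) t := by
    intro c t h1 h2
    refine ((h.hasDerivAt_sq (hlb ⟨h1, h2⟩).2.1 (coe h2)).fun_sub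
      (((hasDerivAt_id t).const_sub b).const_mul c)).congr_deriv ?_
    ring
  refine ⟨e, he0, ?_⟩
  filter_upwards [Ico_mem_nhdsLT hl] with t ht
  constructor
  · have : (0:ℝ) ≤ x t ^ 2 - e / 2 * (b - t) := by
      refine le_of_tendsto (hbt (e / 2)) ?_
      filter_upwards [Ico_mem_nhdsLT ht.2] with r hr
      have := monotoneOn_Icc_of_hasDerivAt_nonneg (s₀ := t) (s₁ := r)
        (fun s hs => (hd (e / 2) s (ht.1.trans hs.1) (hs.2.trans_lt hr.2)).neg)
        (fun s hs => by
          have := (hlb ⟨ht.1.trans hs.1, hs.2.trans_lt hr.2⟩).1.2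
          linarith)
        (Set.left_mem_Icc.2 hr.1) (Set.right_mem_Icc.2 hr.1) hr.1
      simp only [Pi.neg_apply] at this
      linarith
    linarith
  · have : x t ^ 2 - 2 * e * (b - t) ≤ 0 := by
      refine ge_of_tendsto (hbt (2 * e)) ?_
      filter_upwards [Ico_mem_nhdsLT ht.2] with r hr
      exact monotoneOn_Icc_of_hasDerivAt_nonneg (s₀ := t) (s₁ := r)
        (fun s hs => hd (2 * e) s (ht.1.trans hs.1) (hs.2.trans_lt hr.2))
        (fun s hs => by
          have := (hlb ⟨ht.1.trans hs.1, hs.2.trans_lt hr.2⟩).1.1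
          linarith)
        (Set.left_mem_Icc.2 hr.1) (Set.right_mem_Icc.2 hr.1) hr.1
    linarith

end IsReducedSoliton

/-- The behaviour of a soliton end at a finite time up to which `x y²` stays bounded. -/
theorem IsSp2SolitonEnd.finite_time_rates {lam a b s₀ V : ℝ} {x y τ₁ τ₂ u : ℝ → ℝ}
    (h : IsSp2SolitonEnd lam a b x y τ₁ τ₂ u) (ha : a < s₀) (hb : s₀ < b)
    (hV : ∀ t, s₀ ≤ t → t < b → x t * y t ^ 2 ≤ V) :
    Tendsto (fun t => y t / x t) (𝓝[<] b) atTop ∧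
      x =O[𝓝[<] b] (fun t => √(b - t)) ∧
      y =O[𝓝[<] b] (fun t => (b - t) ^ (-(1 / 4) : ℝ)) := by
  have hab := ha.trans hb
  have hR := h.soliton.reduced
  obtain ⟨X, v₁, p₁, hv₁, hX, hv, hp⟩ := hR.exists_limits ha hb hV
  have hdom : ∀ᶠ t in 𝓝[<] b, s₀ ≤ t ∧ t < b ∧ 0 < x t ∧ 0 < y t := by
    filter_upwards [Ico_mem_nhdsLT hb] with t ht
    have h2 : (t : EReal) < b := EReal.coe_lt_coe_iff.2 ht.2
    exact ⟨ht.1, ht.2, h.soliton.x_pos t (ha.trans_le ht.1) h2,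
      h.soliton.y_pos t (ha.trans_le ht.1) h2⟩
  have hx : Tendsto x (𝓝[<] b) (𝓝 (√X)) := by
    refine ((Real.continuous_sqrt.tendsto X).comp hX).congr' ?_
    filter_upwards [hdom] with t ht
    exact Real.sqrt_sq ht.2.2.1.le
  have hX0 : √X = 0 := by
    by_contra hne
    exact h.not_tendsto (lt_of_le_of_ne (Real.sqrt_nonneg X) (Ne.symm hne)) hv₁ hx hv hp
  rw [hX0] at hx
  obtain ⟨e, he, hlin⟩ := hR.sq_linear hab hv₁ hx hv hp
  refine ⟨?_, ?_, ?_⟩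
  · have hx3 : Tendsto (fun t => x t ^ 3) (𝓝[<] b) (𝓝[>] 0) := by
      refine tendsto_nhdsWithin_iff.2 ⟨by simpa using hx.pow 3, ?_⟩
      filter_upwards [hdom] with t ht
      exact pow_pos ht.2.2.1 3
    have := Real.tendsto_sqrt_atTop.comp (hv.pos_mul_atTop hv₁ hx3.inv_tendsto_nhdsGT_zero)
    refine this.congr' ?_
    filter_upwards [hdom] with t ht
    have hxt := ht.2.2.1
    have hyt := ht.2.2.2
    have e : x t * y t ^ 2 * (x t ^ 3)⁻¹ = (y t / x t) ^ 2 := by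
      field_simp
    simp only [Function.comp, Pi.inv_apply]
    rw [e, Real.sqrt_sq (by positivity)]
  · refine IsBigO.of_bound (√(2 * e)) ?_
    filter_upwards [hdom, hlin] with t ht hl
    rw [Real.norm_of_nonneg ht.2.2.1.le, Real.norm_of_nonneg (Real.sqrt_nonneg _),
      ← Real.sqrt_mul (by positivity)]
    exact Real.le_sqrt_of_sq_le hl.2
  -- From `x²y⁴ ≤ V²` and the lower bound on `x²`, `y⁴(b - t) ≤ 2V²/e`. The added `1` makes the
  -- constant dominated by its own fourth power, which avoids taking a root.
  · refine IsBigO.of_bound (1 + 2 * V ^ 2 / e) ?_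
    filter_upwards [hdom, hlin] with t ht hl
    obtain ⟨h1, h2, hxt, hyt⟩ := ht
    have hbt : 0 < b - t := by linarith
    rw [Real.norm_of_nonneg hyt.le, Real.norm_of_nonneg (Real.rpow_nonneg hbt.le _)]
    refine le_of_pow_le_pow_left₀ (n := 4) (by norm_num) (by positivity) ?_
    have e1 : ((b - t) ^ (-(1 / 4) : ℝ)) ^ 4 = (b - t)⁻¹ := by
      rw [← Real.rpow_natCast, ← Real.rpow_mul hbt.le, ← Real.rpow_neg_one]
      norm_num
    rw [mul_pow, e1, ← div_eq_mul_inv, le_div_iff₀ hbt]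
    have e2 : 1 + 2 * V ^ 2 / e ≤ (1 + 2 * V ^ 2 / e) ^ 4 := by
      refine le_self_pow₀ ?_ (by norm_num)
      have : 0 ≤ 2 * V ^ 2 / e := by positivity
      linarith
    refine le_trans ?_ e2
    have e3 : (x t * y t ^ 2) ^ 2 ≤ V ^ 2 := pow_le_pow_left₀ (by positivity) (hV t h1 h2) 2
    have e4 : y t ^ 4 * (e / 2 * (b - t)) ≤ V ^ 2 := by
      refine le_trans (mul_le_mul_of_nonneg_left hl.1 (by positivity)) ?_
      calc y t ^ 4 * x t ^ 2 = (x t * y t ^ 2) ^ 2 := by ring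
        _ ≤ V ^ 2 := e3
    have e5 : y t ^ 4 * (b - t) ≤ 2 * V ^ 2 / e := by
      rw [le_div_iff₀ he]; linarith
    linarith

/-! ### Change of time -/

namespace IsReducedSoliton

variable {lam a : ℝ} {T : EReal} {x v p : ℝ → ℝ}

theorem v_strictMono (h : IsReducedSoliton lam a T x v p) {r t : ℝ} (hr : a < r) (hrt : r < t)
    (hT : (t : EReal) < T) : v r < v t := by
  have hlt : ∀ s, s ≤ t → (s : EReal) < T := fun s hs =>
    (EReal.coe_le_coe_iff.2 hs).trans_lt hT
  refine strictMonoOn_of_deriv_pos (convex_Icc r t)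
    (fun s hs => (h.deriv_v s (hr.trans_le hs.1) (hlt s hs.2)).continuousAt.continuousWithinAt)
    (fun s hs => ?_) (Set.left_mem_Icc.2 hrt.le) (Set.right_mem_Icc.2 hrt.le) hrt
  have hs' := interior_subset hs
  rw [(h.deriv_v s (hr.trans_le hs'.1) (hlt s hs'.2)).deriv]
  exact h.deriv_v_pos (hr.trans_le hs'.1) (hlt s hs'.2)

/-- If `v` is unbounded, then `log v` can be used as the independent variable. -/
theorem exists_isLogSoliton (h : IsReducedSoliton lam a T x v p) (hlam : lam ≠ 0) {t₀ : ℝ}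
    (ha : a < t₀) (hT : (t₀ : EReal) < T)
    (hunb : ∀ V, ∃ t, t₀ ≤ t ∧ (t : EReal) < T ∧ V < v t) :
    ∃ (s₀ : ℝ) (θ : ℝ → ℝ),
      IsLogSoliton lam s₀ (fun s => x (θ s)) (fun s => p (θ s) / lam) θ ∧
      (∀ s, s₀ ≤ s → (θ s : EReal) < T) ∧
      ∀ t : ℝ, t₀ ≤ t → (t : EReal) < T → θ (Real.log (v t)) = t := by
  -- Starting the inverse function slightly before `t₀` makes it differentiable from both sides at
  -- the endpoint `log (v t₀)`.
  obtain ⟨r₀, har, hrt⟩ := exists_between ha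
  have hTr : (r₀ : EReal) < T := (EReal.coe_lt_coe_iff.2 hrt).trans hT
  have hvr := h.v_pos r₀ har hTr
  have hex : ∀ s, ∃ t : ℝ, Real.log (v r₀) ≤ s →
      r₀ ≤ t ∧ (t : EReal) < T ∧ v t = Real.exp s := by
    intro s
    obtain ⟨t₁, h1, h2, h3⟩ := hunb (Real.exp s)
    by_cases hs : Real.log (v r₀) ≤ s
    · have hlt : ∀ r : ℝ, r ≤ t₁ → (r : EReal) < T := fun r hr =>
        (EReal.coe_le_coe_iff.2 hr).trans_lt h2
      have hcont : ContinuousOn v (Set.Icc r₀ t₁) := fun r hr =>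
        (h.deriv_v r (har.trans_le hr.1) (hlt r hr.2)).continuousAt.continuousWithinAt
      obtain ⟨t, ht, hvt⟩ := intermediate_value_Icc (hrt.le.trans h1) hcont
        ⟨(Real.log_le_iff_le_exp hvr).1 hs, h3.le⟩
      exact ⟨t, fun _ => ⟨ht.1, hlt t ht.2, hvt⟩⟩
    · exact ⟨0, fun hs' => absurd hs' hs⟩
  choose θ hθ using hex
  have hinj : ∀ r t : ℝ, r₀ ≤ r → r₀ ≤ t → (r : EReal) < T → (t : EReal) < T → v r = v t →
      r = t := by
    intro r t h1 h2 h3 h4 h5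
    rcases lt_trichotomy r t with hl | hl | hl
    · exact absurd h5 (h.v_strictMono (har.trans_le h1) hl h4).ne
    · exact hl
    · exact absurd h5 (h.v_strictMono (har.trans_le h2) hl h3).ne'
  have hlog : ∀ t : ℝ, r₀ ≤ t → (t : EReal) < T →
      Real.log (v r₀) ≤ Real.log (v t) ∧ θ (Real.log (v t)) = t := by
    intro t h1 h2
    have hle : Real.log (v r₀) ≤ Real.log (v t) :=
      Real.log_le_log hvr (h.v_mono har h1 h2)
    obtain ⟨e1, e2, e3⟩ := hθ _ hle
    rw [Real.exp_log (h.v_pos t (har.trans_le h1) h2)] at e3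
    exact ⟨hle, hinj _ _ e1 h1 e2 h2 e3⟩
  have hmono : StrictMonoOn θ (Set.Ici (Real.log (v r₀))) := by
    intro r hr s hs hrs
    obtain ⟨e1, e2, e3⟩ := hθ r hr
    obtain ⟨f1, f2, f3⟩ := hθ s hs
    by_contra hle
    have := h.v_mono (har.trans_le f1) (not_lt.1 hle) e2
    rw [e3, f3, Real.exp_le_exp] at this
    linarith
  have hs₀ : Real.log (v r₀) < Real.log (v t₀) :=
    Real.log_lt_log hvr (h.v_strictMono har hrt hT)
  have hderiv : ∀ s, Real.log (v t₀) ≤ s →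
      HasDerivAt θ (warp (fun s => x (θ s)) s * x (θ s)) s := by
    intro s hs
    have hs' : Real.log (v r₀) < s := hs₀.trans_le hs
    obtain ⟨e1, e2, e3⟩ := hθ s hs'.le
    have hlt : r₀ < θ s := by
      refine lt_of_le_of_ne e1 fun heq => ?_
      rw [← heq] at e3
      rw [e3, Real.log_exp] at hs'
      exact lt_irrefl _ hs'
    have haθ := har.trans hlt
    have hcont : ContinuousAt θ s := by
      refine hmono.continuousAt_of_image_mem_nhds (Ici_mem_nhds hs') ?_
      filter_upwards [eventually_mem_interval hlt e2] with t ht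
      have := hlog t ht.1.le ht.2
      exact ⟨Real.log (v t), this.1, this.2⟩
    have hx := h.x_pos _ haθ e2
    have hv := h.v_pos _ haθ e2
    have hpos : 0 < (x (θ s) ^ 2 / 2 + v (θ s) / x (θ s)) / v (θ s) :=
      div_pos (h.deriv_v_pos haθ e2) hv
    have := HasDerivAt.of_local_left_inverse hcont ((h.deriv_v _ haθ e2).log hv.ne') hpos.ne'
      (by
        filter_upwards [lt_mem_nhds hs'] with r hr
        rw [(hθ r hr.le).2.2, Real.log_exp])
    refine this.congr_deriv ?_
    unfold warp
    rw [← e3]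
    field_simp
  refine ⟨Real.log (v t₀), θ, ⟨fun s hs => ?_, fun s hs => ?_, fun s hs => ?_, hderiv⟩,
    fun s hs => (hθ s (hs₀.le.trans hs)).2.1, fun t h1 h2 => (hlog t (hrt.le.trans h1) h2).2⟩
  all_goals
    obtain ⟨e1, e2, e3⟩ := hθ s (hs₀.le.trans hs)
    have haθ := har.trans_le e1
    have hx := h.x_pos _ haθ e2
    have hv := h.v_pos _ haθ e2
  · exact hx
  · refine (HasDerivAt.comp s (h.deriv_x _ haθ e2) (hderiv s hs)).congr_deriv ?_
    unfold warp
    rw [← e3]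
    field_simp
    ring
  · refine ((HasDerivAt.comp s (h.deriv_p _ haθ e2) (hderiv s hs)).div_const lam).congr_deriv ?_
    field_simp

/-- The asymptotic behaviour of a solution of the reduced system along which `v` is unbounded. -/
theorem unbounded_asymptotics (h : IsReducedSoliton lam a T x v p) (hlam : lam ≠ 0) {t₀ : ℝ}
    (ha : a < t₀) (hT : (t₀ : EReal) < T)
    (hunb : ∀ V, ∃ t, t₀ ≤ t ∧ (t : EReal) < T ∧ V < v t) :
    T = ⊤ ∧
    (((∃ C > 0, ∀ᶠ t in atTop, C⁻¹ ≤ v t / x t ^ 3 ∧ v t / x t ^ 3 ≤ C) ∧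
        ∃ c₁ c₂ k : ℝ, IsClosedSp2Cone c₁ c₂ ∧
          (fun t => x t - c₁ * (t + k)) =O[atTop] (fun t : ℝ => t⁻¹) ∧
          (fun t => √(v t / x t) - c₂ * (t + k)) =O[atTop] (fun t : ℝ => t⁻¹)) ∨
      (0 < lam ∧ Tendsto (fun t => v t / x t ^ 3) atTop atTop ∧
        Tendsto (fun t => t * x t) atTop (𝓝 (3 / lam)) ∧
        Tendsto (fun t => Real.log (v t) / t ^ 2) atTop (𝓝 (lam / 6)) ∧
        Tendsto x atTop (𝓝 0)) ∨
      (lam < 0 ∧ Tendsto (fun t => v t / x t ^ 3) atTop (𝓝 0) ∧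
        Tendsto (fun t => Real.log (x t) / t) atTop (𝓝 √(-lam / 18)) ∧
        Tendsto (fun t => v t ^ 2 / x t ^ 4) atTop (𝓝 (-9 / (8 * lam))) ∧
        Tendsto (fun t => Real.log (v t) / t) atTop (𝓝 (2 * √(-lam / 18))))) := by
  obtain ⟨s₀, θ, hL, hθT, hinv⟩ := h.exists_isLogSoliton hlam ha hT hunb
  obtain ⟨hθ, hcases⟩ := hL.dichotomy hlam
  -- The inverse function takes values below `T` and tends to infinity.
  have hTtop : T = ⊤ := by
    by_contra hne
    lift T to ℝ using ⟨hne, fun hb => by simp [hb] at hT⟩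
    obtain ⟨s, hs1, hs2⟩ := ((hθ.eventually_ge_atTop T).and (eventually_ge_atTop s₀)).exists
    exact absurd (EReal.coe_lt_coe_iff.1 (hθT s hs2)) (not_lt.2 hs1)
  subst hTtop
  refine ⟨rfl, ?_⟩
  have hlogv : Tendsto (fun t => Real.log (v t)) atTop atTop :=
    Real.tendsto_log_atTop.comp h.v_tendsto_atTop
  have hev : ∀ᶠ t in atTop, θ (Real.log (v t)) = t ∧ Real.exp (Real.log (v t)) = v t := by
    filter_upwards [eventually_ge_atTop t₀] with t ht
    exact ⟨hinv t ht (EReal.coe_lt_top t),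
      Real.exp_log (h.v_pos t (ha.trans_le ht) (EReal.coe_lt_top t))⟩
  rcases hcases with ⟨s₁, ε, hs₁, hε, hz⟩ | ⟨hpos, h1, h2, h3, h4⟩ | ⟨hneg, h1, h2, h3, h4⟩
  · left
    constructor
    · refine ⟨2 / ε, by positivity, ?_⟩
      filter_upwards [hev, hlogv.eventually_ge_atTop s₁] with t ht hs
      have := IsLogSoliton.ratio_bounds (x := fun s => x (θ s)) (hL.x_pos _ (hs₁.trans hs)) hε (hz _ hs)
      simp only [ht.1, ht.2] at this
      refine ⟨by rw [inv_div]; exact this.1, this.2.trans ?_⟩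
      rw [div_le_div_iff₀ (by positivity) hε]
      nlinarith
    · obtain ⟨-, c₁, c₂, k, hc, o1, o2⟩ := (hL.mono hs₁).conical hlam hε hz
      refine ⟨c₁, c₂, k, hc, ?_, ?_⟩
      · refine (o1.comp_tendsto hlogv).congr' ?_ ?_
        all_goals
          filter_upwards [hev] with t ht
          simp only [Function.comp, ht.1]
      · refine (o2.comp_tendsto hlogv).congr' ?_ ?_
        all_goals
          filter_upwards [hev] with t ht
          simp only [Function.comp, ht.1, ht.2]
  · refine Or.inr (Or.inl ⟨hpos, (h1.comp hlogv).congr' ?_, (h2.comp hlogv).congr' ?_,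
      (h3.comp hlogv).congr' ?_, (h4.comp hlogv).congr' ?_⟩)
    all_goals
      filter_upwards [hev] with t ht
      simp only [Function.comp, ht.1, ht.2]
  · refine Or.inr (Or.inr ⟨hneg, (h1.comp hlogv).congr' ?_, (h2.comp hlogv).congr' ?_,
      (h3.comp hlogv).congr' ?_, (h4.comp hlogv).congr' ?_⟩)
    all_goals
      filter_upwards [hev] with t ht
      simp only [Function.comp, ht.1, ht.2]

end IsReducedSoliton

/-! ### Classification of soliton ends -/

theorem slope_unique_of_isBigO_inv {f : ℝ → ℝ} {c c' k k' : ℝ}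
    (h : (fun t => f t - c * (t + k)) =O[atTop] (fun t : ℝ => t⁻¹))
    (h' : (fun t => f t - c' * (t + k')) =O[atTop] (fun t : ℝ => t⁻¹)) : c = c' := by
  have key : ∀ {c k : ℝ}, (fun t => f t - c * (t + k)) =O[atTop] (fun t : ℝ => t⁻¹) →
      Tendsto (fun t => f t * t⁻¹) atTop (𝓝 c) := by
    intro c k h
    have h0 := h.trans_tendsto tendsto_inv_atTop_zero
    have h1 := ((h0.add_const (c * k)).mul tendsto_inv_atTop_zero).const_add c
    rw [mul_zero, add_zero] at h1
    refine h1.congr' ?_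
    filter_upwards [eventually_gt_atTop 0] with t ht
    field_simp
    ring
  exact tendsto_nhds_unique (key h) (key h')

/-- `log f = log (t f) - log t`, and both terms are negligible against `t²`. This passes the growth
of `log (xy²)` on to `log y`. -/
theorem tendsto_log_div_sq_of_tendsto_mul {f : ℝ → ℝ} {c : ℝ} (hc : 0 < c)
    (hf : ∀ᶠ t in atTop, 0 < f t) (h : Tendsto (fun t => t * f t) atTop (𝓝 c)) :
    Tendsto (fun t => Real.log (f t) / t ^ 2) atTop (𝓝 0) := by
  have h1 : Tendsto (fun t => Real.log (t * f t) / t ^ 2) atTop (𝓝 0) :=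
    (h.log hc.ne').div_atTop (tendsto_pow_atTop two_ne_zero)
  have h2 : Tendsto (fun t : ℝ => Real.log t / t * t⁻¹) atTop (𝓝 0) := by
    have := Real.tendsto_pow_log_div_mul_add_atTop 1 0 1 one_ne_zero
    simp only [pow_one, one_mul, add_zero] at this
    simpa using this.mul tendsto_inv_atTop_zero
  have h3 := h1.sub h2
  rw [sub_zero] at h3
  refine h3.congr' ?_
  filter_upwards [eventually_gt_atTop 0, hf] with t ht hft
  rw [Real.log_mul ht.ne' hft.ne']
  field_simp
  ring

/-- The four possible asymptotic behaviours of a soliton end. -/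
theorem IsSp2SolitonEnd.classification {lam a : ℝ} {T : EReal} {x y τ₁ τ₂ u : ℝ → ℝ}
    (h : IsSp2SolitonEnd lam a T x y τ₁ τ₂ u) (hlam : lam ≠ 0) :
    (IsBoundedWarpingEnd T x y ∧
      ∃ c₁ c₂, IsClosedSp2Cone c₁ c₂ ∧ IsAsymptoticRateNegTwo x y c₁ c₂) ∨
    (IsUnboundedWarpingEnd T x y ∧ 0 < lam ∧
      Tendsto (fun t => t * x t) atTop (𝓝 (3 / lam)) ∧
      Tendsto (fun t => Real.log (x t * y t ^ 2) / t ^ 2) atTop (𝓝 (lam / 6)) ∧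
      Tendsto x atTop (𝓝 0) ∧
      Tendsto (fun t => Real.log (y t) / t ^ 2) atTop (𝓝 (lam / 12))) ∨
    (IsUnboundedWarpingEnd T x y ∧ lam < 0 ∧
      Tendsto (fun t => Real.log (x t) / t) atTop (𝓝 √(-lam / 18)) ∧
      Tendsto (fun t => y t ^ 4 / x t ^ 2) atTop (𝓝 (-9 / (8 * lam))) ∧
      Tendsto (fun t => Real.log (y t) / t) atTop (𝓝 (√(-lam / 18) / 2))) ∨
    ∃ b : ℝ, T = b ∧ Tendsto (fun t => y t / x t) (𝓝[<] b) atTop ∧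
      x =O[𝓝[<] b] (fun t => √(b - t)) ∧
      y =O[𝓝[<] b] (fun t => (b - t) ^ (-(1 / 4) : ℝ)) := by
  obtain ⟨t₀, ha, hT⟩ := EReal.lt_iff_exists_real_btwn.1 h.lt
  rw [EReal.coe_lt_coe_iff] at ha
  have hR := h.soliton.reduced
  -- Unbounded `xy²` corresponds to `T = ∞` and bounded `xy²` to `T < ∞`; the equivalence comes out
  -- of the two analyses.
  by_cases hunb : ∀ V, ∃ t : ℝ, t₀ ≤ t ∧ (t : EReal) < T ∧ V < x t * y t ^ 2
  · obtain ⟨rfl, hcases⟩ := hR.unbounded_asymptotics hlam ha hT hunb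
    have hpos : ∀ᶠ t in atTop, 0 < x t ∧ 0 < y t := by
      filter_upwards [eventually_gt_atTop a] with t ht
      exact ⟨h.soliton.x_pos t ht (EReal.coe_lt_top t), h.soliton.y_pos t ht (EReal.coe_lt_top t)⟩
    have hlog : ∀ᶠ t in atTop,
        Real.log (x t * y t ^ 2 / x t ^ 3) / 2 = Real.log (y t / x t) := by
      filter_upwards [hpos] with t ht
      obtain ⟨hx, hy⟩ := ht
      have e : x t * y t ^ 2 / x t ^ 3 = (y t / x t) ^ 2 := by field_simp
      rw [e, Real.log_pow]
      push_cast
      ring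
    have hlogv : ∀ᶠ t in atTop,
        Real.log (x t * y t ^ 2) = Real.log (x t) + 2 * Real.log (y t) := by
      filter_upwards [hpos] with t ht
      obtain ⟨hx, hy⟩ := ht
      rw [Real.log_mul hx.ne' (by positivity), Real.log_pow]
      push_cast
      ring
    rcases hcases with ⟨⟨C, hC, hb⟩, c₁, c₂, k, hc, o1, o2⟩ | ⟨hl, h1, h2, h3, h4⟩ |
      ⟨hl, h1, h2, h3, h4⟩
    · refine Or.inl ⟨⟨rfl, Real.log C / 2, ?_⟩, c₁, c₂, hc, k, o1, o2.congr' ?_ .rfl⟩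
      · filter_upwards [hb, hlog] with t ht hlt
        have hpos' : 0 < x t * y t ^ 2 / x t ^ 3 := (inv_pos.2 hC).trans_le ht.1
        have e1 := Real.log_le_log (inv_pos.2 hC) ht.1
        have e2 := Real.log_le_log hpos' ht.2
        rw [Real.log_inv] at e1
        rw [← hlt, abs_le]
        constructor <;> linarith
      · filter_upwards [hpos] with t ht
        rw [mul_div_cancel_left₀ _ ht.1.ne', Real.sqrt_sq ht.2.le]
    · refine Or.inr (Or.inl ⟨⟨rfl, ?_⟩, hl, h2, h3, h4, ?_⟩)
      · refine tendsto_abs_atTop_atTop.comp ((Tendsto.congr' hlog)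
          ((Real.tendsto_log_atTop.comp h1).atTop_div_const two_pos))
      · have h5 := tendsto_log_div_sq_of_tendsto_mul (div_pos three_pos hl)
          (hpos.mono fun t ht => ht.1) h2
        have h6 := (h3.sub h5).div_const 2
        rw [sub_zero, div_div] at h6
        norm_num at h6
        refine h6.congr' ?_
        filter_upwards [hlogv] with t ht
        rw [ht]
        ring
    · refine Or.inr (Or.inr (Or.inl ⟨⟨rfl, ?_⟩, hl, h2, h3.congr' ?_, ?_⟩))
      · have h5 : Tendsto (fun t => x t * y t ^ 2 / x t ^ 3) atTop (𝓝[>] 0) := by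
          refine tendsto_nhdsWithin_iff.2 ⟨h1, ?_⟩
          filter_upwards [hpos] with t ht
          obtain ⟨hx, hy⟩ := ht
          exact Set.mem_Ioi.2 (by positivity)
        exact tendsto_abs_atBot_atTop.comp ((Tendsto.congr' hlog)
          ((Real.tendsto_log_nhdsGT_zero.comp h5).atBot_div_const two_pos))
      · filter_upwards [hpos] with t ht
        obtain ⟨hx, hy⟩ := ht
        field_simp
      · have h6 := (h4.sub h2).div_const 2
        have e : (2 * √(-lam / 18) - √(-lam / 18)) / 2 = √(-lam / 18) / 2 := by ring
        rw [e] at h6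
        refine h6.congr' ?_
        filter_upwards [hlogv] with t ht
        rw [ht]
        ring
  · push Not at hunb
    obtain ⟨V, hV⟩ := hunb
    refine Or.inr (Or.inr (Or.inr ?_))
    induction T with
    | bot => exact absurd hT not_lt_bot
    | coe b =>
      exact ⟨b, rfl, h.finite_time_rates ha (EReal.coe_lt_coe_iff.1 hT)
        fun t h1 h2 => hV t h1 (EReal.coe_lt_coe_iff.2 h2)⟩
    | top =>
      obtain ⟨t, h1, h2⟩ := ((hR.v_tendsto_atTop.eventually_gt_atTop V).and
        (eventually_ge_atTop t₀)).exists
      exact absurd h1 (not_lt.2 (hV t h2 (EReal.coe_lt_top t)))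

theorem not_bounded_and_unbounded_warping {T : EReal} {x y : ℝ → ℝ} :
    ¬ (IsBoundedWarpingEnd T x y ∧ IsUnboundedWarpingEnd T x y) := by
  rintro ⟨⟨-, C, hC⟩, -, hu⟩
  obtain ⟨t, h1, h2⟩ := (hC.and (hu.eventually_gt_atTop C)).exists
  exact absurd h1 (not_le.2 h2)

theorem theoremD (lam : ℝ) (hlam : lam ≠ 0) (a : ℝ) (T : EReal) (x y τ₁ τ₂ u : ℝ → ℝ)
    (hend : IsSp2SolitonEnd lam a T x y τ₁ τ₂ u) :
    -- exactly one of the three cases occurs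
    ((IsBoundedWarpingEnd T x y ∨ IsUnboundedWarpingEnd T x y ∨ IsForwardIncompleteEnd T) ∧
      ¬ (IsBoundedWarpingEnd T x y ∧ IsUnboundedWarpingEnd T x y) ∧
      ¬ (IsBoundedWarpingEnd T x y ∧ IsForwardIncompleteEnd T) ∧
      ¬ (IsUnboundedWarpingEnd T x y ∧ IsForwardIncompleteEnd T)) ∧
    -- (i)
    (IsBoundedWarpingEnd T x y →
      ∃! c : ℝ × ℝ, IsClosedSp2Cone c.1 c.2 ∧ IsAsymptoticRateNegTwo x y c.1 c.2) ∧
    -- (ii.a)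
    (IsUnboundedWarpingEnd T x y → 0 < lam →
      Tendsto (fun t => t * x t) atTop (𝓝 (3 / lam)) ∧
      Tendsto (fun t => Real.log (x t * y t ^ 2) / t ^ 2) atTop (𝓝 (lam / 6)) ∧
      Tendsto x atTop (𝓝 0) ∧
      Tendsto (fun t => Real.log (y t) / t ^ 2) atTop (𝓝 (lam / 12))) ∧
    -- (ii.b)
    (IsUnboundedWarpingEnd T x y → lam < 0 →
      Tendsto (fun t => Real.log (x t) / t) atTop (𝓝 (Real.sqrt (-lam / 18))) ∧
      Tendsto (fun t => y t ^ 4 / x t ^ 2) atTop (𝓝 (-9 / (8 * lam))) ∧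
      Tendsto (fun t => Real.log (y t) / t) atTop (𝓝 (Real.sqrt (-lam / 18) / 2))) ∧
    -- (iii)
    (∀ tstar : ℝ, T = (tstar : EReal) →
      Tendsto (fun t => y t / x t) (𝓝[<] tstar) atTop ∧
      x =O[𝓝[<] tstar] (fun t => Real.sqrt (tstar - t)) ∧
      y =O[𝓝[<] tstar] (fun t => (tstar - t) ^ (-(1 / 4) : ℝ))) := by
  have hBU := not_bounded_and_unbounded_warping (T := T) (x := x) (y := y)
  have hBF : ¬ (IsBoundedWarpingEnd T x y ∧ IsForwardIncompleteEnd T) := by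
    rintro ⟨⟨rfl, -⟩, b, hb⟩
    exact EReal.coe_ne_top b hb.symm
  have hUF : ¬ (IsUnboundedWarpingEnd T x y ∧ IsForwardIncompleteEnd T) := by
    rintro ⟨⟨rfl, -⟩, b, hb⟩
    exact EReal.coe_ne_top b hb.symm
  rcases hend.classification hlam with ⟨hB, c₁, c₂, hc, hasy⟩ | ⟨hU, hpos, hlim⟩ |
    ⟨hU, hneg, hlim⟩ | ⟨b, rfl, hrates⟩
  · refine ⟨⟨Or.inl hB, hBU, hBF, hUF⟩, fun _ => ⟨(c₁, c₂), ⟨hc, hasy⟩, ?_⟩,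
      fun hU => absurd ⟨hB, hU⟩ hBU, fun hU => absurd ⟨hB, hU⟩ hBU,
      fun b hb => absurd ⟨hB, b, hb⟩ hBF⟩
    rintro ⟨d₁, d₂⟩ ⟨-, k', o1', o2'⟩
    obtain ⟨k, o1, o2⟩ := hasy
    exact Prod.ext (slope_unique_of_isBigO_inv o1' o1) (slope_unique_of_isBigO_inv o2' o2)
  · exact ⟨⟨Or.inr (Or.inl hU), hBU, hBF, hUF⟩, fun hB => absurd ⟨hB, hU⟩ hBU,
      fun _ _ => hlim, fun _ hneg => absurd hneg hpos.not_gt,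
      fun b hb => absurd ⟨hU, b, hb⟩ hUF⟩
  · exact ⟨⟨Or.inr (Or.inl hU), hBU, hBF, hUF⟩, fun hB => absurd ⟨hB, hU⟩ hBU,
      fun _ hpos => absurd hneg hpos.not_gt, fun _ _ => hlim,
      fun b hb => absurd ⟨hU, b, hb⟩ hUF⟩
  · have hF : IsForwardIncompleteEnd (b : EReal) := ⟨b, rfl⟩
    refine ⟨⟨Or.inr (Or.inr hF), hBU, hBF, hUF⟩, fun hB => absurd ⟨hB, hF⟩ hBF,
      fun hU => absurd ⟨hU, hF⟩ hUF, fun hU => absurd ⟨hU, hF⟩ hUF, fun b' hb' => ?_⟩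
    rw [← EReal.coe_eq_coe_iff.1 hb']
    exact hrates
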